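/- Let $\theta>0$, $\Omega\in\,]0,1]$, $\Theta=\theta\begin{pmatrix}0&1\\-1&0\end{pmatrix}$ and $\tilde x_\mu=2\Theta^{-1}_{\mu\nu}x^\nu$ (summation over repeated indices in $\{1,2\}$). Let $\mathcal A=(\mathcal S(\mathbb R^2),\star)$ be the algebra of Schwartz functions with complex conjugation as involution and the Moyal product $$(f\star g)(x)=\frac1{(\pi\theta)^2}\int d^2y\,d^2z\,f(x+y)\,g(x+z)\,e^{-2i\,y^\mu\Theta^{-1}_{\mu\nu}z^\nu}.$$ Let $\mathcal H=L^2(\mathbb R^2)\otimes\mathbb C^2\otimes\mathbb C^2$ and $\pi(a)=L(a)\otimes 1$, where $L(a)$ is the bounded operator on $L^2(\mathbb R^2)$ that extends $\psi\mapsto a\star\psi$. With $\sigma^1=\begin{pmatrix}0&1\\1&0\end{pmatrix}$, $\sigma^2=\begin{pmatrix}0&i\\-i&0\end{pmatrix}$, $\sigma^3=i\sigma^1\sigma^2$, let $D_1$ and $D_2$ be the closures of the operators $$(1\otimes\sigma^\mu)(-i\partial_\mu)-\Omega(\sigma^\mu\otimes\sigma^3)\tilde x_\mu,\qquad (\sigma^3\otimes\sigma^\mu)(-i\partial_\mu)-\Omega(\sigma^\mu\otimes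 1)\tilde x_\mu$$ defined on $\mathcal S(\mathbb R^2)\otimes\mathbb C^2\otimes\mathbb C^2$. Put $\mathfrak X(k)=(\mathcal A,\pi,\mathcal H,D_k)$, $k=1,2$. A triple $(\mathbb A,\pi,H,D)$ is a spectral triple if $\mathbb A$ is an involutive algebra, $\pi$ is a faithful $*$-representation of $\mathbb A$ by bounded operators on the separable Hilbert space $H$, $D$ is a densely defined self-adjoint operator on $H$ whose domain is preserved by every $\pi(a)$, all commutators $[D,\pi(a)]$ are bounded, and $\pi(a)(D-\lambda)^{-1}$ is compact for all $a\in\mathbb A$ and all $\lambda$ outside the spectrum of $D$. For a non-unital algebra such as $\mathcal A$ it is a spectral metric space if in addition $\pi$ is non-degenerate and $[D,\pi(a)]=0$ only for $a=0$. A state is a positive linear functional on $\mathbb A$ of norm $1$ with respect to the norm $\|\pi(a)\|$, and the spectral distance of two states is $$d_D(\omega_1,\omega_2)=\sup\{|\omega_1(a)-\omega_2(a)|:\ a\in\mathbb A,\ \|[D,\pi(a)]\|\le1\}\in[0,\infty].$$ Then, for $k=1,2$, $\mathfrak X(k)$ is a spectral metric space, and its state space with the topology of $d_{D_k}$ has infinitely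 many distinct connected components, each of which is path-connected. -/

import Mathlib

open MeasureTheory SchwartzMap
open scoped ENNReal NNReal ContDiff Matrix Kronecker ComplexOrder FourierTransform

noncomputable section

/-- The data of a triple `(A, π, H, D)`: a product and an involution on the complex vector space `A`,
a map `π` to the bounded operators on the Hilbert space `H`, and an unbounded operator `D` on `H`.
The laws that these data have to satisfy are in `TripleData.IsSpectralTriple`. -/
structure TripleData (A H : Type*) [AddCommGroup A] [Module ℂ A] [NormedAddCommGroup H]
    [InnerProductSpace ℂ H] [CompleteSpace H] where
  prod : A → A → A
  inv : A → A
  rep : A → (H →L[ℂ] H)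
  dirac : H →ₗ.[ℂ] H

namespace TripleData

variable {A H : Type*} [AddCommGroup A] [Module ℂ A] [NormedAddCommGroup H]
  [InnerProductSpace ℂ H] [CompleteSpace H]

/-- `π(a)` preserves the domain of `D` and `T` is a bounded operator on `H` that is equal to
`[D, π(a)] = D π(a) - π(a) D` on the domain of `D`. -/
def IsCommutator (X : TripleData A H) (a : A) (T : H →L[ℂ] H) : Prop :=
  ∀ ψ : X.dirac.domain, ∃ h : X.rep a ψ ∈ X.dirac.domain,
    T ψ = X.dirac ⟨X.rep a ψ, h⟩ - X.rep a (X.dirac ψ)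

/-- `R` is the resolvent `(D - z)⁻¹`, a bounded operator; it exists if and only if `z` is not in the
spectrum of `D`. -/
def IsResolvent (X : TripleData A H) (z : ℂ) (R : H →L[ℂ] H) : Prop :=
  (∀ φ : H, ∃ h : R φ ∈ X.dirac.domain, X.dirac ⟨R φ, h⟩ - z • R φ = φ) ∧
  ∀ ψ : X.dirac.domain, R (X.dirac ψ - z • (ψ : H)) = ψ

/-- Spectral triples. -/
structure IsSpectralTriple (X : TripleData A H) : Prop where
  separable : TopologicalSpace.SeparableSpace H
  -- `A` is an associative algebra with involution
  prod_add : ∀ a b c, X.prod a (b + c) = X.prod a b + X.prod a c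
  add_prod : ∀ a b c, X.prod (a + b) c = X.prod a c + X.prod b c
  smul_prod : ∀ (t : ℂ) a b, X.prod (t • a) b = t • X.prod a b
  prod_smul : ∀ (t : ℂ) a b, X.prod a (t • b) = t • X.prod a b
  prod_assoc : ∀ a b c, X.prod (X.prod a b) c = X.prod a (X.prod b c)
  inv_add : ∀ a b, X.inv (a + b) = X.inv a + X.inv b
  inv_smul : ∀ (t : ℂ) a, X.inv (t • a) = (starRingEnd ℂ) t • X.inv a
  inv_inv : ∀ a, X.inv (X.inv a) = a
  inv_prod : ∀ a b, X.inv (X.prod a b) = X.prod (X.inv b) (X.inv a)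
  -- `π` is a faithful representation compatible with the involutions
  rep_add : ∀ a b, X.rep (a + b) = X.rep a + X.rep b
  rep_smul : ∀ (t : ℂ) a, X.rep (t • a) = t • X.rep a
  rep_prod : ∀ a b, X.rep (X.prod a b) = X.rep a ∘L X.rep b
  rep_inv : ∀ a, X.rep (X.inv a) = ContinuousLinearMap.adjoint (X.rep a)
  rep_faithful : Function.Injective X.rep
  -- `D` is self-adjoint with dense domain, and the domain is preserved by `π(a)`
  dense_domain : Dense (X.dirac.domain : Set H)
  self_adjoint : IsSelfAdjoint X.dirac
  rep_domain : ∀ a, ∀ ψ ∈ X.dirac.domain, X.rep a ψ ∈ X.dirac.domain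
  -- the commutators `[D, π(a)]` are bounded
  bounded_commutator : ∀ a, ∃ T : H →L[ℂ] H, X.IsCommutator a T
  -- the operators `π(a) (D - z)⁻¹`, for `z` not in the spectrum of `D`, are compact
  compact_resolvent : ∀ (a : A) (z : ℂ) (R : H →L[ℂ] H), X.IsResolvent z R →
    IsCompactOperator (X.rep a ∘L R)

/-- A spectral metric space: a spectral triple such that `π` is non-degenerate, i.e. the vectors
`π(a) ψ` span a dense subspace, and the metric commutant `{a | [D, π(a)] = 0}` is trivial, which means `{0}`
for the non-unital algebras considered here. -/
structure IsSpectralMetricSpace (X : TripleData A H) : Prop extends X.IsSpectralTriple where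
  nondegenerate : Dense (Submodule.span ℂ {φ : H | ∃ a ψ, φ = X.rep a ψ} : Set H)
  metric_commutant : {a : A | X.IsCommutator a 0} = {0}

/-- States: positive linear functionals of norm one with respect to the operator norm `‖π(a)‖`. -/
structure State (X : TripleData A H) where
  toFun : A →ₗ[ℂ] ℂ
  positive : ∀ a, 0 ≤ toFun (X.prod (X.inv a) a)
  unit_norm : IsLeast {C : ℝ | 0 ≤ C ∧ ∀ a, ‖toFun a‖ ≤ C * ‖X.rep a‖} 1

/-- The seminorm `ℓ_D(a) = ‖[D, π(a)]‖`, with value `∞` when the commutator is not a bounded operator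
(for a densely defined `D` there is at most one `T` in this infimum). -/
def lipNorm (X : TripleData A H) (a : A) : ℝ≥0∞ :=
  ⨅ (T : H →L[ℂ] H) (_ : X.IsCommutator a T), ‖T‖ₑ

/-- The spectral distance, with values in `[0, ∞]`. -/
def spectralDist (X : TripleData A H) (ρ₁ ρ₂ : X.State) : ℝ≥0∞ :=
  ⨆ (a : A) (_ : X.lipNorm a ≤ 1), ‖ρ₁.toFun a - ρ₂.toFun a‖ₑ

/-- The state space carries the spectral distance and the topology of its open balls. -/
instance (X : TripleData A H) : PseudoEMetricSpace X.State :=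
  PseudoEMetricSpace.ofEDist X.spectralDist
    (fun ρ => by simp [spectralDist])
    (fun ρ₁ ρ₂ => by simp only [spectralDist, ← edist_eq_enorm_sub, edist_comm])
    (fun ρ₁ ρ₂ ρ₃ => by
      refine iSup₂_le fun a ha => ?_
      simp only [spectralDist, ← edist_eq_enorm_sub]
      refine (edist_triangle _ (ρ₂.toFun a) _).trans (add_le_add ?_ ?_)
      · exact le_iSup₂ (f := fun a (_ : X.lipNorm a ≤ 1) => edist (ρ₁.toFun a) (ρ₂.toFun a)) a ha
      · exact le_iSup₂ (f := fun a (_ : X.lipNorm a ≤ 1) => edist (ρ₂.toFun a) (ρ₃.toFun a)) a ha)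

end TripleData

namespace Moyal

/-- The plane `ℝ²`, with coordinates `x 0`, `x 1`. -/
abbrev Plane : Type := EuclideanSpace ℝ (Fin 2)

/-- The matrix `Θ = θ [[0, 1], [-1, 0]]`. -/
def Theta (θ : ℝ) : Matrix (Fin 2) (Fin 2) ℝ := θ • !![0, 1; -1, 0]

/-- The Moyal product as a function on the plane,
`(f ⋆ g)(x) = (π θ)⁻² ∫∫ f(x + y) g(x + z) exp(-2 i y^μ Θ⁻¹_{μν} z^ν) dy dz`. -/
def moyalFun (θ : ℝ) (f g : 𝓢(Plane, ℂ)) (x : Plane) : ℂ :=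
  ((1 / (Real.pi * θ) ^ 2 : ℝ) : ℂ) * ∫ y : Plane, ∫ z : Plane, f (x + y) * g (x + z) *
    Complex.exp (-Complex.I * 2 * ((∑ μ, ∑ ν, y μ * (Theta θ)⁻¹ μ ν * z ν : ℝ) : ℂ))

theorem theta_inv (θ : ℝ) : (Theta θ)⁻¹ = θ⁻¹ • !![0, -1; 1, 0] := by
  rcases eq_or_ne θ 0 with rfl | h
  · simp [Theta]
  · apply Matrix.inv_eq_right_inv
    ext i j
    fin_cases i <;> fin_cases j <;> simp [Theta, Matrix.mul_apply, h]

theorem theta_form (θ : ℝ) (y z : Plane) :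
    ∑ μ, ∑ ν, y μ * (Theta θ)⁻¹ μ ν * z ν = θ⁻¹ * (y 1 * z 0 - y 0 * z 1) := by
  rw [theta_inv]
  simp [Fin.sum_univ_two]
  ring

/-- Auxiliary: `ℝ² × ℝ²` with its Euclidean norm. It and the following facts only serve to show that the
Moyal product of two Schwartz functions is a Schwartz function. -/
abbrev Plane2 : Type := WithLp 2 (Plane × Plane)

theorem tensor_decay (f g : 𝓢(Plane, ℂ)) (k n : ℕ) : ∃ C : ℝ, ∀ w : Plane2,
    ‖w‖ ^ k * ‖iteratedFDeriv ℝ n (fun w : Plane2 => f w.fst * g w.snd) w‖ ≤ C := by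
  set p : Plane2 →L[ℝ] Plane := WithLp.fstL 2 ℝ Plane Plane
  set q : Plane2 →L[ℝ] Plane := WithLp.sndL 2 ℝ Plane Plane
  have key : ∀ (h : 𝓢(Plane, ℂ)) (r : Plane2 →L[ℝ] Plane), (∀ w, ‖r w‖ ≤ ‖w‖) → ∀ i ≤ n,
      ∃ C : ℝ, 0 ≤ C ∧ ∀ w, (1 + ‖r w‖) ^ k * ‖iteratedFDeriv ℝ i (h ∘ r) w‖ ≤ C := by
    intro h r hr i hi
    refine ⟨2 ^ k * (Finset.Iic (k, n)).sup (fun m => SchwartzMap.seminorm ℝ m.1 m.2) h,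
      by positivity, fun w => ?_⟩
    have h1 := one_add_le_sup_seminorm_apply (𝕜 := ℝ) (m := (k, n)) (k := k) (n := i)
      le_rfl hi h (r w)
    refine le_trans ?_ h1
    gcongr
    rw [ContinuousLinearMap.iteratedFDeriv_comp_right r (h.smooth i) w le_rfl]
    refine (ContinuousMultilinearMap.norm_compContinuousLinearMap_le _ _).trans ?_
    have : ‖r‖ ≤ 1 := r.opNorm_le_bound zero_le_one (by simpa using hr)
    simp only [Finset.prod_const]
    exact mul_le_of_le_one_right (norm_nonneg _) (pow_le_one₀ (norm_nonneg _) this)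
  have hp : ∀ w, ‖p w‖ ≤ ‖w‖ := fun w => WithLp.norm_fst_le _ w
  have hq : ∀ w, ‖q w‖ ≤ ‖w‖ := fun w => WithLp.norm_snd_le _ w
  have kp : ∀ i : ℕ, ∃ C : ℝ, 0 ≤ C ∧ ∀ w, i ≤ n →
      (1 + ‖p w‖) ^ k * ‖iteratedFDeriv ℝ i (f ∘ p) w‖ ≤ C := fun i => by
    by_cases hi : i ≤ n
    · obtain ⟨C, h0, h⟩ := key f p hp i hi
      exact ⟨C, h0, fun w _ => h w⟩
    · exact ⟨0, le_rfl, fun w h => absurd h hi⟩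
  have kq : ∀ i : ℕ, ∃ C : ℝ, 0 ≤ C ∧ ∀ w, i ≤ n →
      (1 + ‖q w‖) ^ k * ‖iteratedFDeriv ℝ i (g ∘ q) w‖ ≤ C := fun i => by
    by_cases hi : i ≤ n
    · obtain ⟨C, h0, h⟩ := key g q hq i hi
      exact ⟨C, h0, fun w _ => h w⟩
    · exact ⟨0, le_rfl, fun w h => absurd h hi⟩
  choose A hA0 hA using kp
  choose B hB0 hB using kq
  refine ⟨∑ i ∈ Finset.range (n + 1), (n.choose i : ℝ) * (A i * B (n - i)), fun w => ?_⟩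
  have h1 := norm_iteratedFDeriv_mul_le (𝕜 := ℝ) (N := ∞) (f := f ∘ p) (g := g ∘ q)
    ((f.smooth ⊤).comp p.contDiff) ((g.smooth ⊤).comp q.contDiff) w (n := n)
    (mod_cast le_top)
  have h2 : ‖w‖ ≤ (1 + ‖p w‖) * (1 + ‖q w‖) := by
    have : ‖w‖ ≤ ‖p w‖ + ‖q w‖ := by
      rw [WithLp.prod_norm_eq_of_L2]
      apply Real.sqrt_le_iff.2
      refine ⟨by positivity, ?_⟩
      have e1 : w.fst = p w := rfl
      have e2 : w.snd = q w := rfl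
      rw [e1, e2]
      nlinarith [norm_nonneg (p w), norm_nonneg (q w)]
    nlinarith [norm_nonneg (p w), norm_nonneg (q w), mul_nonneg (norm_nonneg (p w)) (norm_nonneg (q w))]
  calc ‖w‖ ^ k * ‖iteratedFDeriv ℝ n (fun w : Plane2 => f w.fst * g w.snd) w‖
      ≤ ((1 + ‖p w‖) * (1 + ‖q w‖)) ^ k * ∑ i ∈ Finset.range (n + 1), (n.choose i : ℝ) *
        ‖iteratedFDeriv ℝ i (f ∘ p) w‖ * ‖iteratedFDeriv ℝ (n - i) (g ∘ q) w‖ := by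
        gcongr
        exact h1
    _ = ∑ i ∈ Finset.range (n + 1), (n.choose i : ℝ) *
        (((1 + ‖p w‖) ^ k * ‖iteratedFDeriv ℝ i (f ∘ p) w‖) *
        ((1 + ‖q w‖) ^ k * ‖iteratedFDeriv ℝ (n - i) (g ∘ q) w‖)) := by
        rw [Finset.mul_sum]
        refine Finset.sum_congr rfl fun i _ => ?_
        rw [mul_pow]; ring
    _ ≤ _ := by
        refine Finset.sum_le_sum fun i hi => ?_
        have hi' : i ≤ n := Nat.lt_succ_iff.1 (Finset.mem_range.1 hi)
        have := hA0 i
        gcongr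
        · exact hA i w hi'
        · exact hB (n - i) w (Nat.sub_le _ _)

/-- The Schwartz function `(u, v) ↦ f u * g v`. -/
def tensor (f g : 𝓢(Plane, ℂ)) : 𝓢(Plane2, ℂ) where
  toFun w := f w.fst * g w.snd
  smooth' := ((f.smooth ⊤).comp (WithLp.fstL 2 ℝ Plane Plane).contDiff).mul
    ((g.smooth ⊤).comp (WithLp.sndL 2 ℝ Plane Plane).contDiff)
  decay' := tensor_decay f g

theorem expI_growth : Function.HasTemperateGrowth (fun t : ℝ => Complex.exp (Complex.I * t)) := by
  have hd : ContDiff ℝ ∞ (fun t : ℝ => Complex.exp (Complex.I * t)) :=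
    Complex.contDiff_exp.comp (contDiff_const.mul Complex.ofRealCLM.contDiff)
  have hder : ∀ n : ℕ, iteratedDeriv n (fun t : ℝ => Complex.exp (Complex.I * t))
      = fun t : ℝ => Complex.I ^ n * Complex.exp (Complex.I * t) := by
    intro n
    induction n with
    | zero => simp
    | succ n ih =>
      rw [iteratedDeriv_succ, ih]
      ext t
      have h1 : HasDerivAt (fun t : ℝ => Complex.I * (t : ℂ)) (Complex.I * 1) t :=
        (Complex.ofRealCLM.hasDerivAt (x := t)).const_mul Complex.I
      have h2 := (h1.cexp).const_mul (Complex.I ^ n)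
      rw [h2.deriv]
      ring
  refine ⟨hd, fun n => ⟨0, 1, fun t => ?_⟩⟩
  rw [norm_iteratedFDeriv_eq_norm_iteratedDeriv, hder]
  simp [Complex.norm_exp]

/-- The oscillating factor `exp(-2 i u^μ Θ⁻¹_{μν} v^ν)`. -/
def phase (θ : ℝ) (w : Plane2) : ℂ :=
  Complex.exp (Complex.I * ((-2 * (θ⁻¹ * (w.fst 1 * w.snd 0 - w.fst 0 * w.snd 1)) : ℝ) : ℂ))

theorem phase_growth (θ : ℝ) : (phase θ).HasTemperateGrowth := by
  have c : ∀ i : Fin 2, Function.HasTemperateGrowth (fun w : Plane2 => w.fst i) := fun i =>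
    ((EuclideanSpace.proj i : Plane →L[ℝ] ℝ) ∘L WithLp.fstL 2 ℝ Plane Plane).hasTemperateGrowth
  have d : ∀ i : Fin 2, Function.HasTemperateGrowth (fun w : Plane2 => w.snd i) := fun i =>
    ((EuclideanSpace.proj i : Plane →L[ℝ] ℝ) ∘L WithLp.sndL 2 ℝ Plane Plane).hasTemperateGrowth
  have e : Function.HasTemperateGrowth (fun w : Plane2 =>
      -2 * (θ⁻¹ * (w.fst 1 * w.snd 0 - w.fst 0 * w.snd 1))) := by
    exact (Function.HasTemperateGrowth.const (-2 : ℝ)).mul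
      ((Function.HasTemperateGrowth.const θ⁻¹).mul (((c 1).mul (d 0)).sub ((c 0).mul (d 1))))
  exact expI_growth.comp e

/-- The linear map `x ↦ (J x, -J x) / (π θ)`, where `J x = (x 1, -x 0)`. -/
def freq (θ : ℝ) : Plane →L[ℝ] Plane2 :=
  (Real.pi⁻¹ * θ⁻¹) • ((WithLp.prodContinuousLinearEquiv 2 ℝ Plane Plane).symm.toContinuousLinearMap ∘L
    ((Matrix.toEuclideanLin !![0, 1; -1, 0]).toContinuousLinearMap.prod
      (Matrix.toEuclideanLin !![0, -1; 1, 0]).toContinuousLinearMap))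

theorem freq_apply (θ : ℝ) (x : Plane) : (freq θ x).fst 0 = Real.pi⁻¹ * θ⁻¹ * x 1 ∧
    (freq θ x).fst 1 = -(Real.pi⁻¹ * θ⁻¹ * x 0) ∧ (freq θ x).snd 0 = -(Real.pi⁻¹ * θ⁻¹ * x 1) ∧
    (freq θ x).snd 1 = Real.pi⁻¹ * θ⁻¹ * x 0 := by
  refine ⟨?_, ?_, ?_, ?_⟩ <;> simp [freq, Matrix.toLpLin_apply, Matrix.vecHead, Matrix.vecTail]

theorem freq_upper {θ : ℝ} (hθ : θ ≠ 0) :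
    ∃ (k : ℕ) (C : ℝ), ∀ x, ‖x‖ ≤ C * (1 + ‖freq θ x‖) ^ k := by
  have hi : Function.Injective (freq θ).toLinearMap := by
    rw [← LinearMap.ker_eq_bot, LinearMap.ker_eq_bot']
    intro x hx
    have hc : Real.pi⁻¹ * θ⁻¹ ≠ 0 := by positivity
    have hx' : freq θ x = 0 := hx
    obtain ⟨h0, -, -, h1⟩ := freq_apply θ x
    rw [hx'] at h0 h1
    have e0 : x 0 = 0 := (mul_eq_zero.1 h1.symm).resolve_left hc
    have e1 : x 1 = 0 := (mul_eq_zero.1 h0.symm).resolve_left hc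
    ext i
    fin_cases i
    · exact e0
    · exact e1
  obtain ⟨K, -, hK⟩ := (freq θ).toLinearMap.exists_antilipschitzWith (LinearMap.ker_eq_bot.2 hi)
  refine ⟨1, K, fun x => ?_⟩
  have h1 := hK.le_mul_dist x 0
  rw [map_zero, dist_zero_right, dist_zero_right] at h1
  have h2 : ‖x‖ ≤ K * ‖freq θ x‖ := h1
  refine h2.trans ?_
  rw [pow_one]
  gcongr
  simp

/-- The Moyal product written as a restricted Fourier transform. -/
def moyalAux {θ : ℝ} (hθ : θ ≠ 0) (f g : 𝓢(Plane, ℂ)) : 𝓢(Plane, ℂ) :=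
  ((1 / (Real.pi * θ) ^ 2 : ℝ) : ℂ) • SchwartzMap.compCLM ℂ (freq θ).hasTemperateGrowth
    (freq_upper hθ) (𝓕 (SchwartzMap.smulLeftCLM ℂ (phase θ) (tensor f g)))

theorem moyalAux_eq {θ : ℝ} (hθ : θ ≠ 0) (f g : 𝓢(Plane, ℂ)) :
    ⇑(moyalAux hθ f g) = moyalFun θ f g := by
  ext x
  have h0 : moyalAux hθ f g x = ((1 / (Real.pi * θ) ^ 2 : ℝ) : ℂ) *
      𝓕 (SchwartzMap.smulLeftCLM ℂ (phase θ) (tensor f g) : Plane2 → ℂ) (freq θ x) := rfl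
  rw [h0, moyalFun]
  congr 1
  set G := SchwartzMap.smulLeftCLM ℂ (phase θ) (tensor f g)
  have hG : ∀ w, G w = phase θ w * (f w.fst * g w.snd) := fun w =>
    smulLeftCLM_apply_apply (phase_growth θ) _ _
  set F : Plane → Plane → ℂ := fun u v =>
    Complex.exp (((-2 * Real.pi * inner ℝ (WithLp.toLp 2 (u, v) : Plane2) (freq θ x) : ℝ) : ℂ) * Complex.I) * G (WithLp.toLp 2 (u, v)) with hF
  have hint : Integrable (fun w : Plane2 => Complex.exp (((-2 * Real.pi * inner ℝ w (freq θ x) : ℝ) : ℂ)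
      * Complex.I) * G w) := by
    refine G.integrable.bdd_mul (c := 1) ?_ ?_
    · fun_prop
    · refine Filter.Eventually.of_forall fun w => ?_
      rw [Complex.norm_exp_ofReal_mul_I]
  have hint2 : Integrable (fun p : Plane × Plane => F p.1 p.2) (volume.prod volume) :=
    (WithLp.volume_preserving_toLp Plane Plane).integrable_comp_of_integrable hint
  calc 𝓕 (G : Plane2 → ℂ) (freq θ x)
      = ∫ w : Plane2, Complex.exp (((-2 * Real.pi * inner ℝ w (freq θ x) : ℝ) : ℂ) * Complex.I) * G w := by
        rw [Real.fourier_eq']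
        simp only [smul_eq_mul]
    _ = ∫ p : Plane × Plane, F p.1 p.2 := by
        have := (WithLp.volume_preserving_toLp Plane Plane).integral_comp
          (MeasurableEquiv.toLp 2 (Plane × Plane)).measurableEmbedding
          (fun w : Plane2 => Complex.exp (((-2 * Real.pi * inner ℝ w (freq θ x) : ℝ) : ℂ) * Complex.I) * G w)
        exact this.symm
    _ = ∫ u : Plane, ∫ v : Plane, F u v := integral_prod _ hint2
    _ = ∫ y : Plane, ∫ v : Plane, F (x + y) v := (integral_add_left_eq_self (fun u => ∫ v, F u v) x).symm
    _ = ∫ y : Plane, ∫ z : Plane, F (x + y) (x + z) := by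
        congr 1
        ext y
        exact (integral_add_left_eq_self (fun v => F (x + y) v) x).symm
    _ = _ := by
        congr 1
        ext y
        congr 1
        ext z
        rw [theta_form, hF]
        simp only [hG, phase]
        rw [← mul_assoc, ← Complex.exp_add, mul_comm]
        congr 2
        obtain ⟨h0, h1, h2, h3⟩ := freq_apply θ x
        simp [Fin.sum_univ_two, PiLp.inner_apply, WithLp.prod_inner_apply]
        simp only [h0, h1, h2, h3]
        push_cast
        have : (Real.pi : ℂ) ≠ 0 := by exact_mod_cast Real.pi_ne_zero
        field_simp
        ring

theorem exists_moyal (θ : ℝ) (f g : 𝓢(Plane, ℂ)) : ∃ h : 𝓢(Plane, ℂ), ⇑h = moyalFun θ f g := by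
  rcases eq_or_ne θ 0 with rfl | hθ
  · exact ⟨0, by ext x; simp [moyalFun]⟩
  · exact ⟨moyalAux hθ f g, moyalAux_eq hθ f g⟩

/-- The Moyal product of two Schwartz functions, as a Schwartz function. -/
def moyalProd (θ : ℝ) (f g : 𝓢(Plane, ℂ)) : 𝓢(Plane, ℂ) where
  toFun := moyalFun θ f g
  smooth' := by
    obtain ⟨h, hh⟩ := exists_moyal θ f g
    exact hh ▸ h.smooth'
  decay' := by
    obtain ⟨h, hh⟩ := exists_moyal θ f g
    exact hh ▸ h.decay'

theorem moyalProd_apply (θ : ℝ) (f g : 𝓢(Plane, ℂ)) (x : Plane) : moyalProd θ f g x = moyalFun θ f g x := rfl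

theorem moyalProd_eq_moyalAux {θ : ℝ} (hθ : θ ≠ 0) (f g : 𝓢(Plane, ℂ)) :
    moyalProd θ f g = moyalAux hθ f g := by
  ext x
  rw [moyalProd_apply, moyalAux_eq]

theorem moyalProd_zero_param (f g : 𝓢(Plane, ℂ)) : moyalProd 0 f g = 0 := by
  ext x
  simp [moyalProd_apply, moyalFun]

/-- Left Moyal multiplication `ψ ↦ a ⋆ ψ` on the Schwartz space, as a linear map. -/
def moyalLeft (θ : ℝ) (a : 𝓢(Plane, ℂ)) : 𝓢(Plane, ℂ) →ₗ[ℂ] 𝓢(Plane, ℂ) where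
  toFun := moyalProd θ a
  map_add' f g := by
    rcases eq_or_ne θ 0 with rfl | hθ
    · simp [moyalProd_zero_param]
    · have : tensor a (f + g) = tensor a f + tensor a g := by
        ext w
        exact mul_add _ _ _
      simp only [moyalProd_eq_moyalAux hθ, moyalAux, this, map_add, FourierTransform.fourier_add, smul_add]
  map_smul' c f := by
    rcases eq_or_ne θ 0 with rfl | hθ
    · simp [moyalProd_zero_param]
    · have : tensor a (c • f) = c • tensor a f := by
        ext w
        exact mul_left_comm _ _ _
      simp only [moyalProd_eq_moyalAux hθ, moyalAux, this, map_smul, FourierTransform.fourier_smul,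
        RingHom.id_apply]
      rw [smul_comm]

/-- The involution of the Moyal algebra: complex conjugation. -/
def conj (f : 𝓢(Plane, ℂ)) : 𝓢(Plane, ℂ) :=
  f.postcompCLM (Complex.conjCLE : ℂ →L[ℝ] ℂ)

theorem conj_apply (f : 𝓢(Plane, ℂ)) (x : Plane) : conj f x = (starRingEnd ℂ) (f x) := rfl

/-- The Hilbert space `L²(ℝ²)`. -/
abbrev L2 : Type := Lp ℂ 2 (volume : Measure Plane)

/-- The operator `L(a)` on `L²(ℝ²)`: the continuous extension of `ψ ↦ a ⋆ ψ` from the Schwartz space. -/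
def leftMul (θ : ℝ) (a : 𝓢(Plane, ℂ)) : L2 →L[ℂ] L2 :=
  ((SchwartzMap.toLpCLM ℂ ℂ 2 (volume : Measure Plane)).toLinearMap ∘ₗ moyalLeft θ a).extendOfNorm
    (SchwartzMap.toLpCLM ℂ ℂ 2 (volume : Measure Plane)).toLinearMap

/-- The Hilbert space `L²(ℝ²) ⊗ ℂ² ⊗ ℂ²`, four copies of `L²(ℝ²)` indexed by the basis of `ℂ² ⊗ ℂ²`. -/
abbrev Spinor : Type := PiLp 2 (fun _ : Fin 2 × Fin 2 => L2)

/-- The representation `π(a) = L(a) ⊗ 1`, acting componentwise. -/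
def rep (θ : ℝ) (a : 𝓢(Plane, ℂ)) : Spinor →L[ℂ] Spinor :=
  (PiLp.continuousLinearEquiv 2 ℂ (fun _ : Fin 2 × Fin 2 => L2)).symm.toContinuousLinearMap ∘L
    ContinuousLinearMap.pi fun i => leftMul θ a ∘L PiLp.proj 2 (fun _ : Fin 2 × Fin 2 => L2) i

theorem rep_apply (θ : ℝ) (a : 𝓢(Plane, ℂ)) (ψ : Spinor) (i : Fin 2 × Fin 2) :
    rep θ a ψ i = leftMul θ a (ψ i) := rfl

/-- The matrices `σ¹`, `σ²`. -/
def pauli : Fin 2 → Matrix (Fin 2) (Fin 2) ℂ :=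
  ![!![0, 1; 1, 0], !![0, Complex.I; -Complex.I, 0]]

/-- `σ³ = i σ¹ σ²`. -/
def pauli3 : Matrix (Fin 2) (Fin 2) ℂ := Complex.I • (pauli 0 * pauli 1)

/-- The matrices in front of `-i ∂_μ`: `1 ⊗ σ^μ` for `k = 1` and `σ³ ⊗ σ^μ` for `k = 2`. -/
def gammaD (k : ℕ) (μ : Fin 2) : Matrix (Fin 2 × Fin 2) (Fin 2 × Fin 2) ℂ :=
  if k = 1 then (1 : Matrix (Fin 2) (Fin 2) ℂ) ⊗ₖ pauli μ else pauli3 ⊗ₖ pauli μ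

/-- The matrices in front of `-Ω x̃_μ`: `σ^μ ⊗ σ³` for `k = 1` and `σ^μ ⊗ 1` for `k = 2`. -/
def gammaX (k : ℕ) (μ : Fin 2) : Matrix (Fin 2 × Fin 2) (Fin 2 × Fin 2) ℂ :=
  if k = 1 then pauli μ ⊗ₖ pauli3 else pauli μ ⊗ₖ (1 : Matrix (Fin 2) (Fin 2) ℂ)

/-- The function `x̃_μ = 2 Θ⁻¹_{μν} x^ν`. -/
def tildeX (θ : ℝ) (μ : Fin 2) (x : Plane) : ℂ := ((2 * ∑ ν, (Theta θ)⁻¹ μ ν * x ν : ℝ) : ℂ)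

theorem tildeX_growth (θ : ℝ) (μ : Fin 2) : (tildeX θ μ).HasTemperateGrowth := by
  have h := (Complex.ofRealCLM ∘L ((2 : ℝ) • ∑ ν, (Theta θ)⁻¹ μ ν •
    (EuclideanSpace.proj ν : Plane →L[ℝ] ℝ))).hasTemperateGrowth
  convert h using 1
  ext x
  simp [tildeX]
  ring

/-- Multiplication by `x̃_μ` on the Schwartz space. -/
def mulTildeX (θ : ℝ) (μ : Fin 2) : 𝓢(Plane, ℂ) →ₗ[ℂ] 𝓢(Plane, ℂ) :=
  (SchwartzMap.smulLeftCLM ℂ (tildeX θ μ)).toLinearMap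

theorem mulTildeX_apply (θ : ℝ) (μ : Fin 2) (f : 𝓢(Plane, ℂ)) (x : Plane) :
    mulTildeX θ μ f x = tildeX θ μ x * f x :=
  smulLeftCLM_apply_apply (tildeX_growth θ μ) f x

/-- The partial derivative `∂_μ` on the Schwartz space. -/
def partialDeriv (μ : Fin 2) : 𝓢(Plane, ℂ) →ₗ[ℂ] 𝓢(Plane, ℂ) :=
  (LineDeriv.lineDerivOpCLM ℂ 𝓢(Plane, ℂ) (EuclideanSpace.single μ (1 : ℝ))).toLinearMap

/-- The differential expression of `D_k` on Schwartz spinors: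
`(D_k ψ)_i = ∑_μ ∑_j (gammaD^μ_{ij} (-i ∂_μ ψ_j) - Ω gammaX^μ_{ij} x̃_μ ψ_j)`. -/
def diracSchwartz (θ Ω : ℝ) (k : ℕ) :
    (Fin 2 × Fin 2 → 𝓢(Plane, ℂ)) →ₗ[ℂ] (Fin 2 × Fin 2 → 𝓢(Plane, ℂ)) :=
  LinearMap.pi fun i => ∑ μ, ∑ j, (gammaD k μ i j • (-Complex.I) • partialDeriv μ
    - (Ω : ℂ) • gammaX k μ i j • mulTildeX θ μ) ∘ₗ LinearMap.proj j

/-- The inclusion of Schwartz spinors in the Hilbert space. -/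
def toSpinor : (Fin 2 × Fin 2 → 𝓢(Plane, ℂ)) →ₗ[ℂ] Spinor :=
  (WithLp.linearEquiv 2 ℂ (Fin 2 × Fin 2 → L2)).symm.toLinearMap ∘ₗ
    LinearMap.pi fun i => (SchwartzMap.toLpCLM ℂ ℂ 2 (volume : Measure Plane)).toLinearMap ∘ₗ
      LinearMap.proj i

theorem toSpinor_injective : Function.Injective toSpinor := by
  intro ψ φ h
  ext1 i
  apply SchwartzMap.injective_toLp (μ := (volume : Measure Plane)) 2
  exact congrArg (fun v : Spinor => v i) h

/-- The expression above as an unbounded operator with domain the Schwartz spinors. -/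
def diracCore (θ Ω : ℝ) (k : ℕ) : Spinor →ₗ.[ℂ] Spinor where
  domain := LinearMap.range toSpinor
  toFun := toSpinor ∘ₗ diracSchwartz θ Ω k ∘ₗ
    (LinearEquiv.ofInjective toSpinor toSpinor_injective).symm.toLinearMap

/-- The Dirac operator `D_k`: the closure of the operator defined on Schwartz spinors. -/
def dirac (θ Ω : ℝ) (k : ℕ) : Spinor →ₗ.[ℂ] Spinor := (diracCore θ Ω k).closure
/-- The data of the harmonic Moyal triple `𝔛(k)`, `k = 1, 2`. -/
def harmonicTriple (θ Ω : ℝ) (k : ℕ) : TripleData 𝓢(Plane, ℂ) Spinor where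
  prod := moyalProd θ
  inv := conj
  rep := rep θ
  dirac := dirac θ Ω k

end Moyal

end

noncomputable section

open Filter Topology

/-! States at finite distance can be joined by a segment of convex combinations, on which the
distance is |s - t| d(ρ, σ). Hence the connected component of ρ is the set of states at finite
distance from ρ; this set is clopen and path-connected. If d(ρ, σ) = ∞ for one pair, then any two
distinct points of the segment from ρ to σ are at infinite distance, so there are infinitely many
components. Everything about the topology therefore reduces to one pair at infinite distance
(`connectedComponent_eq_ball`, `infinite_connectedComponents`).

Such a pair exists by uniform boundedness (`TripleData.exists_edist_eq_top`). Let u_n be an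
approximate unit with ‖[D, π(u_n)]‖ = O(1/n), and r_n a multiple of n + 1 such that r_n u_n has
Lipschitz seminorm at most 1. If all distances were finite, the quadratic form of r_n (π(u_n) - c_n)
would be bounded in n at every unit vector, where c_n is the value of a fixed vector state at u_n.
Then these operators are bounded in norm, and π(u_n) tends to 1 in norm. This is impossible, because
every π(a) has norm distance at least 1/2 from 1 (`half_le_norm_rep_sub_one`).

The analysis rests on a⋆b(x) = ∫ â(ξ) exp(2πiξx) b(x + πΘξ) dξ, which presents L(a) as a
superposition of unitaries with weight â (`moyalProd_eq_left`). It gives ‖L(a)‖ ≤ ‖â‖₁,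
associativity, the Leibniz rule and [x̃_μ, L(a)] = i L(∂_μ a). So [D, π(a)] is a matrix of operators
L(∂_μ a), and the u_n are the inverse Fourier transforms of bumps shrinking to the origin.

D is self-adjoint by an approximation argument (`isSelfAdjoint_closure_coreOperator`): regularize
with K_n = L(u_n) M(u_n), M being pointwise multiplication. For compactness, L(a) M(u_n) is
Hilbert-Schmidt, and M(u_n) (D - z)⁻¹ tends to (D - z)⁻¹ in norm because multiplication by x̃ is
bounded relative to D (`sum_norm_mulTilde_le`); this is where Ω > 0 enters. -/

namespace TripleData

variable {A H : Type*} [AddCommGroup A] [Module ℂ A] [NormedAddCommGroup H]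
  [InnerProductSpace ℂ H] [CompleteSpace H] {X : TripleData A H}

/-! ### States, their convex combinations and the connected components -/

theorem State.norm_apply_le (ρ : X.State) (a : A) : ‖ρ.toFun a‖ ≤ ‖X.rep a‖ := by
  simpa using ρ.unit_norm.1.2 a

/-- The sesquilinear form `(a, b) ↦ f (a* b)` of a positive functional. -/
@[reducible]
def positiveCore (hX : X.IsSpectralTriple) (f : A →ₗ[ℂ] ℂ)
    (hf : ∀ a, 0 ≤ f (X.prod (X.inv a) a)) : PreInnerProductSpace.Core ℂ A where
  inner a b := f (X.prod (X.inv a) b)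
  conj_inner_symm a b := by
    -- Hermitian symmetry follows from the reality of f on (a+b)*(a+b) and on (a+ib)*(a+ib).
    have h1 := (Complex.nonneg_iff.1 (hf (a + b))).2
    have h2 := (Complex.nonneg_iff.1 (hf (a + Complex.I • b))).2
    have ha := (Complex.nonneg_iff.1 (hf a)).2
    have hb := (Complex.nonneg_iff.1 (hf b)).2
    simp only [hX.inv_add, hX.inv_smul, hX.prod_add, hX.add_prod, hX.prod_smul, hX.smul_prod,
      map_add, map_smul, smul_eq_mul, Complex.add_im, Complex.mul_im, Complex.mul_re, Complex.conj_I,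
      Complex.neg_re, Complex.neg_im, Complex.I_re, Complex.I_im] at h1 h2
    apply Complex.ext
    · simp only [Complex.conj_re]
      linarith
    · simp only [Complex.conj_im]
      linarith
  re_inner_nonneg a := (Complex.nonneg_iff.1 (hf a)).1
  add_left a b c := by simp [hX.inv_add, hX.add_prod]
  smul_left a b t := by simp [hX.inv_smul, hX.smul_prod]

/-- Cauchy-Schwarz for the form (x, y) ↦ f(x* y), at x = a* and y = b. -/
theorem norm_apply_prod_sq_le (hX : X.IsSpectralTriple) (f : A →ₗ[ℂ] ℂ)
    (hf : ∀ a, 0 ≤ f (X.prod (X.inv a) a)) (a b : A) :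
    ‖f (X.prod a b)‖ ^ 2 ≤ (f (X.prod a (X.inv a))).re * (f (X.prod (X.inv b) b)).re := by
  have h1 : ‖f (X.prod (X.inv (X.inv a)) b)‖ * ‖f (X.prod (X.inv b) (X.inv a))‖ ≤
      (f (X.prod (X.inv (X.inv a)) (X.inv a))).re * (f (X.prod (X.inv b) b)).re :=
    @InnerProductSpace.Core.inner_mul_inner_self_le ℂ A _ _ _ (positiveCore hX f hf) (X.inv a) b
  have h2 : (starRingEnd ℂ) (f (X.prod (X.inv b) (X.inv a))) = f (X.prod (X.inv (X.inv a)) b) :=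
    (positiveCore hX f hf).conj_inner_symm (X.inv a) b
  rw [← h2, RCLike.norm_conj, ← pow_two, ← RCLike.norm_conj, h2] at h1
  rwa [hX.inv_inv] at h1

/-- A sequence in the algebra, bounded by one, which is an approximate unit for the representation and for
the algebra. -/
structure IsApproxUnit (X : TripleData A H) (u : ℕ → A) : Prop where
  norm_le : ∀ n, ‖X.rep (u n)‖ ≤ 1
  tendsto_apply : ∀ ψ, Tendsto (fun n => X.rep (u n) ψ) atTop (𝓝 ψ)
  tendsto_prod : ∀ a, Tendsto (fun n => X.rep (X.prod (u n) a)) atTop (𝓝 (X.rep a))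

theorem norm_rep_prod_inv_le (hX : X.IsSpectralTriple) {a : A} (ha : ‖X.rep a‖ ≤ 1) :
    ‖X.rep (X.prod a (X.inv a))‖ ≤ 1 := by
  rw [hX.rep_prod, hX.rep_inv]
  refine (ContinuousLinearMap.opNorm_comp_le _ _).trans ?_
  rw [LinearIsometryEquiv.norm_map]
  exact mul_le_one₀ ha (norm_nonneg _) ha

/-- If ρ(u_n u_n*) ≤ c held for infinitely many n, Cauchy-Schwarz would give |ρ(u_n a)|² ≤ c ‖π(a)‖²
for these n, and in the limit ‖ρ‖ ≤ √c < 1. The lemma shows that convex combinations again have norm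
1: one u_n nearly attains the norm of both states at once. -/
theorem State.eventually_lt (hX : X.IsSpectralTriple) {u : ℕ → A} (hu : X.IsApproxUnit u)
    (ρ : X.State) {c : ℝ} (hc : c < 1) :
    ∀ᶠ n in atTop, c < (ρ.toFun (X.prod (u n) (X.inv (u n)))).re := by
  by_contra hcon
  have hcon' : ∃ᶠ n in atTop, (ρ.toFun (X.prod (u n) (X.inv (u n)))).re ≤ c := by
    simpa only [Filter.not_eventually, not_lt] using hcon
  have hpos : ∀ b, 0 ≤ (ρ.toFun (X.prod b (X.inv b))).re := fun b => by
    have := (Complex.nonneg_iff.1 (ρ.positive (X.inv b))).1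
    rwa [hX.inv_inv] at this
  have hc0 : 0 ≤ c := by
    obtain ⟨n, hn⟩ := hcon'.exists
    exact (hpos _).trans hn
  have key : ∀ a, ‖ρ.toFun a‖ ≤ √c * ‖X.rep a‖ := by
    intro a
    have h1 : Tendsto (fun n => ρ.toFun (X.prod (u n) a)) atTop (𝓝 (ρ.toFun a)) := by
      rw [tendsto_iff_norm_sub_tendsto_zero]
      have h2 := tendsto_iff_norm_sub_tendsto_zero.1 (hu.tendsto_prod a)
      refine squeeze_zero (fun _ => norm_nonneg _) (fun n => ?_) h2
      have h3 : X.rep (X.prod (u n) a) - X.rep a = X.rep (X.prod (u n) a + (-1 : ℂ) • a) := by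
        rw [hX.rep_add, hX.rep_smul]; simp [sub_eq_add_neg]
      rw [h3, ← map_sub]
      have h4 := ρ.norm_apply_le (X.prod (u n) a + (-1 : ℂ) • a)
      rwa [neg_one_smul, ← sub_eq_add_neg] at h4 ⊢
    have h5 : ‖ρ.toFun a‖ ^ 2 ≤ c * ‖X.rep a‖ ^ 2 := by
      refine le_of_tendsto_of_frequently (h1.norm.pow 2) (hcon'.mono fun n hn => ?_)
      refine (norm_apply_prod_sq_le hX ρ.toFun ρ.positive _ _).trans ?_
      have h6 : (ρ.toFun (X.prod (X.inv a) a)).re ≤ ‖X.rep a‖ ^ 2 := by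
        refine (Complex.re_le_norm _).trans ((ρ.norm_apply_le _).trans ?_)
        rw [hX.rep_prod, hX.rep_inv, pow_two]
        refine (ContinuousLinearMap.opNorm_comp_le _ _).trans ?_
        rw [LinearIsometryEquiv.norm_map]
      have h7 := (Complex.nonneg_iff.1 (ρ.positive a)).1
      gcongr
    have h8 := Real.sqrt_le_sqrt h5
    rwa [Real.sqrt_sq (norm_nonneg _), Real.sqrt_mul hc0, Real.sqrt_sq (norm_nonneg _)] at h8
  have h9 : 1 ≤ √c := ρ.unit_norm.2 ⟨Real.sqrt_nonneg c, key⟩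
  rw [Real.one_le_sqrt] at h9
  linarith

/-- Convex combinations of states. -/
def State.mix (hX : X.IsSpectralTriple) {u : ℕ → A} (hu : X.IsApproxUnit u) (ρ σ : X.State)
    (t : unitInterval) : X.State where
  toFun := ((1 - t : ℝ) : ℂ) • ρ.toFun + ((t : ℝ) : ℂ) • σ.toFun
  positive a := by
    have h1 : (0 : ℂ) ≤ ((1 - t : ℝ) : ℂ) := by exact_mod_cast unitInterval.one_minus_nonneg t
    have h2 : (0 : ℂ) ≤ ((t : ℝ) : ℂ) := by exact_mod_cast unitInterval.nonneg t
    exact add_nonneg (mul_nonneg h1 (ρ.positive a)) (mul_nonneg h2 (σ.positive a))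
  unit_norm := by
    have ht0 := unitInterval.nonneg t
    have ht1 := unitInterval.one_minus_nonneg t
    refine ⟨⟨zero_le_one, fun a => ?_⟩, fun C hC => ?_⟩
    · have h1 := ρ.norm_apply_le a
      have h2 := σ.norm_apply_le a
      simp only [LinearMap.add_apply, LinearMap.smul_apply, smul_eq_mul]
      refine (norm_add_le _ _).trans ?_
      rw [norm_mul, norm_mul, Complex.norm_real, Complex.norm_real, Real.norm_of_nonneg ht0,
        Real.norm_of_nonneg ht1]
      nlinarith
    · refine le_of_forall_lt fun c hc => ?_
      obtain ⟨d, hcd, hd⟩ := exists_between hc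
      obtain ⟨n, h1, h2⟩ := ((ρ.eventually_lt hX hu hd).and (σ.eventually_lt hX hu hd)).exists
      refine hcd.trans_le ?_
      have h3 := hC.2 (X.prod (u n) (X.inv (u n)))
      have h4 := (Complex.re_le_norm _).trans h3
      have h5 := mul_le_mul_of_nonneg_left (norm_rep_prod_inv_le hX (hu.norm_le n)) hC.1
      simp only [LinearMap.add_apply, LinearMap.smul_apply, smul_eq_mul, Complex.add_re,
        Complex.re_ofReal_mul] at h4
      nlinarith

theorem edist_eq (ρ σ : X.State) : edist ρ σ = X.spectralDist ρ σ := rfl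

/-- The two mixtures differ by (t - s)(ρ - σ), so the supremum scales. Infinite distances are
included, with 0 · ∞ = 0. -/
theorem edist_mix (hX : X.IsSpectralTriple) {u : ℕ → A} (hu : X.IsApproxUnit u) (ρ σ : X.State)
    (s t : unitInterval) : edist (ρ.mix hX hu σ s) (ρ.mix hX hu σ t) = edist s t * edist ρ σ := by
  simp only [edist_eq, spectralDist, ENNReal.mul_iSup]
  refine iSup_congr fun a => iSup_congr fun _ => ?_
  have : (ρ.mix hX hu σ s).toFun a - (ρ.mix hX hu σ t).toFun a
      = ((t - s : ℝ) : ℂ) * (ρ.toFun a - σ.toFun a) := by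
    simp [State.mix]
    ring
  rw [this, enorm_mul]
  congr 1
  rw [edist_comm, Subtype.edist_eq, edist_eq_enorm_sub]
  exact congrArg ENNReal.ofNNReal (Complex.nnnorm_real _)

theorem State.mix_zero (hX : X.IsSpectralTriple) {u : ℕ → A} (hu : X.IsApproxUnit u)
    (ρ σ : X.State) : ρ.mix hX hu σ 0 = ρ := by
  obtain ⟨f, _, _⟩ := ρ
  simp [State.mix]

theorem State.mix_one (hX : X.IsSpectralTriple) {u : ℕ → A} (hu : X.IsApproxUnit u)
    (ρ σ : X.State) : ρ.mix hX hu σ 1 = σ := by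
  obtain ⟨f, _, _⟩ := σ
  simp [State.mix]

/-- A ball of infinite radius is open, and so is its complement by the triangle inequality. It
contains the segment from ρ to each of its points, and this segment is Lipschitz with constant the
distance. -/
theorem connectedComponent_eq_ball (hX : X.IsSpectralTriple) {u : ℕ → A} (hu : X.IsApproxUnit u)
    (ρ : X.State) : connectedComponent ρ = Metric.eball ρ ⊤ ∧ IsPathConnected (Metric.eball ρ ⊤) := by
  have hclopen : IsClopen (Metric.eball ρ ⊤) := by
    refine ⟨⟨?_⟩, Metric.isOpen_eball⟩
    rw [EMetric.isOpen_iff]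
    intro σ hσ
    refine ⟨⊤, ENNReal.zero_lt_top, fun τ hτ => ?_⟩
    simp only [Set.mem_compl_iff, Metric.mem_eball, not_lt, top_le_iff] at hσ hτ ⊢
    by_contra h
    have := edist_triangle σ τ ρ
    rw [hσ, edist_comm σ τ, top_le_iff, ENNReal.add_eq_top] at this
    exact this.elim hτ.ne h
  have hpath : IsPathConnected (Metric.eball ρ ⊤) := by
    refine ⟨ρ, by simp, fun {σ} hσ => ?_⟩
    have hfin : edist ρ σ ≠ ⊤ := by
      rw [edist_comm]; exact (Metric.mem_eball.1 hσ).ne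
    have hcont : Continuous fun t : unitInterval => ρ.mix hX hu σ t := by
      refine LipschitzWith.continuous (K := (edist ρ σ).toNNReal) fun s t => ?_
      rw [edist_mix, mul_comm, ENNReal.coe_toNNReal hfin]
    refine ⟨⟨⟨_, hcont⟩, ρ.mix_zero hX hu σ, ρ.mix_one hX hu σ⟩, fun t => ?_⟩
    rw [Metric.mem_eball]
    change edist (ρ.mix hX hu σ t) ρ < ⊤
    nth_rw 2 [← ρ.mix_zero hX hu σ]
    rw [edist_mix]
    exact ENNReal.mul_lt_top (edist_lt_top _ _) hfin.lt_top
  refine ⟨?_, hpath⟩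
  have hmem : ρ ∈ Metric.eball ρ ⊤ := by simp
  exact (hclopen.connectedComponent_subset hmem).antisymm
    (hpath.isConnected.isPreconnected.subset_connectedComponent hmem)

/-- On the segment between states at infinite distance, distinct parameters are at distance |s - t|
· ∞ = ∞ and lie in different components. -/
theorem infinite_connectedComponents (hX : X.IsSpectralTriple) {u : ℕ → A} (hu : X.IsApproxUnit u)
    {ρ σ : X.State} (h : edist ρ σ = ⊤) : Infinite (ConnectedComponents X.State) := by
  have : Infinite unitInterval := (Set.Icc_infinite zero_lt_one).to_subtype
  refine Infinite.of_injective (fun t : unitInterval => ConnectedComponents.mk (ρ.mix hX hu σ t))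
    fun s t hst => ?_
  have h1 := ConnectedComponents.coe_eq_coe'.1 hst
  rw [(connectedComponent_eq_ball hX hu _).1, Metric.mem_eball, edist_mix, h] at h1
  by_contra hne
  rw [ENNReal.mul_top (by simpa using hne)] at h1
  exact lt_irrefl _ h1

/-! ### Vector states and a criterion for infinite distance -/

/-- The vector state `a ↦ ⟨ψ, π(a) ψ⟩`. -/
def vectorState (hX : X.IsSpectralTriple) {u : ℕ → A} (hu : X.IsApproxUnit u) (ψ : H)
    (hψ : ‖ψ‖ = 1) : X.State where
  toFun :=
    { toFun := fun a => inner ℂ ψ (X.rep a ψ)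
      map_add' := fun a b => by simp [hX.rep_add]
      map_smul' := fun t a => by simp [hX.rep_smul] }
  positive a := by
    change 0 ≤ inner ℂ ψ (X.rep (X.prod (X.inv a) a) ψ)
    rw [hX.rep_prod, hX.rep_inv, ContinuousLinearMap.comp_apply,
      ContinuousLinearMap.adjoint_inner_right, inner_self_eq_norm_sq_to_K]
    exact Complex.zero_le_real.2 (sq_nonneg ‖X.rep a ψ‖) |>.trans_eq (by simp)
  unit_norm := by
    refine ⟨⟨zero_le_one, fun a => ?_⟩, fun C hC => ?_⟩
    · refine (norm_inner_le_norm _ _).trans ?_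
      have := (X.rep a).le_opNorm ψ
      rw [hψ] at this ⊢
      linarith
    · have h1 : Tendsto (fun n => ‖inner ℂ ψ (X.rep (u n) ψ)‖) atTop (𝓝 ‖inner ℂ ψ ψ‖) :=
        (Tendsto.inner tendsto_const_nhds (hu.tendsto_apply ψ)).norm
      rw [inner_self_eq_norm_sq_to_K, hψ] at h1
      refine le_of_tendsto (by simpa using h1) (Eventually.of_forall fun n => ?_)
      refine (hC.2 (u n)).trans ?_
      exact mul_le_of_le_one_right hC.1 (hu.norm_le n)

theorem vectorState_apply (hX : X.IsSpectralTriple) {u : ℕ → A} (hu : X.IsApproxUnit u) (ψ : H)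
    (hψ : ‖ψ‖ = 1) (a : A) : (vectorState hX hu ψ hψ).toFun a = inner ℂ ψ (X.rep a ψ) := rfl

/-- A sequence of operators whose quadratic forms are bounded at each unit vector is bounded. -/
theorem exists_norm_le_of_forall_inner_le (T : ℕ → H →L[ℂ] H)
    (h : ∀ ψ : H, ‖ψ‖ = 1 → ∃ C : ℝ, ∀ n, ‖inner ℂ ψ (T n ψ)‖ ≤ C) : ∃ C : ℝ, ∀ n, ‖T n‖ ≤ C := by
  have h1 : ∀ ψ : H, ∃ C : ℝ, ∀ n, ‖inner ℂ (T n ψ) ψ‖ ≤ C := by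
    intro ψ
    rcases eq_or_ne ψ 0 with rfl | hψ
    · exact ⟨0, by simp⟩
    · obtain ⟨C, hC⟩ := h (((‖ψ‖⁻¹ : ℝ) : ℂ) • ψ) (by
        rw [norm_smul, Complex.norm_real, norm_inv, norm_norm, inv_mul_cancel₀ (norm_ne_zero_iff.2 hψ)])
      refine ⟨C * ‖ψ‖ ^ 2, fun n => ?_⟩
      have h2 := hC n
      rw [map_smul, inner_smul_left, inner_smul_right, norm_mul, norm_mul, RCLike.norm_conj,
        Complex.norm_real, norm_inv, norm_norm] at h2
      have h3 : 0 < ‖ψ‖ := norm_pos_iff.2 hψ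
      rw [norm_inner_symm]
      calc ‖inner ℂ ψ (T n ψ)‖ = (‖ψ‖⁻¹ * (‖ψ‖⁻¹ * ‖inner ℂ ψ (T n ψ)‖)) * ‖ψ‖ ^ 2 := by
            field_simp
        _ ≤ _ := by gcongr
  choose C hC using h1
  have h2 : ∀ ψ : H, ∃ B : ℝ, ∀ n, ‖T n ψ‖ ≤ B := by
    intro ψ
    -- Polarization bounds ⟨T_n ψ, φ⟩ for every φ. The first use of uniform boundedness then bounds
    -- T_n ψ, the second bounds T_n.
    obtain ⟨B, hB⟩ := banach_steinhaus (g := fun n => innerSL ℂ (T n ψ)) fun φ => by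
      refine ⟨(C (φ + ψ) + C (φ - ψ) + C (φ + Complex.I • ψ) + C (φ - Complex.I • ψ)) / 4,
        fun n => ?_⟩
      have hpol := inner_map_polarization (T n).toLinearMap φ ψ
      simp only [ContinuousLinearMap.coe_coe] at hpol
      rw [innerSL_apply_apply, hpol, norm_div]
      have h4 : ‖(4 : ℂ)‖ = 4 := by norm_num
      rw [h4]
      gcongr
      refine (norm_sub_le _ _).trans ?_
      refine (add_le_add ((norm_add_le _ _).trans (add_le_add (norm_sub_le _ _) le_rfl)) le_rfl).trans ?_
      simp only [norm_mul, Complex.norm_I, one_mul]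
      exact add_le_add (add_le_add (add_le_add (hC _ n) (hC _ n)) (hC _ n)) (hC _ n)
    exact ⟨B, fun n => by simpa using hB n⟩
  exact banach_steinhaus h2

/-- Were all distances finite, the operators r_n (π(u_n) - c_n) would have pointwise bounded
quadratic forms, the bound at ψ being the distance of its vector state to ρ. Their norms are then at
most some C, so ‖π(u_n) - 1‖ ≤ C / r_n + |c_n - 1| tends to 0, against `hone`. -/
theorem exists_edist_eq_top (hX : X.IsSpectralTriple) {u : ℕ → A} (hu : X.IsApproxUnit u)
    {r : ℕ → ℝ} (hr : Tendsto r atTop atTop) (hlip : ∀ n, X.lipNorm ((r n : ℂ) • u n) ≤ 1)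
    (hone : ∀ a, 1 / 2 ≤ ‖X.rep a - 1‖) : ∃ ρ σ : X.State, edist ρ σ = ⊤ := by
  have : Nontrivial H := by
    by_contra hn
    rw [not_nontrivial_iff_subsingleton] at hn
    have h1 := hone 0
    rw [Subsingleton.elim (X.rep 0 - 1) 0, norm_zero] at h1
    norm_num at h1
  obtain ⟨ψ₀, hψ₀⟩ := exists_norm_eq H zero_le_one
  by_contra! hcon
  set ρ := vectorState hX hu ψ₀ hψ₀
  set c : ℕ → ℂ := fun n => ρ.toFun (u n) with hc
  have hbd := exists_norm_le_of_forall_inner_le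
    (fun n => (r n : ℂ) • (X.rep (u n) - c n • (1 : H →L[ℂ] H))) fun ψ hψ => by
      refine ⟨(edist (vectorState hX hu ψ hψ) ρ).toReal, fun n => ?_⟩
      have h1 : ‖(vectorState hX hu ψ hψ).toFun ((r n : ℂ) • u n) - ρ.toFun ((r n : ℂ) • u n)‖ₑ
          ≤ edist (vectorState hX hu ψ hψ) ρ :=
        le_iSup₂ (f := fun a (_ : X.lipNorm a ≤ 1) =>
          ‖(vectorState hX hu ψ hψ).toFun a - ρ.toFun a‖ₑ) _ (hlip n)
      have h2 := ENNReal.toReal_mono (hcon _ _) h1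
      rw [toReal_enorm] at h2
      refine le_of_eq_of_le ?_ h2
      rw [map_smul, map_smul, vectorState_apply, _root_.smul_apply, _root_.sub_apply,
        _root_.smul_apply, one_apply_eq_self, inner_smul_right, inner_sub_right,
        inner_smul_right, inner_self_eq_norm_sq_to_K, hψ]
      simp [hc, mul_sub]
  obtain ⟨C, hC⟩ := hbd
  have hc1 : Tendsto c atTop (𝓝 1) := by
    have h1 : Tendsto (fun n => inner ℂ ψ₀ (X.rep (u n) ψ₀)) atTop (𝓝 (inner ℂ ψ₀ ψ₀)) :=
      Tendsto.inner tendsto_const_nhds (hu.tendsto_apply ψ₀)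
    rw [inner_self_eq_norm_sq_to_K, hψ₀] at h1
    rw [RCLike.ofReal_one, one_pow] at h1
    exact h1
  have h1 : Tendsto (fun n => C / r n + ‖c n - 1‖) atTop (𝓝 (0 + 0)) := by
    refine (hr.const_div_atTop C).add ?_
    exact tendsto_iff_norm_sub_tendsto_zero.1 hc1
  have h2 : ∀ᶠ n in atTop, C / r n + ‖c n - 1‖ < 1 / 2 := by
    refine h1.eventually (gt_mem_nhds ?_)
    norm_num
  obtain ⟨n, hn, hrn⟩ := (h2.and (hr.eventually_gt_atTop 0)).exists
  have h3 := hC n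
  rw [norm_smul, Complex.norm_real, Real.norm_of_nonneg hrn.le] at h3
  have h4 : ‖X.rep (u n) - c n • (1 : H →L[ℂ] H)‖ ≤ C / r n := by
    rw [le_div_iff₀ hrn]; linarith
  have h5 : ‖X.rep (u n) - 1‖ ≤ C / r n + ‖c n - 1‖ := by
    have : X.rep (u n) - 1 = (X.rep (u n) - c n • (1 : H →L[ℂ] H)) + (c n - 1) • (1 : H →L[ℂ] H) := by
      rw [sub_smul, one_smul]; abel
    rw [this]
    refine (norm_add_le _ _).trans (add_le_add h4 ?_)
    rw [norm_smul, norm_one, mul_one]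
  linarith [hone (u n)]

end TripleData

/-! ### Closures of symmetric operators given on a core -/

section Core

variable {E H : Type*} [AddCommGroup E] [Module ℂ E] [NormedAddCommGroup H]
  [InnerProductSpace ℂ H]

/-- The unbounded operator on `H` given by a linear map `d` on a space `E` that is embedded in `H`. -/
def coreOperator (ι : E →ₗ[ℂ] H) (hι : Function.Injective ι) (d : E →ₗ[ℂ] E) : H →ₗ.[ℂ] H where
  domain := LinearMap.range ι
  toFun := ι ∘ₗ d ∘ₗ (LinearEquiv.ofInjective ι hι).symm.toLinearMap

variable {ι : E →ₗ[ℂ] H} {hι : Function.Injective ι} {d : E →ₗ[ℂ] E}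

theorem coreOperator_apply (ψ : E) :
    coreOperator ι hι d ⟨ι ψ, LinearMap.mem_range_self ι ψ⟩ = ι (d ψ) := by
  have : (⟨ι ψ, LinearMap.mem_range_self ι ψ⟩ : LinearMap.range ι) = LinearEquiv.ofInjective ι hι ψ := rfl
  exact congrArg (fun x => ι (d x)) ((LinearEquiv.symm_apply_eq _).2 this)

theorem coreOperator_graph :
    ((coreOperator ι hι d).graph : Set (H × H)) = Set.range fun ψ => (ι ψ, ι (d ψ)) := by
  ext ⟨u, v⟩
  simp only [SetLike.mem_coe, LinearPMap.mem_graph_iff, Set.mem_range, Prod.mk.injEq]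
  constructor
  · rintro ⟨⟨_, ψ, rfl⟩, rfl, rfl⟩
    exact ⟨ψ, rfl, (coreOperator_apply ψ).symm⟩
  · rintro ⟨ψ, rfl, rfl⟩
    exact ⟨⟨ι ψ, LinearMap.mem_range_self ι ψ⟩, rfl, coreOperator_apply ψ⟩

theorem coreOperator_isFormalAdjoint
    (hd : ∀ φ ψ, inner ℂ (ι (d φ)) (ι ψ) = inner ℂ (ι φ) (ι (d ψ))) :
    (coreOperator ι hι d).IsFormalAdjoint (coreOperator ι hι d) := by
  rintro ⟨_, φ, rfl⟩ ⟨_, ψ, rfl⟩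
  rw [coreOperator_apply, coreOperator_apply]
  exact hd φ ψ

/-- Statements about the closure reduce to closed conditions on pairs (ι ψ, ι (d ψ)). -/
theorem mem_closure_graph_iff (h : (coreOperator ι hι d).IsClosable) {u v : H} :
    (∃ hu : u ∈ (coreOperator ι hι d).closure.domain, (coreOperator ι hι d).closure ⟨u, hu⟩ = v) ↔
      (u, v) ∈ closure (Set.range fun ψ => (ι ψ, ι (d ψ))) := by
  rw [← coreOperator_graph (hι := hι), ← Submodule.topologicalClosure_coe,
    h.graph_closure_eq_closure_graph, SetLike.mem_coe, LinearPMap.mem_graph_iff]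
  constructor
  · rintro ⟨hu, rfl⟩
    exact ⟨⟨u, hu⟩, rfl, rfl⟩
  · rintro ⟨⟨w, hw⟩, rfl, rfl⟩
    exact ⟨hw, rfl⟩

theorem coreOperator_closure_apply (h : (coreOperator ι hι d).IsClosable) (ψ : E) :
    ∃ hu : ι ψ ∈ (coreOperator ι hι d).closure.domain,
      (coreOperator ι hι d).closure ⟨ι ψ, hu⟩ = ι (d ψ) :=
  (mem_closure_graph_iff h).2 (subset_closure ⟨ψ, rfl⟩)

/-- A commutator that is bounded on the core is bounded on the domain of the closure. -/
theorem coreOperator_closure_commutator (h : (coreOperator ι hι d).IsClosable) (A T : H →L[ℂ] H)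
    (k : E → E) (hA : ∀ ψ, A (ι ψ) = ι (k ψ)) (hT : ∀ ψ, T (ι ψ) = ι (d (k ψ)) - ι (k (d ψ)))
    (ψ : (coreOperator ι hι d).closure.domain) :
    ∃ hu : A ψ ∈ (coreOperator ι hι d).closure.domain,
      T ψ = (coreOperator ι hι d).closure ⟨A ψ, hu⟩ - A ((coreOperator ι hι d).closure ψ) := by
  have hψ := (mem_closure_graph_iff h).1 ⟨ψ.2, rfl⟩
  have hc : Continuous fun p : H × H => (A p.1, A p.2 + T p.1) := by fun_prop
  have h1 := map_mem_closure hc hψ (t := Set.range fun ψ => (ι ψ, ι (d ψ))) (by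
    rintro _ ⟨φ, rfl⟩
    exact ⟨k φ, by simp [hA, hT]⟩)
  obtain ⟨hu, h2⟩ := (mem_closure_graph_iff h).2 h1
  exact ⟨hu, by rw [h2]; simp⟩

theorem coreOperator_closure_norm_le (h : (coreOperator ι hι d).IsClosable) (B : H →L[ℂ] H) (C : ℝ)
    (hB : ∀ ψ, ‖B (ι ψ)‖ ≤ C * (‖ι ψ‖ + ‖ι (d ψ)‖)) (ψ : (coreOperator ι hι d).closure.domain) :
    ‖B ψ‖ ≤ C * (‖(ψ : H)‖ + ‖(coreOperator ι hι d).closure ψ‖) := by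
  have hψ := (mem_closure_graph_iff h).1 ⟨ψ.2, rfl⟩
  have hclosed : IsClosed {p : H × H | ‖B p.1‖ ≤ C * (‖p.1‖ + ‖p.2‖)} :=
    isClosed_le (by fun_prop) (by fun_prop)
  refine closure_minimal ?_ hclosed hψ
  rintro _ ⟨φ, rfl⟩
  exact hB φ

variable [CompleteSpace H]

/-- A densely defined symmetric operator is contained in its adjoint, which is closed. -/
theorem coreOperator_isClosable (hdense : DenseRange ι)
    (hd : ∀ φ ψ, inner ℂ (ι (d φ)) (ι ψ) = inner ℂ (ι φ) (ι (d ψ))) :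
    (coreOperator ι hι d).IsClosable := by
  have h : Dense ((coreOperator ι hι d).domain : Set H) := hdense
  exact (LinearPMap.adjoint_isClosed h).isClosable.leIsClosable
    ((coreOperator_isFormalAdjoint hd).le_adjoint h)

/-- An approximation criterion for the closure of a symmetric operator to be self-adjoint: there are
bounded operators `K n` tending to `1` such that `d K n` is bounded and the commutators of `d` with the adjoints
of the `K n` tend to zero. -/
theorem isSelfAdjoint_closure_coreOperator (hdense : DenseRange ι)
    (hd : ∀ φ ψ, inner ℂ (ι (d φ)) (ι ψ) = inner ℂ (ι φ) (ι (d ψ)))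
    (K B C : ℕ → H →L[ℂ] H) (k k' : ℕ → E → E)
    (hK : ∀ n ψ, K n (ι ψ) = ι (k n ψ)) (hB : ∀ n ψ, B n (ι ψ) = ι (d (k n ψ)))
    (hK' : ∀ n ψ, ContinuousLinearMap.adjoint (K n) (ι ψ) = ι (k' n ψ))
    (hC : ∀ n ψ, C n (ι ψ) = ι (d (k' n ψ)) - ι (k' n (d ψ)))
    (hKlim : ∀ v, Tendsto (fun n => K n v) atTop (𝓝 v))
    (hClim : Tendsto (fun n => ‖C n‖) atTop (𝓝 0)) :
    IsSelfAdjoint (coreOperator ι hι d).closure := by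
  set D := coreOperator ι hι d with hD
  have hDd : Dense (D.domain : Set H) := hdense
  have hcl : D.IsClosable := coreOperator_isClosable hdense hd
  have hcd : Dense (D.closure.domain : Set H) := hDd.mono D.le_closure.1
  have hle : D.closure ≤ D.adjoint := by
    have h1 := (LinearPMap.adjoint_isClosed hDd).isClosable.closure_mono
      ((coreOperator_isFormalAdjoint hd).le_adjoint hDd)
    have h2 : D.adjoint.closure = D.adjoint := by
      have h3 := (LinearPMap.adjoint_isClosed hDd).isClosable.graph_closure_eq_closure_graph
      rw [(LinearPMap.adjoint_isClosed hDd).submodule_topologicalClosure_eq] at h3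
      exact LinearPMap.eq_of_eq_graph h3.symm
    rwa [h2] at h1
  have hmem : ∀ v : D.adjoint.domain, ((v : H), D.adjoint v) ∈
      closure (Set.range fun ψ => (ι ψ, ι (d ψ))) := by
    intro v
    -- Formally d K = K d - C*, where C = [d, K*]. Tested against the core, this needs only v in the
    -- domain of the adjoint, since K* maps the core to itself.
    have key : ∀ n, B n v = K n (D.adjoint v) - ContinuousLinearMap.adjoint (C n) (v : H) := by
      intro n
      refine hdense.eq_of_inner_left (𝕜 := ℂ) fun ψ => ?_
      have h1 : inner ℂ (B n v) (ι ψ) =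
          inner ℂ (v : H) (ContinuousLinearMap.adjoint (K n) (ι (d ψ))) := by
        refine hdense.induction_on
          (p := fun x => inner ℂ (B n x) (ι ψ) =
            inner ℂ x (ContinuousLinearMap.adjoint (K n) (ι (d ψ)))) (v : H)
          (isClosed_eq (by fun_prop) (by fun_prop)) fun φ => ?_
        rw [hB, hd, ContinuousLinearMap.adjoint_inner_right, hK]
      have h2 : inner ℂ (D.adjoint v) (ι (k' n ψ)) = inner ℂ (v : H) (ι (d (k' n ψ))) := by
        have := D.adjoint_isFormalAdjoint hDd v ⟨ι (k' n ψ), LinearMap.mem_range_self _ _⟩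
        exact this.trans (congrArg _ (coreOperator_apply _))
      rw [h1, hK', inner_sub_left, ContinuousLinearMap.adjoint_inner_left,
        ← ContinuousLinearMap.adjoint_inner_right, hK', hC, inner_sub_right, h2]
      abel
    -- B_n extends d K_n, so approximating v by core vectors puts this pair in the closed graph. It
    -- converges to (v, D* v).
    have hin : ∀ n, (K n v, B n v) ∈ closure (Set.range fun ψ => (ι ψ, ι (d ψ))) := by
      intro n
      have hc : Continuous fun x : H => (K n x, B n x) := by fun_prop
      have := map_mem_closure hc (hdense (v : H)) (t := Set.range fun ψ => (ι ψ, ι (d ψ))) (by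
        rintro _ ⟨ψ, rfl⟩
        exact ⟨k n ψ, by simp only [hK, hB]⟩)
      exact this
    refine isClosed_closure.mem_of_tendsto (b := atTop) (f := fun n => (K n v, B n v)) ?_
      (Eventually.of_forall hin)
    refine (hKlim v).prodMk_nhds ?_
    simp_rw [key]
    have h3 : Tendsto (fun n => ContinuousLinearMap.adjoint (C n) (v : H)) atTop (𝓝 0) := by
      rw [tendsto_zero_iff_norm_tendsto_zero]
      have h4 : Tendsto (fun n => ‖C n‖ * ‖(v : H)‖) atTop (𝓝 0) := by
        simpa using hClim.mul_const ‖(v : H)‖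
      refine squeeze_zero (fun _ => norm_nonneg _) (fun n => ?_) h4
      have := (ContinuousLinearMap.adjoint (C n)).le_opNorm (v : H)
      rwa [LinearIsometryEquiv.norm_map] at this
    simpa using (hKlim (D.adjoint v)).sub h3
  have heq : D.adjoint = D.closure := by
    refine le_antisymm (LinearPMap.le_of_le_graph ?_) hle
    rintro ⟨u, w⟩ huw
    obtain ⟨v, rfl, rfl⟩ := LinearPMap.mem_graph_iff _ |>.1 huw
    obtain ⟨hu, h⟩ := (mem_closure_graph_iff hcl).2 (hmem v)
    exact LinearPMap.mem_graph_iff _ |>.2 ⟨⟨v, hu⟩, rfl, h⟩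
  -- The adjoint of the closure is a formal adjoint of D, hence below D* = closure of D. Conversely,
  -- D* and the closure of D are formally adjoint, by passing to limits on the graph.
  rw [LinearPMap.isSelfAdjoint_def]
  refine le_antisymm ?_ ?_
  · refine le_trans (LinearPMap.IsFormalAdjoint.le_adjoint hDd ?_) heq.le
    intro x y
    have hx := D.le_closure.2 (x := x) (y := ⟨x, D.le_closure.1 x.2⟩) rfl
    rw [hx]
    exact (D.closure.adjoint_isFormalAdjoint hcd).symm _ y
  · refine LinearPMap.IsFormalAdjoint.le_adjoint hcd ?_
    intro x y
    have hx := hle.2 (x := x) (y := ⟨x, hle.1 x.2⟩) rfl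
    rw [hx]
    set x' : D.adjoint.domain := ⟨x, hle.1 x.2⟩
    have hy : ((y : H), D.closure y) ∈ closure (Set.range fun ψ => (ι ψ, ι (d ψ))) :=
      (mem_closure_graph_iff hcl).1 ⟨y.2, rfl⟩
    have hclosed : IsClosed {p : H × H | inner ℂ (D.adjoint x') p.1 = inner ℂ (x' : H) p.2} :=
      isClosed_eq (by fun_prop) (by fun_prop)
    refine closure_minimal ?_ hclosed hy
    rintro _ ⟨ψ, rfl⟩
    have := D.adjoint_isFormalAdjoint hDd x' ⟨ι ψ, LinearMap.mem_range_self _ _⟩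
    exact this.trans (congrArg _ (coreOperator_apply _))

end Core

/-! ### Hilbert-Schmidt operators -/

section HilbertSchmidt

variable {H : Type*} [NormedAddCommGroup H] [InnerProductSpace ℂ H]
  {α : Type*} [MeasurableSpace α] {μ : Measure α}

/-- Parseval for the remainder, whose coefficients in F vanish and whose other coefficients are
those of x. -/
theorem norm_sub_sum_repr_sq {ι : Type*} (b : HilbertBasis ι ℂ H) (F : Finset ι) (x : H) :
    Summable (fun i : {i // i ∉ F} => ‖inner ℂ (b i) x‖ ^ 2) ∧
    ‖x - ∑ i ∈ F, inner ℂ (b i) x • b i‖ ^ 2 = ∑' i : {i // i ∉ F}, ‖inner ℂ (b i) x‖ ^ 2 := by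
  classical
  set y := x - ∑ i ∈ F, inner ℂ (b i) x • b i with hy
  have h1 : HasSum (fun i => ‖inner ℂ (b i) y‖ ^ 2) (‖y‖ ^ 2) := by
    have h2 := b.hasSum_inner_mul_inner y y
    rw [inner_self_eq_norm_sq_to_K] at h2
    have h3 := Complex.hasSum_re h2
    convert h3 using 1
    · ext i
      rw [← inner_conj_symm y (b i), RCLike.conj_mul]
      norm_cast
    · norm_cast
  have h4 : ∀ i, inner ℂ (b i) y = if i ∈ F then 0 else inner ℂ (b i) x := by
    intro i
    rw [hy, inner_sub_right, inner_sum]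
    simp only [inner_smul_right, orthonormal_iff_ite.1 b.orthonormal]
    simp only [mul_ite, mul_one, mul_zero, Finset.sum_ite_eq]
    split_ifs <;> simp
  have h5 : HasSum (fun i : {i // i ∉ F} => ‖inner ℂ (b i) y‖ ^ 2) (‖y‖ ^ 2) := by
    refine (hasSum_subtype_iff_of_support_subset (s := {i | i ∉ F}) ?_).2 h1
    intro i hi hF
    simp [h4, hF] at hi
  have h6 : HasSum (fun i : {i // i ∉ F} => ‖inner ℂ (b i) x‖ ^ 2) (‖y‖ ^ 2) := by
    convert h5 using 4 with i
    rw [h4, if_neg i.2]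
  exact ⟨h6.summable, h6.tsum_eq.symm⟩

/-- Hilbert-Schmidt operators are compact: the adjoint of an operator with square-integrable kernel. -/
theorem isCompactOperator_adjoint_of_kernel [CompleteSpace H] (T : H →L[ℂ] Lp ℂ 2 μ) (k : α → H)
    (hk : ∀ v, ∀ᵐ x ∂μ, T v x = inner ℂ (k x) v) (hfin : ∫⁻ x, ‖k x‖ₑ ^ 2 ∂μ ≠ ⊤) :
    IsCompactOperator (ContinuousLinearMap.adjoint T) := by
  classical
  obtain ⟨w, b, -⟩ := exists_hilbertBasis ℂ H
  set M := (∫⁻ x, ‖k x‖ₑ ^ 2 ∂μ).toReal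
  have henorm : ∀ f : Lp ℂ 2 μ, ENNReal.ofReal (‖f‖ ^ 2) = ∫⁻ x, ‖f x‖ₑ ^ 2 ∂μ := by
    intro f
    rw [Lp.norm_def, ← ENNReal.toReal_pow, ENNReal.ofReal_toReal
      (ENNReal.pow_ne_top (Lp.eLpNorm_ne_top f)), eLpNorm_eq_lintegral_rpow_enorm_toReal (by simp) (by simp)]
    simp only [ENNReal.toReal_ofNat, ENNReal.rpow_ofNat]
    rw [← ENNReal.rpow_natCast, ← ENNReal.rpow_mul]
    simp
  -- Bessel's inequality for k(x) at almost every x, integrated, bounds each finite sum by ∫ ‖k‖².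
  have hsum : Summable fun i => ‖T (b i)‖ ^ 2 := by
    refine summable_of_sum_le (c := M) (fun _ => by positivity) fun F => ?_
    rw [← ENNReal.ofReal_le_iff_le_toReal hfin, ENNReal.ofReal_sum_of_nonneg (fun _ _ => by positivity)]
    simp only [henorm]
    rw [← lintegral_finsetSum' _ (fun i _ => (Lp.aestronglyMeasurable _).enorm.pow_const 2)]
    have hall : ∀ᵐ x ∂μ, ∀ i ∈ F, T (b i) x = inner ℂ (k x) (b i) :=
      (Finset.eventually_all F).2 fun i _ => hk (b i)
    refine lintegral_mono_ae (hall.mono fun x hx => ?_)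
    have h1 := b.orthonormal.sum_inner_products_le (s := F) (k x)
    have h2 : ∑ i ∈ F, ‖T (b i) x‖ₑ ^ 2 = ENNReal.ofReal (∑ i ∈ F, ‖inner ℂ (b i) (k x)‖ ^ 2) := by
      rw [ENNReal.ofReal_sum_of_nonneg (fun _ _ => by positivity)]
      refine Finset.sum_congr rfl fun i hi => ?_
      rw [hx i hi, norm_inner_symm, ENNReal.ofReal_pow (norm_nonneg _), ofReal_norm]
    rw [h2, ← ofReal_norm, ← ENNReal.ofReal_pow (norm_nonneg _)]
    exact ENNReal.ofReal_le_ofReal h1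
  let P : Finset w → H →L[ℂ] H := fun F => ∑ i ∈ F, (innerSL ℂ (b i)).smulRight (b i)
  have hP : ∀ F x, P F x = ∑ i ∈ F, inner ℂ (b i) x • b i := by
    intro F x
    simp [P]
  have hPc : ∀ F, IsCompactOperator (P F) := by
    intro F
    refine Finset.sum_induction (fun i => (innerSL ℂ (b i)).smulRight (b i))
      (fun S : H →L[ℂ] H => IsCompactOperator S) (fun _ _ h1 h2 => h1.add h2)
      isCompactOperator_zero fun i _ => ?_
    have h1 : IsCompactOperator (innerSL ℂ (b i)) :=
      isCompactOperator_of_locallyCompactSpace_dom _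
    exact h1.clm_comp ((1 : ℂ →L[ℂ] ℂ).smulRight (b i))
  refine isCompactOperator_of_tendsto (l := atTop) (F := fun F => P F ∘L ContinuousLinearMap.adjoint T)
    ?_ (Eventually.of_forall fun F => (hPc F).comp_clm _)
  rw [tendsto_iff_norm_sub_tendsto_zero]
  have htail := tendsto_tsum_compl_atTop_zero fun i => ‖T (b i)‖ ^ 2
  have htail2 := htail.sqrt
  rw [Real.sqrt_zero] at htail2
  refine squeeze_zero (fun _ => norm_nonneg _) (fun F => ?_) htail2
  rw [norm_sub_rev]
  refine ContinuousLinearMap.opNorm_le_bound _ (Real.sqrt_nonneg _) fun v => ?_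
  obtain ⟨h1, h2⟩ := norm_sub_sum_repr_sq b F (ContinuousLinearMap.adjoint T v)
  rw [← hP] at h2
  -- The coefficients ⟨b_i, T* v⟩ = ⟨T b_i, v⟩ are at most ‖T b_i‖ ‖v‖, so the finite rank operators
  -- P_F T* converge in norm with error the tail of ∑ ‖T b_i‖².
  have h3 : ∑' i : {i // i ∉ F}, ‖inner ℂ (b i) (ContinuousLinearMap.adjoint T v)‖ ^ 2 ≤
      (∑' i : {i // i ∉ F}, ‖T (b i)‖ ^ 2) * ‖v‖ ^ 2 := by
    rw [← tsum_mul_right]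
    refine h1.tsum_le_tsum (fun i => ?_) ((hsum.subtype _).mul_right _)
    rw [ContinuousLinearMap.adjoint_inner_right, ← mul_pow]
    gcongr
    exact norm_inner_le_norm _ _
  have h4 := Real.sqrt_le_sqrt (h2.trans_le h3)
  rwa [Real.sqrt_sq (norm_nonneg _), Real.sqrt_mul' _ (sq_nonneg _),
    Real.sqrt_sq (norm_nonneg _)] at h4

end HilbertSchmidt

/-! ### The Moyal product as a superposition of translations and modulations -/

namespace Moyal

/-- The rotation `x ↦ (x 1, -x 0)` of the plane. -/
def rot : Plane ≃ₗᵢ[ℝ] Plane where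
  toFun x := !₂[x 1, -x 0]
  invFun x := !₂[-x 1, x 0]
  map_add' x y := by ext i; fin_cases i <;> simp [add_comm]
  map_smul' c x := by ext i; fin_cases i <;> simp
  left_inv x := by ext i; fin_cases i <;> simp
  right_inv x := by ext i; fin_cases i <;> simp
  norm_map' x := by simp [EuclideanSpace.norm_eq, Fin.sum_univ_two, add_comm]

theorem rot_symm_zero (x : Plane) : rot.symm x 0 = -x 1 := rfl

theorem rot_symm_one (x : Plane) : rot.symm x 1 = x 0 := rfl

/-- The translation vector `π Θ ξ` of left Moyal multiplication by the plane wave of frequency `ξ`. -/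
def shift (θ : ℝ) : Plane →L[ℝ] Plane := (Real.pi * θ) • (rot : Plane →L[ℝ] Plane)

theorem shift_apply (θ : ℝ) (x : Plane) : shift θ x = (Real.pi * θ) • rot x := rfl

theorem shift_zero_coord (θ : ℝ) (x : Plane) : shift θ x 0 = Real.pi * θ * x 1 := by
  simp [shift_apply, rot]

theorem shift_one_coord (θ : ℝ) (x : Plane) : shift θ x 1 = -(Real.pi * θ * x 0) := by
  simp [shift_apply, rot]

theorem inner_plane (x y : Plane) : inner ℝ x y = x 0 * y 0 + x 1 * y 1 := by
  simp [PiLp.inner_apply, Fin.sum_univ_two, mul_comm]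

theorem inner_shift_right (θ : ℝ) (x y : Plane) : inner ℝ x (shift θ y) = -inner ℝ (shift θ x) y := by
  simp only [inner_plane, shift_zero_coord, shift_one_coord]
  ring

theorem inner_shift_self (θ : ℝ) (x : Plane) : inner ℝ x (shift θ x) = 0 := by
  simp only [inner_plane, shift_zero_coord, shift_one_coord]
  ring

/-- The plane wave `exp(2 π i ξ x)`. -/
def wave (ξ x : Plane) : ℂ := Complex.exp (((2 * Real.pi * inner ℝ ξ x : ℝ) : ℂ) * Complex.I)

theorem norm_wave (ξ x : Plane) : ‖wave ξ x‖ = 1 := Complex.norm_exp_ofReal_mul_I _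

theorem wave_add_right (ξ x y : Plane) : wave ξ (x + y) = wave ξ x * wave ξ y := by
  rw [wave, wave, wave, ← Complex.exp_add, inner_add_right]
  push_cast
  ring_nf

theorem wave_comm (ξ x : Plane) : wave ξ x = wave x ξ := by
  rw [wave, wave, real_inner_comm]

theorem wave_add_left (ξ η x : Plane) : wave (ξ + η) x = wave ξ x * wave η x := by
  rw [wave_comm, wave_add_right, wave_comm x, wave_comm x]

theorem wave_conj (ξ x : Plane) : (starRingEnd ℂ) (wave ξ x) = wave (-ξ) x := by
  rw [wave, wave, ← Complex.exp_conj, inner_neg_left, map_mul, Complex.conj_ofReal, Complex.conj_I]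
  push_cast
  ring_nf

/-- Antisymmetry of Θ; this is the phase identity that makes left and right Moyal multiplications
commute. -/
theorem wave_shift_swap (θ : ℝ) (ξ η : Plane) : wave η (-shift θ ξ) = wave ξ (shift θ η) := by
  rw [wave, wave, inner_neg_right, inner_shift_right, neg_neg, real_inner_comm]

theorem wave_shift_self (θ : ℝ) (ξ : Plane) : wave ξ (shift θ ξ) = 1 := by
  rw [wave, inner_shift_self]
  simp

theorem continuous_wave : Continuous fun p : Plane × Plane => wave p.1 p.2 := by
  unfold wave
  fun_prop

@[fun_prop]
theorem Continuous.wave {X : Type*} [TopologicalSpace X] {f g : X → Plane} (hf : Continuous f)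
    (hg : Continuous g) : Continuous fun x => Moyal.wave (f x) (g x) :=
  continuous_wave.comp (hf.prodMk hg)

theorem fourier_eq_wave (a : 𝓢(Plane, ℂ)) (ξ : Plane) : 𝓕 a ξ = ∫ x, wave (-ξ) x * a x := by
  rw [fourier_coe, Real.fourier_eq']
  refine integral_congr_ae (Eventually.of_forall fun x => ?_)
  simp only [wave, inner_neg_left, real_inner_comm, smul_eq_mul]
  ring_nf

theorem eq_integral_wave_fourier (a : 𝓢(Plane, ℂ)) (x : Plane) : a x = ∫ ξ, wave ξ x * 𝓕 a ξ := by
  have h : 𝓕⁻ (𝓕 a) x = a x := by rw [FourierTransform.fourierInv_fourier_eq]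
  rw [← h, fourierInv_coe, Real.fourierInv_eq']
  rfl

theorem fourier_conj (a : 𝓢(Plane, ℂ)) (ξ : Plane) : 𝓕 (conj a) ξ = (starRingEnd ℂ) (𝓕 a (-ξ)) := by
  rw [fourier_eq_wave, fourier_eq_wave, ← integral_conj]
  refine integral_congr_ae (Eventually.of_forall fun x => ?_)
  simp [conj_apply, wave_conj]

theorem conj_conj (a : 𝓢(Plane, ℂ)) : conj (conj a) = a := by
  ext x
  simp [conj_apply]

theorem integral_comp_shift {θ : ℝ} (hθ : 0 < θ) (f : Plane → ℂ) :
    ∫ ξ, f (shift θ ξ) = ((1 / (Real.pi * θ) ^ 2 : ℝ) : ℂ) * ∫ x, f x := by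
  have h1 := Measure.integral_comp_smul (volume : Measure Plane) f (Real.pi * θ)
  have h2 := (rot.measurePreserving).integral_comp rot.toHomeomorph.measurableEmbedding
    (fun x => f ((Real.pi * θ) • x))
  simp only [shift_apply]
  rw [h2, h1, finrank_euclideanSpace, Fintype.card_fin, abs_of_pos (by positivity), one_div]
  simp

theorem integrable_moyal (θ : ℝ) (a b : 𝓢(Plane, ℂ)) (x : Plane) :
    Integrable (fun p : Plane × Plane => a (x + p.1) * b (x + p.2) *
    Complex.exp (-Complex.I * 2 * ((∑ μ, ∑ ν, p.1 μ * (Theta θ)⁻¹ μ ν * p.2 ν : ℝ) : ℂ)))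
    (volume.prod volume) := by
  refine Integrable.mul_bdd (c := 1) ?_ ?_ ?_
  · exact (a.integrable.comp_add_left x).mul_prod (b.integrable.comp_add_left x)
  · simp only [theta_form]
    exact Continuous.aestronglyMeasurable (by fun_prop)
  · refine Eventually.of_forall fun p => ?_
    rw [show ∀ t : ℝ, -Complex.I * 2 * (t : ℂ) = ((-2 * t : ℝ) : ℂ) * Complex.I by
      intro t; push_cast; ring, Complex.norm_exp_ofReal_mul_I]

/-- Exchanging y and z reverses the sign of the antisymmetric form, which compensates the
conjugation of the phase. -/
theorem moyalFun_conj (θ : ℝ) (a b : 𝓢(Plane, ℂ)) (x : Plane) :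
    (starRingEnd ℂ) (moyalFun θ a b x) = moyalFun θ (conj b) (conj a) x := by
  rw [moyalFun, moyalFun, map_mul, Complex.conj_ofReal, ← integral_conj]
  congr 1
  rw [integral_integral_swap (integrable_moyal θ (conj b) (conj a) x)]
  congr 1
  ext y
  rw [← integral_conj]
  congr 1
  ext z
  rw [map_mul, map_mul, ← Complex.exp_conj, conj_apply, conj_apply, theta_form, theta_form]
  simp only [map_mul, map_neg, Complex.conj_I, Complex.conj_ofReal, map_ofNat]
  rw [mul_comm (starRingEnd ℂ (a (x + y)))]
  congr 2
  push_cast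
  ring

theorem conj_moyalProd (θ : ℝ) (a b : 𝓢(Plane, ℂ)) :
    conj (moyalProd θ a b) = moyalProd θ (conj b) (conj a) := by
  ext x
  exact moyalFun_conj θ a b x

/-- Left Moyal multiplication as an integral operator. -/
theorem moyalProd_eq_kernel {θ : ℝ} (hθ : 0 < θ) (a b : 𝓢(Plane, ℂ)) (x : Plane) :
    moyalProd θ a b x = ((1 / (Real.pi * θ) ^ 2 : ℝ) : ℂ) * ∫ z,
      𝓕 a ((Real.pi * θ)⁻¹ • rot.symm z) * (wave ((Real.pi * θ)⁻¹ • rot.symm z) x * b (x + z)) := by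
  -- With the integral over y inside, the phase is a plane wave in y, and translating y by x leaves
  -- the Fourier transform of a times a modulation at x.
  rw [moyalProd_apply, moyalFun, integral_integral_swap (integrable_moyal θ a b x)]
  congr 2
  ext z
  set w := (Real.pi * θ)⁻¹ • rot.symm z with hw
  have h1 : ∀ y : Plane, Complex.exp (-Complex.I * 2 *
      ((∑ μ, ∑ ν, y μ * (Theta θ)⁻¹ μ ν * z ν : ℝ) : ℂ)) = wave (-w) y := by
    intro y
    rw [theta_form, wave, inner_plane]
    congr 1
    have h0 : w 0 = (Real.pi * θ)⁻¹ * -z 1 := by simp [hw, rot_symm_zero]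
    have h2 : w 1 = (Real.pi * θ)⁻¹ * z 0 := by simp [hw, rot_symm_one]
    simp only [PiLp.neg_apply, h0, h2]
    push_cast
    have : (Real.pi : ℂ) ≠ 0 := by exact_mod_cast Real.pi_ne_zero
    have : (θ : ℂ) ≠ 0 := by exact_mod_cast hθ.ne'
    field_simp
    ring
  simp only [h1]
  have h2 : ∫ y, a (x + y) * b (x + z) * wave (-w) y =
      ∫ y, wave w x * b (x + z) * (wave (-w) (x + y) * a (x + y)) := by
    congr 1
    ext y
    rw [wave_add_right]
    have h3 : wave w x * wave (-w) x = 1 := by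
      rw [← wave_add_left]; simp [wave]
    linear_combination (-(b (x + z) * wave (-w) y * a (x + y))) * h3
  rw [h2, integral_const_mul, integral_add_left_eq_self (fun y => wave (-w) y * a y) x,
    ← fourier_eq_wave]
  ring

/-- Left Moyal multiplication as a superposition of translations and modulations. -/
theorem moyalProd_eq_left {θ : ℝ} (hθ : 0 < θ) (a b : 𝓢(Plane, ℂ)) (x : Plane) :
    moyalProd θ a b x = ∫ ξ, 𝓕 a ξ * (wave ξ x * b (x + shift θ ξ)) := by
  have h := integral_comp_shift hθ fun z =>
    𝓕 a ((Real.pi * θ)⁻¹ • rot.symm z) * (wave ((Real.pi * θ)⁻¹ • rot.symm z) x * b (x + z))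
  rw [moyalProd_eq_kernel hθ, ← h]
  congr 1
  ext ξ
  have : (Real.pi * θ)⁻¹ • rot.symm (shift θ ξ) = ξ := by
    rw [shift_apply, map_smul, smul_smul, inv_mul_cancel₀ (by positivity), one_smul,
      LinearIsometryEquiv.symm_apply_apply]
  rw [this]

/-- Right Moyal multiplication as a superposition of translations and modulations. -/
theorem moyalProd_eq_right {θ : ℝ} (hθ : 0 < θ) (a b : 𝓢(Plane, ℂ)) (x : Plane) :
    moyalProd θ a b x = ∫ ξ, 𝓕 b ξ * (wave ξ x * a (x - shift θ ξ)) := by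
  -- The right formula is the conjugate of the left one, since conjugation reverses products.
  have h1 : moyalProd θ a b x = (starRingEnd ℂ) (moyalProd θ (conj b) (conj a) x) := by
    rw [← conj_moyalProd, conj_apply, Complex.conj_conj]
  rw [h1, moyalProd_eq_left hθ, ← integral_conj, ← integral_neg_eq_self]
  congr 1
  ext ξ
  simp [fourier_conj, conj_apply, wave_conj, sub_eq_add_neg]

theorem norm_le_const (f : 𝓢(Plane, ℂ)) : ∃ C, 0 ≤ C ∧ ∀ x, ‖f x‖ ≤ C :=
  ⟨_, apply_nonneg _ _, fun x => f.norm_le_seminorm ℝ x⟩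

/-- Associativity says that left multiplication by a commutes with right multiplication by c.
Expanding the former over the frequencies of a and the latter over those of c reduces it to
`wave_shift_swap` and Fubini. -/
theorem moyalProd_assoc {θ : ℝ} (hθ : 0 < θ) (a b c : 𝓢(Plane, ℂ)) :
    moyalProd θ (moyalProd θ a b) c = moyalProd θ a (moyalProd θ b c) := by
  ext x
  rw [moyalProd_eq_right hθ, moyalProd_eq_left hθ]
  have h1 : ∀ ξ, 𝓕 c ξ * (wave ξ x * moyalProd θ a b (x - shift θ ξ)) =
      ∫ η, 𝓕 c ξ * 𝓕 a η * (wave ξ x * wave η (x - shift θ ξ) * b (x - shift θ ξ + shift θ η)) := by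
    intro ξ
    rw [moyalProd_eq_left hθ, ← integral_const_mul, ← integral_const_mul]
    congr 1
    ext η
    ring
  have h2 : ∀ η, 𝓕 a η * (wave η x * moyalProd θ b c (x + shift θ η)) =
      ∫ ξ, 𝓕 c ξ * 𝓕 a η * (wave ξ x * wave η (x - shift θ ξ) * b (x - shift θ ξ + shift θ η)) := by
    intro η
    rw [moyalProd_eq_right hθ, ← integral_const_mul, ← integral_const_mul]
    congr 1
    ext ξ
    have e1 : wave ξ (x + shift θ η) = wave ξ x * wave ξ (shift θ η) := wave_add_right _ _ _
    have e2 : wave η (x - shift θ ξ) = wave η x * wave ξ (shift θ η) := by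
      rw [sub_eq_add_neg, wave_add_right, wave_shift_swap]
    rw [e1, e2, sub_add_eq_add_sub]
    ring
  simp only [h1, h2]
  refine integral_integral_swap ?_
  obtain ⟨C, -, hC⟩ := norm_le_const b
  refine Integrable.mul_bdd (c := C) ((𝓕 c).integrable.mul_prod (𝓕 a).integrable) ?_ ?_
  · exact Continuous.aestronglyMeasurable (by fun_prop)
  · refine Eventually.of_forall fun p => ?_
    rw [norm_mul, norm_mul, norm_wave, norm_wave, one_mul, one_mul]
    exact hC _

/-! ### Bounded operators on L²: left Moyal multiplication and pointwise multiplication -/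

/-- The inclusion of the Schwartz space in `L²`. -/
abbrev toL2 : 𝓢(Plane, ℂ) →ₗ[ℂ] L2 :=
  (SchwartzMap.toLpCLM ℂ ℂ 2 (volume : Measure Plane)).toLinearMap

theorem denseRange_toL2 : DenseRange toL2 :=
  SchwartzMap.denseRange_toLpCLM (F := ℂ) (by simp : (2 : ℝ≥0∞) ≠ ⊤)

theorem toL2_injective : Function.Injective toL2 :=
  SchwartzMap.injective_toLp (μ := (volume : Measure Plane)) 2

theorem inner_toL2 (f g : 𝓢(Plane, ℂ)) :
    inner ℂ (toL2 f) (toL2 g) = ∫ x, (starRingEnd ℂ) (f x) * g x := by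
  refine (inner_toL2_toL2_eq f g volume).trans ?_
  simp [mul_comm]

theorem norm_toL2 (f : 𝓢(Plane, ℂ)) : ‖toL2 f‖ = (∫ x, ‖f x‖ ^ (2 : ℝ)) ^ (1 / 2 : ℝ) := by
  have h := norm_toLp' (f := f) (p := 2) (μ := (volume : Measure Plane)) (by simp) (by simp)
  simpa using h

theorem norm_toL2_le_of_le {f g : 𝓢(Plane, ℂ)} {C : ℝ} (h : ∀ x, ‖f x‖ ≤ C * ‖g x‖) :
    ‖toL2 f‖ ≤ C * ‖toL2 g‖ := by
  refine Lp.norm_le_mul_norm_of_ae_le_mul ?_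
  filter_upwards [f.coeFn_toLp 2 volume, g.coeFn_toLp 2 volume] with x hf hg
  change ‖f.toLp 2 volume x‖ ≤ C * ‖g.toLp 2 volume x‖
  rw [hf, hg]
  exact h x

/-- Modulations and translations preserve the L² norm; Hölder's inequality does the rest. -/
theorem norm_integral_wave_le (f g : 𝓢(Plane, ℂ)) (ξ s : Plane) :
    ‖∫ x, (starRingEnd ℂ) (f x) * (wave ξ x * g (x + s))‖ ≤ ‖toL2 f‖ * ‖toL2 g‖ := by
  have hm : MemLp (fun x => g (x + s)) (ENNReal.ofReal 2) volume := by
    rw [ENNReal.ofReal_ofNat]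
    exact (g.memLp 2 volume).comp_measurePreserving (measurePreserving_add_right volume s)
  have hf : MemLp f (ENNReal.ofReal 2) volume := by
    rw [ENNReal.ofReal_ofNat]
    exact f.memLp 2 volume
  have h := integral_mul_norm_le_Lp_mul_Lq Real.HolderConjugate.two_two hf hm
  refine (norm_integral_le_integral_norm _).trans ?_
  rw [norm_toL2, norm_toL2, ← integral_add_right_eq_self (fun x => ‖g x‖ ^ (2 : ℝ)) s]
  simpa [norm_wave] using h

/-- The matrix elements of left Moyal multiplication. -/
theorem inner_toL2_moyalProd {θ : ℝ} (hθ : 0 < θ) (a f g : 𝓢(Plane, ℂ)) :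
    inner ℂ (toL2 f) (toL2 (moyalProd θ a g)) =
      ∫ ξ, 𝓕 a ξ * ∫ x, (starRingEnd ℂ) (f x) * (wave ξ x * g (x + shift θ ξ)) := by
  rw [inner_toL2]
  simp only [moyalProd_eq_left hθ, ← integral_const_mul]
  rw [integral_integral_swap]
  · congr 1
    ext ξ
    congr 1
    ext x
    ring
  · obtain ⟨C, -, hC⟩ := norm_le_const g
    have h1 : Integrable (fun p : Plane × Plane => (starRingEnd ℂ) (f p.1) * 𝓕 a p.2)
        (volume.prod volume) := (conj f).integrable.mul_prod (𝓕 a).integrable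
    have h2 : Integrable (fun p : Plane × Plane => (starRingEnd ℂ) (f p.1) * 𝓕 a p.2 *
        (wave p.2 p.1 * g (p.1 + shift θ p.2))) (volume.prod volume) := by
      refine h1.mul_bdd (c := C) (Continuous.aestronglyMeasurable (by fun_prop)) ?_
      refine Eventually.of_forall fun p => ?_
      rw [norm_mul, norm_wave, one_mul]
      exact hC _
    refine h2.congr (Eventually.of_forall fun p => ?_)
    simp [Function.uncurry, mul_assoc]

/-- The `L¹` norm of the Fourier transform, which bounds the norm of left Moyal multiplication. -/
def fourierNorm (a : 𝓢(Plane, ℂ)) : ℝ := ∫ ξ, ‖𝓕 a ξ‖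

theorem fourierNorm_nonneg (a : 𝓢(Plane, ℂ)) : 0 ≤ fourierNorm a :=
  integral_nonneg fun _ => norm_nonneg _

theorem norm_toL2_moyalProd_le {θ : ℝ} (hθ : 0 < θ) (a g : 𝓢(Plane, ℂ)) :
    ‖toL2 (moyalProd θ a g)‖ ≤ fourierNorm a * ‖toL2 g‖ := by
  set f := moyalProd θ a g with hf
  -- The matrix elements are tested on f = a ⋆ g itself; one factor ‖f‖ is divided out at the end.
  have h1 : ‖inner ℂ (toL2 f) (toL2 f)‖ ≤ fourierNorm a * (‖toL2 f‖ * ‖toL2 g‖) := by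
    nth_rw 2 [hf]
    rw [inner_toL2_moyalProd hθ, fourierNorm, ← integral_mul_const]
    refine norm_integral_le_of_norm_le ((𝓕 a).integrable.norm.mul_const _)
      (Eventually.of_forall fun ξ => ?_)
    rw [norm_mul]
    gcongr
    exact norm_integral_wave_le f g ξ _
  rw [inner_self_eq_norm_sq_to_K, norm_pow, RCLike.norm_ofReal, abs_norm] at h1
  rcases (norm_nonneg (toL2 f)).eq_or_lt with h0 | h0
  · rw [← h0]
    exact mul_nonneg (fourierNorm_nonneg a) (norm_nonneg _)
  · nlinarith

/-- The bounded extension to `L²` of an operator on the Schwartz space. -/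
def extendL2 (k : 𝓢(Plane, ℂ) →ₗ[ℂ] 𝓢(Plane, ℂ)) : L2 →L[ℂ] L2 := (toL2 ∘ₗ k).extendOfNorm toL2

theorem extendL2_toL2 {k : 𝓢(Plane, ℂ) →ₗ[ℂ] 𝓢(Plane, ℂ)} {C : ℝ}
    (h : ∀ f, ‖toL2 (k f)‖ ≤ C * ‖toL2 f‖) (f : 𝓢(Plane, ℂ)) : extendL2 k (toL2 f) = toL2 (k f) :=
  LinearMap.extendOfNorm_eq denseRange_toL2 ⟨C, h⟩ f

theorem norm_extendL2_le {k : 𝓢(Plane, ℂ) →ₗ[ℂ] 𝓢(Plane, ℂ)} {C : ℝ} (hC : 0 ≤ C)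
    (h : ∀ f, ‖toL2 (k f)‖ ≤ C * ‖toL2 f‖) : ‖extendL2 k‖ ≤ C :=
  LinearMap.opNorm_extendOfNorm_le denseRange_toL2 hC h

theorem clm_ext_toL2 {F : Type*} [NormedAddCommGroup F] [NormedSpace ℂ F] {S T : L2 →L[ℂ] F}
    (h : ∀ f, S (toL2 f) = T (toL2 f)) : S = T := by
  ext1 x
  exact congrFun (denseRange_toL2.equalizer S.continuous T.continuous (funext h)) x

theorem adjoint_eq_of_inner {S T : L2 →L[ℂ] L2}
    (h : ∀ f g, inner ℂ (toL2 f) (S (toL2 g)) = inner ℂ (T (toL2 f)) (toL2 g)) :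
    ContinuousLinearMap.adjoint S = T := by
  refine clm_ext_toL2 fun f => ?_
  refine denseRange_toL2.eq_of_inner_left (𝕜 := ℂ) fun g => ?_
  rw [ContinuousLinearMap.adjoint_inner_left, h]

section leftMul

variable {θ : ℝ} (hθ : 0 < θ)
include hθ

theorem leftMul_toL2 (a f : 𝓢(Plane, ℂ)) : leftMul θ a (toL2 f) = toL2 (moyalProd θ a f) :=
  extendL2_toL2 (k := moyalLeft θ a) (norm_toL2_moyalProd_le hθ a) f

theorem norm_leftMul_le (a : 𝓢(Plane, ℂ)) : ‖leftMul θ a‖ ≤ fourierNorm a :=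
  norm_extendL2_le (k := moyalLeft θ a) (fourierNorm_nonneg a) (norm_toL2_moyalProd_le hθ a)

/-- The adjoint of each modulated translation is the one of opposite frequency, without an extra
phase because ξ is orthogonal to Θξ. The substitution ξ ↦ -ξ turns the conjugate of â into the
Fourier transform of the conjugate of a. -/
theorem adjoint_leftMul (a : 𝓢(Plane, ℂ)) :
    ContinuousLinearMap.adjoint (leftMul θ a) = leftMul θ (conj a) := by
  refine adjoint_eq_of_inner fun f g => ?_
  rw [leftMul_toL2 hθ, leftMul_toL2 hθ, ← inner_conj_symm (toL2 (moyalProd θ (conj a) f)),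
    inner_toL2_moyalProd hθ, inner_toL2_moyalProd hθ, ← integral_conj, ← integral_neg_eq_self]
  congr 1
  ext ξ
  rw [map_mul, fourier_conj, ← integral_conj, Complex.conj_conj]
  congr 1
  simp only [map_mul, map_neg]
  rw [← integral_add_right_eq_self _ (shift θ ξ)]
  congr 1
  ext x
  simp only [← wave_conj, wave_add_right, wave_shift_self, map_one, mul_one, Complex.conj_conj,
    add_neg_cancel_right]
  ring

end leftMul

theorem moyalProd_add_right (θ : ℝ) (a b c : 𝓢(Plane, ℂ)) :
    moyalProd θ a (b + c) = moyalProd θ a b + moyalProd θ a c := (moyalLeft θ a).map_add b c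

theorem moyalProd_smul_right (θ : ℝ) (t : ℂ) (a b : 𝓢(Plane, ℂ)) :
    moyalProd θ a (t • b) = t • moyalProd θ a b := (moyalLeft θ a).map_smul t b

theorem conj_add (a b : 𝓢(Plane, ℂ)) : conj (a + b) = conj a + conj b := by
  ext x; simp [conj_apply]

theorem conj_smul (t : ℂ) (a : 𝓢(Plane, ℂ)) : conj (t • a) = (starRingEnd ℂ) t • conj a := by
  ext x; simp [conj_apply]

theorem moyalProd_add_left (θ : ℝ) (a b c : 𝓢(Plane, ℂ)) :
    moyalProd θ (a + b) c = moyalProd θ a c + moyalProd θ b c := by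
  rw [← conj_conj (moyalProd θ (a + b) c), conj_moyalProd, conj_add, moyalProd_add_right, conj_add,
    conj_moyalProd, conj_moyalProd]
  simp only [conj_conj]

theorem moyalProd_smul_left (θ : ℝ) (t : ℂ) (a b : 𝓢(Plane, ℂ)) :
    moyalProd θ (t • a) b = t • moyalProd θ a b := by
  rw [← conj_conj (moyalProd θ (t • a) b), conj_moyalProd, conj_smul, moyalProd_smul_right, conj_smul,
    conj_moyalProd]
  simp only [conj_conj, Complex.conj_conj]

/-- Pointwise multiplication by a Schwartz function. -/
def schwartzMul (b : 𝓢(Plane, ℂ)) : 𝓢(Plane, ℂ) →ₗ[ℂ] 𝓢(Plane, ℂ) := (smulLeftCLM ℂ b).toLinearMap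

theorem schwartzMul_apply (b f : 𝓢(Plane, ℂ)) (x : Plane) : schwartzMul b f x = b x * f x :=
  smulLeftCLM_apply_apply b.hasTemperateGrowth f x

theorem norm_toL2_schwartzMul_le {b : 𝓢(Plane, ℂ)} {C : ℝ} (hb : ∀ x, ‖b x‖ ≤ C) (f : 𝓢(Plane, ℂ)) :
    ‖toL2 (schwartzMul b f)‖ ≤ C * ‖toL2 f‖ := by
  refine norm_toL2_le_of_le fun x => ?_
  rw [schwartzMul_apply, norm_mul]
  gcongr
  exact hb x

/-- The multiplication operator on `L²`. -/
def mulOp (b : 𝓢(Plane, ℂ)) : L2 →L[ℂ] L2 := extendL2 (schwartzMul b)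

theorem mulOp_toL2 (b f : 𝓢(Plane, ℂ)) : mulOp b (toL2 f) = toL2 (schwartzMul b f) := by
  obtain ⟨C, -, hC⟩ := norm_le_const b
  exact extendL2_toL2 (norm_toL2_schwartzMul_le hC) f

theorem norm_mulOp_le {b : 𝓢(Plane, ℂ)} {C : ℝ} (hb : ∀ x, ‖b x‖ ≤ C) : ‖mulOp b‖ ≤ C :=
  norm_extendL2_le ((norm_nonneg _).trans (hb 0)) (norm_toL2_schwartzMul_le hb)

theorem adjoint_mulOp (b : 𝓢(Plane, ℂ)) : ContinuousLinearMap.adjoint (mulOp b) = mulOp (conj b) := by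
  refine adjoint_eq_of_inner fun f g => ?_
  rw [mulOp_toL2, mulOp_toL2, inner_toL2, inner_toL2]
  congr 1
  ext x
  simp only [schwartzMul_apply, conj_apply, map_mul, Complex.conj_conj]
  ring

section leftMul

variable {θ : ℝ} (hθ : 0 < θ)
include hθ

theorem leftMul_add (a b : 𝓢(Plane, ℂ)) : leftMul θ (a + b) = leftMul θ a + leftMul θ b := by
  refine clm_ext_toL2 fun f => ?_
  rw [_root_.add_apply, leftMul_toL2 hθ, leftMul_toL2 hθ, leftMul_toL2 hθ, moyalProd_add_left, map_add]

theorem leftMul_smul (t : ℂ) (a : 𝓢(Plane, ℂ)) : leftMul θ (t • a) = t • leftMul θ a := by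
  refine clm_ext_toL2 fun f => ?_
  rw [_root_.smul_apply, leftMul_toL2 hθ, leftMul_toL2 hθ, moyalProd_smul_left, map_smul]

theorem leftMul_sub (a b : 𝓢(Plane, ℂ)) : leftMul θ (a - b) = leftMul θ a - leftMul θ b := by
  rw [sub_eq_add_neg, sub_eq_add_neg, leftMul_add hθ, ← neg_one_smul ℂ b, leftMul_smul hθ, neg_one_smul]

theorem leftMul_moyalProd (a b : 𝓢(Plane, ℂ)) :
    leftMul θ (moyalProd θ a b) = leftMul θ a ∘L leftMul θ b := by
  refine clm_ext_toL2 fun f => ?_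
  rw [ContinuousLinearMap.comp_apply, leftMul_toL2 hθ, leftMul_toL2 hθ, leftMul_toL2 hθ,
    moyalProd_assoc hθ]

theorem norm_leftMul_conj (a : 𝓢(Plane, ℂ)) : ‖leftMul θ (conj a)‖ = ‖leftMul θ a‖ := by
  rw [← adjoint_leftMul hθ, LinearIsometryEquiv.norm_map]

end leftMul

/-! ### Derivations -/

theorem partialDeriv_apply (μ : Fin 2) (f : 𝓢(Plane, ℂ)) (x : Plane) :
    partialDeriv μ f x = fderiv ℝ f x (EuclideanSpace.single μ (1 : ℝ)) := by
  exact lineDerivOp_apply_eq_fderiv _ f x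

theorem hasDerivAt_line (μ : Fin 2) (f : 𝓢(Plane, ℂ)) (x : Plane) (t : ℝ) :
    HasDerivAt (fun t : ℝ => f (x + t • EuclideanSpace.single μ (1 : ℝ)))
      (partialDeriv μ f (x + t • EuclideanSpace.single μ (1 : ℝ))) t := by
  have h1 : HasDerivAt (fun t : ℝ => x + t • EuclideanSpace.single μ (1 : ℝ))
      (EuclideanSpace.single μ (1 : ℝ)) t := by
    simpa using ((hasDerivAt_id t).smul_const (EuclideanSpace.single μ (1 : ℝ))).const_add x
  rw [partialDeriv_apply]
  exact (f.hasFDerivAt _).comp_hasDerivAt t h1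

theorem partialDeriv_eq_of_hasDerivAt {μ : Fin 2} {f : 𝓢(Plane, ℂ)} {x : Plane} {v : ℂ}
    (h : HasDerivAt (fun t : ℝ => f (x + t • EuclideanSpace.single μ (1 : ℝ))) v 0) :
    partialDeriv μ f x = v := by
  have := (hasDerivAt_line μ f x 0).unique h
  simpa using this

theorem partialDeriv_conj (μ : Fin 2) (f : 𝓢(Plane, ℂ)) :
    partialDeriv μ (conj f) = conj (partialDeriv μ f) := by
  ext x
  refine partialDeriv_eq_of_hasDerivAt ?_
  have := (hasDerivAt_line μ f x 0).star
  simp only [zero_smul, add_zero] at this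
  exact this

theorem mulTildeX_conj (θ : ℝ) (μ : Fin 2) (f : 𝓢(Plane, ℂ)) :
    mulTildeX θ μ (conj f) = conj (mulTildeX θ μ f) := by
  ext x
  simp only [mulTildeX_apply, conj_apply, map_mul]
  rw [tildeX, Complex.conj_ofReal]

theorem fourier_partialDeriv (μ : Fin 2) (f : 𝓢(Plane, ℂ)) (ξ : Plane) :
    𝓕 (partialDeriv μ f) ξ = 2 * Real.pi * Complex.I * (ξ μ : ℂ) * 𝓕 f ξ := by
  have h := DFunLike.congr_fun (fourier_lineDerivOp_eq f (EuclideanSpace.single μ (1 : ℝ))) ξ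
  refine h.trans ?_
  have hg : Function.HasTemperateGrowth
      fun x : Plane => inner ℝ x (EuclideanSpace.single μ (1 : ℝ)) := by
    fun_prop
  rw [_root_.smul_apply, smulLeftCLM_apply_apply hg]
  rw [EuclideanSpace.inner_single_right]
  simp
  ring

theorem tildeX_add (θ : ℝ) (μ : Fin 2) (x y : Plane) :
    tildeX θ μ (x + y) = tildeX θ μ x + tildeX θ μ y := by
  simp [tildeX]
  ring

theorem tildeX_zero (θ : ℝ) (x : Plane) : tildeX θ 0 x = ((-2 * θ⁻¹ * x 1 : ℝ) : ℂ) := by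
  rw [tildeX, theta_inv]
  congr 1
  simp [Fin.sum_univ_two]
  ring

theorem tildeX_one (θ : ℝ) (x : Plane) : tildeX θ 1 x = ((2 * θ⁻¹ * x 0 : ℝ) : ℂ) := by
  rw [tildeX, theta_inv]
  congr 1
  simp [Fin.sum_univ_two]
  ring

/-- The translation attached to the frequency ξ changes x̃_μ by 2πξ_μ, the symbol of -i∂_μ. This is
why commutators with x̃ are again derivatives. -/
theorem tildeX_shift {θ : ℝ} (hθ : 0 < θ) (μ : Fin 2) (ξ : Plane) :
    tildeX θ μ (shift θ ξ) = 2 * Real.pi * (ξ μ : ℂ) := by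
  have h : θ⁻¹ * θ = 1 := inv_mul_cancel₀ hθ.ne'
  fin_cases μ
  · change tildeX θ 0 _ = _
    rw [tildeX_zero, shift_one_coord,
      show -2 * θ⁻¹ * -(Real.pi * θ * ξ 0) = 2 * Real.pi * ξ 0 * (θ⁻¹ * θ) by ring, h]
    simp
  · change tildeX θ 1 _ = _
    rw [tildeX_one, shift_zero_coord,
      show 2 * θ⁻¹ * (Real.pi * θ * ξ 1) = 2 * Real.pi * ξ 1 * (θ⁻¹ * θ) by ring, h]
    simp

theorem integrable_left {θ : ℝ} (a b : 𝓢(Plane, ℂ)) (x : Plane) :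
    Integrable fun ξ => 𝓕 a ξ * (wave ξ x * b (x + shift θ ξ)) := by
  obtain ⟨C, -, hC⟩ := norm_le_const b
  refine (𝓕 a).integrable.mul_bdd (c := C) (Continuous.aestronglyMeasurable (by fun_prop)) ?_
  refine Eventually.of_forall fun ξ => ?_
  rw [norm_mul, norm_wave, one_mul]
  exact hC _

theorem mulTildeX_moyalProd {θ : ℝ} (hθ : 0 < θ) (μ : Fin 2) (a f : 𝓢(Plane, ℂ)) :
    mulTildeX θ μ (moyalProd θ a f) =
      moyalProd θ a (mulTildeX θ μ f) + Complex.I • moyalProd θ (partialDeriv μ a) f := by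
  ext x
  rw [mulTildeX_apply, _root_.add_apply, _root_.smul_apply, smul_eq_mul, moyalProd_eq_left hθ,
    moyalProd_eq_left hθ, moyalProd_eq_left hθ, ← integral_const_mul, ← integral_const_mul,
    ← integral_add (integrable_left _ _ _) ((integrable_left _ _ _).const_mul _)]
  congr 1
  ext ξ
  rw [mulTildeX_apply, tildeX_add, tildeX_shift hθ, fourier_partialDeriv]
  linear_combination (-2 * Real.pi * (ξ μ : ℂ) * 𝓕 a ξ * (wave ξ x * f (x + shift θ ξ))) *
    Complex.I_mul_I

theorem hasDerivAt_wave_line (μ : Fin 2) (ξ x : Plane) (t : ℝ) :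
    HasDerivAt (fun t : ℝ => wave ξ (x + t • EuclideanSpace.single μ (1 : ℝ)))
      (2 * Real.pi * Complex.I * (ξ μ : ℂ) * wave ξ (x + t • EuclideanSpace.single μ (1 : ℝ))) t := by
  have h1 : HasDerivAt (fun t : ℝ =>
      ((2 * Real.pi * inner ℝ ξ (x + t • EuclideanSpace.single μ (1 : ℝ)) : ℝ) : ℂ) * Complex.I)
      ((2 * Real.pi * (1 * ξ μ) : ℝ) * Complex.I) t := by
    refine HasDerivAt.mul_const (HasDerivAt.ofReal_comp ?_) _
    simp only [inner_add_right, inner_smul_right, EuclideanSpace.inner_single_right]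
    simp only [one_mul, conj_trivial]
    exact (((hasDerivAt_id t).mul_const _).const_add _).const_mul _ |>.congr_deriv (by simp)
  have h2 := h1.cexp
  refine h2.congr_deriv ?_
  simp only [wave]
  push_cast
  ring

/-- Differentiation under the integral: the wave contributes ∂_μ a and the translate contributes ∂_μ
f. The dominating function is integrable because the Fourier transforms of a and ∂_μ a are Schwartz.
-/
theorem partialDeriv_moyalProd {θ : ℝ} (hθ : 0 < θ) (μ : Fin 2) (a f : 𝓢(Plane, ℂ)) :
    partialDeriv μ (moyalProd θ a f) =
      moyalProd θ (partialDeriv μ a) f + moyalProd θ a (partialDeriv μ f) := by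
  ext x
  refine partialDeriv_eq_of_hasDerivAt ?_
  set e : Plane := EuclideanSpace.single μ (1 : ℝ)
  obtain ⟨C, -, hC⟩ := norm_le_const f
  obtain ⟨C', -, hC'⟩ := norm_le_const (partialDeriv μ f)
  have key := (hasDerivAt_integral_of_dominated_loc_of_deriv_le (𝕜 := ℝ) (μ := volume) (x₀ := 0)
    (s := Set.univ)
    (F := fun t ξ => 𝓕 a ξ * (wave ξ (x + t • e) * f (x + t • e + shift θ ξ)))
    (F' := fun t ξ => 𝓕 (partialDeriv μ a) ξ * (wave ξ (x + t • e) * f (x + t • e + shift θ ξ)) +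
      𝓕 a ξ * (wave ξ (x + t • e) * partialDeriv μ f (x + t • e + shift θ ξ)))
    (bound := fun ξ => ‖𝓕 (partialDeriv μ a) ξ‖ * C + ‖𝓕 a ξ‖ * C') univ_mem
    (Eventually.of_forall fun t => (integrable_left a f _).aestronglyMeasurable)
    (integrable_left a f _)
    (((integrable_left _ _ _).add (integrable_left _ _ _)).aestronglyMeasurable)
    (Eventually.of_forall fun ξ t _ => ?_)
    (((𝓕 (partialDeriv μ a)).integrable.norm.mul_const _).add ((𝓕 a).integrable.norm.mul_const _))
    (Eventually.of_forall fun ξ t _ => ?_)).2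
  · simp only [← moyalProd_eq_left hθ] at key
    refine key.congr_deriv ?_
    rw [integral_add (integrable_left _ _ _) (integrable_left _ _ _), ← moyalProd_eq_left hθ,
      ← moyalProd_eq_left hθ]
    simp
  · refine (norm_add_le _ _).trans ?_
    simp only [norm_mul, norm_wave, one_mul]
    gcongr
    · exact hC _
    · exact hC' _
  · have h1 : HasDerivAt (fun t : ℝ => f (x + t • e + shift θ ξ))
        (partialDeriv μ f (x + t • e + shift θ ξ)) t := by
      have := hasDerivAt_line μ f (x + shift θ ξ) t
      simpa only [add_right_comm] using this
    have h2 := ((hasDerivAt_wave_line μ ξ x t).mul h1).const_mul (𝓕 a ξ)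
    refine h2.congr_deriv ?_
    rw [fourier_partialDeriv]
    ring

/-- The conjugate of `mulTildeX_moyalProd`, with the factors exchanged. -/
theorem moyalProd_mulTildeX_left {θ : ℝ} (hθ : 0 < θ) (μ : Fin 2) (a f : 𝓢(Plane, ℂ)) :
    moyalProd θ (mulTildeX θ μ a) f =
      mulTildeX θ μ (moyalProd θ a f) + Complex.I • moyalProd θ a (partialDeriv μ f) := by
  have h := congrArg conj (mulTildeX_moyalProd hθ μ (conj f) (conj a))
  rw [← mulTildeX_conj, conj_add, conj_smul, conj_moyalProd, conj_moyalProd, conj_moyalProd,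
    ← mulTildeX_conj, ← partialDeriv_conj, conj_conj, conj_conj, Complex.conj_I] at h
  rw [h, neg_smul, neg_add_cancel_right]

/-- A derivative of a product is traded for multiplications by x̃ on its factors; no derivative of f
remains. This makes the regularized Dirac operator bounded. -/
theorem partialDeriv_moyalProd_eq {θ : ℝ} (hθ : 0 < θ) (μ : Fin 2) (a f : 𝓢(Plane, ℂ)) :
    partialDeriv μ (moyalProd θ a f) =
      (-Complex.I) • (moyalProd θ (mulTildeX θ μ a) f - moyalProd θ a (mulTildeX θ μ f)) := by
  rw [moyalProd_mulTildeX_left hθ, mulTildeX_moyalProd hθ, partialDeriv_moyalProd hθ]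
  have : Complex.I * Complex.I = -1 := Complex.I_mul_I
  match_scalars <;> simp

/-! ### A slowly varying approximate unit -/

/-- A bump function of integral one on the ball of radius `1 / (n + 1)`. -/
def bump (n : ℕ) : ContDiffBump (0 : Plane) where
  rIn := 1 / (2 * (n + 1))
  rOut := 1 / (n + 1)
  rIn_pos := by positivity
  rIn_lt_rOut := by
    apply one_div_lt_one_div_of_lt (by positivity)
    have : (0 : ℝ) < n + 1 := by positivity
    linarith

theorem bump_hasCompactSupport (n : ℕ) :
    HasCompactSupport fun x => (((bump n).normed volume x : ℝ) : ℂ) :=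
  (bump n).hasCompactSupport_normed.comp_left (g := fun t : ℝ => (t : ℂ)) Complex.ofReal_zero

/-- The normalized bump function as a Schwartz function. -/
def bumpSchwartz (n : ℕ) : 𝓢(Plane, ℂ) :=
  (bump_hasCompactSupport n).toSchwartzMap
    (Complex.ofRealCLM.contDiff.comp (bump n).contDiff_normed)

theorem bumpSchwartz_apply (n : ℕ) (x : Plane) :
    bumpSchwartz n x = (((bump n).normed volume x : ℝ) : ℂ) := rfl

theorem norm_bumpSchwartz (n : ℕ) (x : Plane) : ‖bumpSchwartz n x‖ = (bump n).normed volume x := by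
  rw [bumpSchwartz_apply, Complex.norm_real, Real.norm_of_nonneg ((bump n).nonneg_normed x)]

theorem integral_bumpSchwartz (n : ℕ) : ∫ x, bumpSchwartz n x = 1 := by
  simp only [bumpSchwartz_apply]
  rw [integral_complex_ofReal, (bump n).integral_normed, Complex.ofReal_one]

theorem integral_norm_bumpSchwartz (n : ℕ) : ∫ x, ‖bumpSchwartz n x‖ = 1 := by
  simp only [norm_bumpSchwartz]
  exact (bump n).integral_normed

theorem bumpSchwartz_eq_zero {n : ℕ} {x : Plane} (h : 1 / (n + 1 : ℝ) < ‖x‖) : bumpSchwartz n x = 0 := by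
  have : (bump n).normed volume x = 0 := by
    rw [← Function.notMem_support, (bump n).support_normed_eq, Metric.mem_ball, dist_zero_right]
    exact not_lt.2 h.le
  rw [bumpSchwartz_apply, this, Complex.ofReal_zero]

theorem norm_integral_bump_le {n : ℕ} {F : Plane → ℂ} {M : ℝ}
    (h : ∀ ξ : Plane, ‖ξ‖ ≤ 1 / (n + 1 : ℝ) → ‖F ξ‖ ≤ M) : ‖∫ ξ, bumpSchwartz n ξ * F ξ‖ ≤ M := by
  have h1 : ∫ ξ, ‖bumpSchwartz n ξ‖ * M = M := by
    rw [integral_mul_const, integral_norm_bumpSchwartz, one_mul]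
  rw [← h1]
  refine norm_integral_le_of_norm_le ((bumpSchwartz n).integrable.norm.mul_const _)
    (Eventually.of_forall fun ξ => ?_)
  rw [norm_mul]
  rcases lt_or_ge (1 / (n + 1 : ℝ)) ‖ξ‖ with h2 | h2
  · rw [bumpSchwartz_eq_zero h2]
    simp
  · gcongr
    exact h ξ h2

theorem norm_integral_bump_sub_le {n : ℕ} {F : Plane → ℂ} (hF : Continuous F) {B : ℝ}
    (hB : ∀ ξ, ‖F ξ‖ ≤ B) {c : ℂ} {M : ℝ}
    (h : ∀ ξ : Plane, ‖ξ‖ ≤ 1 / (n + 1 : ℝ) → ‖F ξ - c‖ ≤ M) :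
    ‖(∫ ξ, bumpSchwartz n ξ * F ξ) - c‖ ≤ M := by
  have h1 : (∫ ξ, bumpSchwartz n ξ * F ξ) - c = ∫ ξ, bumpSchwartz n ξ * (F ξ - c) := by
    simp only [mul_sub]
    rw [integral_sub, integral_mul_const, integral_bumpSchwartz, one_mul]
    · exact (bumpSchwartz n).integrable.mul_bdd hF.aestronglyMeasurable (Eventually.of_forall hB)
    · exact (bumpSchwartz n).integrable.mul_const _
  rw [h1]
  exact norm_integral_bump_le h

/-- An approximate unit of the Moyal algebra, with slowly varying elements. -/
def unitSeq (n : ℕ) : 𝓢(Plane, ℂ) := 𝓕⁻ (bumpSchwartz n)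

theorem fourier_unitSeq (n : ℕ) : 𝓕 (unitSeq n) = bumpSchwartz n :=
  FourierTransform.fourier_fourierInv_eq _

theorem unitSeq_apply (n : ℕ) (x : Plane) : unitSeq n x = ∫ ξ, bumpSchwartz n ξ * wave ξ x := by
  rw [eq_integral_wave_fourier, fourier_unitSeq]
  simp only [mul_comm]

theorem norm_le_fourierNorm (f : 𝓢(Plane, ℂ)) (x : Plane) : ‖f x‖ ≤ fourierNorm f := by
  rw [eq_integral_wave_fourier]
  refine (norm_integral_le_integral_norm _).trans_eq ?_
  simp [norm_wave, fourierNorm]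

theorem fourierNorm_unitSeq (n : ℕ) : fourierNorm (unitSeq n) = 1 := by
  rw [fourierNorm, fourier_unitSeq, integral_norm_bumpSchwartz]

theorem norm_unitSeq_le (n : ℕ) (x : Plane) : ‖unitSeq n x‖ ≤ 1 :=
  (norm_le_fourierNorm _ x).trans_eq (fourierNorm_unitSeq n)

theorem norm_coord_le (x : Plane) (μ : Fin 2) : |x μ| ≤ ‖x‖ := PiLp.norm_apply_le x μ

theorem fourierNorm_partialDeriv_unitSeq_le (μ : Fin 2) (n : ℕ) :
    fourierNorm (partialDeriv μ (unitSeq n)) ≤ 2 * Real.pi / (n + 1) := by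
  have h1 : ∫ ξ, ‖bumpSchwartz n ξ‖ * (2 * Real.pi / (n + 1)) = 2 * Real.pi / (n + 1) := by
    rw [integral_mul_const, integral_norm_bumpSchwartz, one_mul]
  rw [← h1, fourierNorm]
  refine integral_mono (𝓕 _ : 𝓢(Plane, ℂ)).integrable.norm
    ((bumpSchwartz n).integrable.norm.mul_const _) fun ξ => ?_
  simp only [fourier_partialDeriv, fourier_unitSeq]
  rcases lt_or_ge (1 / (n + 1 : ℝ)) ‖ξ‖ with h2 | h2
  · rw [bumpSchwartz_eq_zero h2]
    simp
  · rw [norm_mul, mul_comm]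
    gcongr
    have h3 : ‖2 * Real.pi * Complex.I * (ξ μ : ℂ)‖ = 2 * Real.pi * |ξ μ| := by
      simp [abs_of_pos Real.pi_pos]
    rw [h3]
    calc 2 * Real.pi * |ξ μ| ≤ 2 * Real.pi * (1 / (n + 1 : ℝ)) := by
          gcongr
          exact (norm_coord_le ξ μ).trans h2
      _ = _ := by ring

theorem norm_wave_sub_one_le (ξ x : Plane) : ‖wave ξ x - 1‖ ≤ 2 * Real.pi * (‖ξ‖ * ‖x‖) := by
  have h := Real.norm_exp_I_mul_ofReal_sub_one_le (x := 2 * Real.pi * inner ℝ ξ x)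
  rw [mul_comm Complex.I] at h
  refine h.trans ?_
  rw [norm_mul, Real.norm_of_nonneg (by positivity)]
  gcongr
  exact norm_inner_le_norm _ _

theorem norm_unitSeq_sub_one_le (n : ℕ) (x : Plane) :
    ‖unitSeq n x - 1‖ ≤ 2 * Real.pi / (n + 1) * ‖x‖ := by
  rw [unitSeq_apply]
  refine norm_integral_bump_sub_le (B := 1) (by fun_prop) (fun ξ => (norm_wave ξ x).le) fun ξ hξ => ?_
  refine (norm_wave_sub_one_le ξ x).trans ?_
  calc 2 * Real.pi * (‖ξ‖ * ‖x‖) ≤ 2 * Real.pi * (1 / (n + 1 : ℝ) * ‖x‖) := by gcongr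
    _ = _ := by ring

theorem exists_decay (f : 𝓢(Plane, ℂ)) (k n : ℕ) :
    ∃ C, 0 ≤ C ∧ ∀ x, (1 + ‖x‖) ^ k * ‖iteratedFDeriv ℝ n f x‖ ≤ C :=
  ⟨2 ^ k * (Finset.Iic (k, n)).sup (fun m => SchwartzMap.seminorm ℝ m.1 m.2) f, by positivity,
    fun x => one_add_le_sup_seminorm_apply (𝕜 := ℝ) (m := (k, n)) le_rfl le_rfl f x⟩

theorem one_add_norm_pow_le {x y : Plane} {b : ℝ} (h : ‖x - y‖ ≤ b) (k : ℕ) :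
    (1 + ‖x‖) ^ k ≤ (1 + b) ^ k * (1 + ‖y‖) ^ k := by
  rw [← mul_pow]
  gcongr
  have h1 : ‖x‖ ≤ ‖x - y‖ + ‖y‖ := by simpa using norm_add_le (x - y) y
  have h2 := norm_nonneg (x - y)
  nlinarith [norm_nonneg y]

/-- The rate of convergence of mollified modulations and translations of a Schwartz function. -/
theorem exists_bump_rate (f : 𝓢(Plane, ℂ)) (A B : Plane →L[ℝ] Plane) : ∃ C, 0 ≤ C ∧ ∀ n x,
    ‖(∫ ξ, bumpSchwartz n ξ * (wave x (A ξ) * f (x + B ξ))) - f x‖ ≤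
      C / (n + 1) * (1 + ‖x‖) ^ (-4 : ℝ) := by
  -- The weight of order 4 is to remain. The modulation error carries a factor ‖x‖, which costs one
  -- more power of decay of f; the translation error uses the decay of the first derivative.
  obtain ⟨C₀, hC₀, h₀⟩ := exists_decay f 5 0
  obtain ⟨C₁, hC₁, h₁⟩ := exists_decay f 4 1
  refine ⟨2 * Real.pi * ‖A‖ * ((1 + ‖B‖) ^ 5 * C₀) + ‖B‖ * ((1 + ‖B‖) ^ 4 * C₁), by positivity,
    fun n x => ?_⟩
  obtain ⟨M, -, hM⟩ := norm_le_const f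
  refine norm_integral_bump_sub_le (B := M) (by fun_prop) (fun ξ => ?_) fun ξ hξ => ?_
  · rw [norm_mul, norm_wave, one_mul]
    exact hM _
  have hw : (1 + ‖x‖) ^ (-4 : ℝ) = ((1 + ‖x‖) ^ 4)⁻¹ := by
    rw [Real.rpow_neg (by positivity)]
    norm_cast
  have hξ1 : ‖ξ‖ ≤ 1 := by
    refine hξ.trans ?_
    rw [div_le_one (by positivity)]
    simp
  have hBξ : ‖B ξ‖ ≤ ‖B‖ * ‖ξ‖ := B.le_opNorm ξ
  have hBξ1 : ‖B ξ‖ ≤ ‖B‖ := hBξ.trans (mul_le_of_le_one_right (norm_nonneg _) hξ1)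
  have e1 : (1 + ‖x‖) ^ 4 * (‖x‖ * ‖f (x + B ξ)‖) ≤ (1 + ‖B‖) ^ 5 * C₀ := by
    have h2 := one_add_norm_pow_le (x := x) (y := x + B ξ) (b := ‖B‖) (by simpa using hBξ1) 5
    have h3 := h₀ (x + B ξ)
    rw [norm_iteratedFDeriv_zero] at h3
    calc (1 + ‖x‖) ^ 4 * (‖x‖ * ‖f (x + B ξ)‖)
        ≤ (1 + ‖x‖) ^ 4 * ((1 + ‖x‖) * ‖f (x + B ξ)‖) := by gcongr; simp
      _ = (1 + ‖x‖) ^ 5 * ‖f (x + B ξ)‖ := by ring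
      _ ≤ ((1 + ‖B‖) ^ 5 * (1 + ‖x + B ξ‖) ^ 5) * ‖f (x + B ξ)‖ := by gcongr
      _ = (1 + ‖B‖) ^ 5 * ((1 + ‖x + B ξ‖) ^ 5 * ‖f (x + B ξ)‖) := by ring
      _ ≤ _ := by gcongr
  have e2 : (1 + ‖x‖) ^ 4 * ‖f (x + B ξ) - f x‖ ≤ (‖B‖ * ‖ξ‖) * ((1 + ‖B‖) ^ 4 * C₁) := by
    have h2 : ∀ y ∈ Metric.closedBall x ‖B‖, ‖fderiv ℝ f y‖ ≤
        ((1 + ‖x‖) ^ 4)⁻¹ * ((1 + ‖B‖) ^ 4 * C₁) := by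
      intro y hy
      have h3 := one_add_norm_pow_le (x := x) (y := y) (b := ‖B‖)
        (by rw [← dist_eq_norm, dist_comm]; exact hy) 4
      have h4 := h₁ y
      rw [norm_iteratedFDeriv_one] at h4
      rw [inv_mul_eq_div, le_div_iff₀' (by positivity)]
      calc (1 + ‖x‖) ^ 4 * ‖fderiv ℝ f y‖ ≤ ((1 + ‖B‖) ^ 4 * (1 + ‖y‖) ^ 4) * ‖fderiv ℝ f y‖ := by gcongr
        _ = (1 + ‖B‖) ^ 4 * ((1 + ‖y‖) ^ 4 * ‖fderiv ℝ f y‖) := by ring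
        _ ≤ _ := by gcongr
    have h5 := (convex_closedBall x ‖B‖).norm_image_sub_le_of_norm_fderiv_le (𝕜 := ℝ)
      (fun y _ => f.differentiableAt) h2 (Metric.mem_closedBall_self (norm_nonneg _))
      (y := x + B ξ) (by simpa using hBξ1)
    rw [add_sub_cancel_left] at h5
    calc (1 + ‖x‖) ^ 4 * ‖f (x + B ξ) - f x‖
        ≤ (1 + ‖x‖) ^ 4 * (((1 + ‖x‖) ^ 4)⁻¹ * ((1 + ‖B‖) ^ 4 * C₁) * ‖B ξ‖) := by gcongr
      _ = ‖B ξ‖ * ((1 + ‖B‖) ^ 4 * C₁) := by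
        field_simp
      _ ≤ _ := by gcongr
  rw [hw, ← div_eq_mul_inv, le_div_iff₀' (by positivity)]
  have e3 : ‖wave x (A ξ) * f (x + B ξ) - f x‖ ≤
      2 * Real.pi * (‖x‖ * (‖A‖ * ‖ξ‖)) * ‖f (x + B ξ)‖ + ‖f (x + B ξ) - f x‖ := by
    have : wave x (A ξ) * f (x + B ξ) - f x =
        (wave x (A ξ) - 1) * f (x + B ξ) + (f (x + B ξ) - f x) := by ring
    rw [this]
    refine (norm_add_le _ _).trans ?_
    rw [norm_mul]
    gcongr
    refine (norm_wave_sub_one_le _ _).trans ?_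
    gcongr
    exact A.le_opNorm ξ
  calc (1 + ‖x‖) ^ 4 * ‖wave x (A ξ) * f (x + B ξ) - f x‖
      ≤ (1 + ‖x‖) ^ 4 * (2 * Real.pi * (‖x‖ * (‖A‖ * ‖ξ‖)) * ‖f (x + B ξ)‖ + ‖f (x + B ξ) - f x‖) := by
        gcongr
    _ = 2 * Real.pi * (‖A‖ * ‖ξ‖) * ((1 + ‖x‖) ^ 4 * (‖x‖ * ‖f (x + B ξ)‖)) +
        (1 + ‖x‖) ^ 4 * ‖f (x + B ξ) - f x‖ := by ring
    _ ≤ 2 * Real.pi * (‖A‖ * ‖ξ‖) * ((1 + ‖B‖) ^ 5 * C₀) + (‖B‖ * ‖ξ‖) * ((1 + ‖B‖) ^ 4 * C₁) := by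
        gcongr
    _ = ‖ξ‖ * (2 * Real.pi * ‖A‖ * ((1 + ‖B‖) ^ 5 * C₀) + ‖B‖ * ((1 + ‖B‖) ^ 4 * C₁)) := by ring
    _ ≤ 1 / (n + 1 : ℝ) * (2 * Real.pi * ‖A‖ * ((1 + ‖B‖) ^ 5 * C₀) + ‖B‖ * ((1 + ‖B‖) ^ 4 * C₁)) := by
        gcongr
    _ = _ := by ring

theorem integrable_weight {r : ℝ} (hr : 2 < r) :
    Integrable (fun x : Plane => (1 + ‖x‖) ^ (-r)) volume := by
  refine integrable_one_add_norm ?_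
  rw [finrank_euclideanSpace]
  simpa using hr

theorem exists_unitSeq_rate_L2 {θ : ℝ} (hθ : 0 < θ) (f : 𝓢(Plane, ℂ)) : ∃ C, 0 ≤ C ∧ ∀ n,
    ‖toL2 (moyalProd θ (unitSeq n) f) - toL2 f‖ ≤ C / (n + 1 : ℝ) := by
  -- In position space the frequency ξ modulates by ξ and translates by πΘξ.
  obtain ⟨C, hC, h⟩ := exists_bump_rate f 1 (shift θ)
  set K := (∫ x : Plane, ((1 + ‖x‖) ^ (-4 : ℝ)) ^ (2 : ℝ)) ^ (1 / 2 : ℝ) with hK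
  have hK0 : 0 ≤ K := Real.rpow_nonneg (integral_nonneg fun x => by positivity) _
  refine ⟨C * K, by positivity, fun n => ?_⟩
  rw [← map_sub, norm_toL2]
  have hw : ∀ x : Plane, ((1 + ‖x‖) ^ (-4 : ℝ)) ^ (2 : ℝ) = (1 + ‖x‖) ^ (-8 : ℝ) := by
    intro x
    rw [← Real.rpow_mul (by positivity)]
    norm_num
  have h1 : ∫ x, ‖(moyalProd θ (unitSeq n) f - f) x‖ ^ (2 : ℝ) ≤
      (C / (n + 1)) ^ (2 : ℝ) * ∫ x : Plane, ((1 + ‖x‖) ^ (-4 : ℝ)) ^ (2 : ℝ) := by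
    rw [← integral_const_mul]
    refine integral_mono_of_nonneg (Eventually.of_forall fun x => by positivity) ?_
      (Eventually.of_forall fun x => ?_)
    · simp only [hw]
      exact (integrable_weight (by norm_num)).const_mul _
    · have h2 := h n x
      simp only [one_apply_eq_self] at h2
      beta_reduce
      rw [← Real.mul_rpow (by positivity) (by positivity)]
      refine Real.rpow_le_rpow (norm_nonneg _) ?_ (by norm_num)
      rw [_root_.sub_apply, moyalProd_eq_left hθ, fourier_unitSeq]
      simp only [wave_comm _ x]
      exact h2
  refine (Real.rpow_le_rpow (integral_nonneg fun x => by positivity) h1 (by norm_num)).trans_eq ?_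
  rw [Real.mul_rpow (by positivity) (integral_nonneg fun x => by positivity),
    ← Real.rpow_mul (by positivity), ← hK, mul_one_div_cancel two_ne_zero, Real.rpow_one]
  ring

/-- In Fourier space the Moyal product is a twisted convolution, so the same mollification estimate
controls u_n ⋆ a - a in the norm ‖â‖₁. -/
theorem fourier_moyalProd {θ : ℝ} (hθ : 0 < θ) (a b : 𝓢(Plane, ℂ)) (η : Plane) :
    𝓕 (moyalProd θ a b) η = ∫ ξ, 𝓕 a ξ * (wave η (shift θ ξ) * 𝓕 b (η - ξ)) := by
  rw [fourier_eq_wave]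
  simp only [moyalProd_eq_left hθ, ← integral_const_mul]
  rw [integral_integral_swap]
  · congr 1
    ext ξ
    rw [fourier_eq_wave b, ← integral_const_mul, ← integral_const_mul]
    symm
    rw [← integral_add_right_eq_self _ (shift θ ξ)]
    congr 1
    ext x
    have h1 : wave (-(η - ξ)) (x + shift θ ξ) =
        wave ξ x * wave (-η) x * wave (-η) (shift θ ξ) := by
      rw [neg_sub, sub_eq_add_neg, wave_add_left, wave_add_right, wave_add_right, wave_shift_self]
      ring
    have h2 : wave η (shift θ ξ) * wave (-η) (shift θ ξ) = 1 := by
      rw [← wave_add_left]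
      simp [wave]
    rw [h1]
    linear_combination (𝓕 a ξ * (wave ξ x * wave (-η) x * b (x + shift θ ξ))) * h2
  -- For fixed ξ the integrand is a translate of b in x up to a phase, so the inner integral of its
  -- modulus is |â(ξ)| ‖b‖₁.
  · rw [integrable_prod_iff' (Continuous.aestronglyMeasurable (by
      unfold Function.uncurry
      fun_prop))]
    simp only [Function.uncurry]
    refine ⟨Eventually.of_forall fun ξ => ?_, ?_⟩
    · have h1 := ((b.integrable (μ := volume)).comp_add_right (shift θ ξ)).norm.const_mul ‖𝓕 a ξ‖
      refine h1.mono' (Continuous.aestronglyMeasurable (by fun_prop)) (Eventually.of_forall fun x => ?_)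
      simp [norm_wave]
    · simp only [norm_mul, norm_wave, one_mul]
      have h1 : ∀ ξ, ∫ x, ‖𝓕 a ξ‖ * ‖b (x + shift θ ξ)‖ = ‖𝓕 a ξ‖ * ∫ x, ‖b x‖ := fun ξ => by
        rw [integral_const_mul, integral_add_right_eq_self (fun x => ‖b x‖)]
      simp only [h1]
      exact (𝓕 a).integrable.norm.mul_const _

theorem exists_unitSeq_rate_fourierNorm {θ : ℝ} (hθ : 0 < θ) (a : 𝓢(Plane, ℂ)) : ∃ C, 0 ≤ C ∧ ∀ n,
    fourierNorm (moyalProd θ (unitSeq n) a - a) ≤ C / (n + 1 : ℝ) := by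
  -- In Fourier space the roles change: modulation by πΘξ, translation by -ξ.
  obtain ⟨C, hC, h⟩ := exists_bump_rate (𝓕 a) (shift θ) (-1)
  set K := ∫ x : Plane, (1 + ‖x‖) ^ (-4 : ℝ) with hK
  have hK0 : 0 ≤ K := integral_nonneg fun x => by positivity
  refine ⟨C * K, by positivity, fun n => ?_⟩
  have h1 : C * K / (n + 1 : ℝ) = ∫ x : Plane, C / (n + 1) * (1 + ‖x‖) ^ (-4 : ℝ) := by
    rw [integral_const_mul, hK]
    ring
  rw [h1, fourierNorm]
  refine integral_mono_of_nonneg (Eventually.of_forall fun x => norm_nonneg _)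
    ((integrable_weight (by norm_num)).const_mul _) (Eventually.of_forall fun η => ?_)
  have h2 := h n η
  simp only [_root_.neg_apply, one_apply_eq_self, ← sub_eq_add_neg] at h2
  have h3 : 𝓕 (moyalProd θ (unitSeq n) a - a) = 𝓕 (moyalProd θ (unitSeq n) a) - 𝓕 a :=
    map_sub (FourierTransform.fourierCLM ℂ 𝓢(Plane, ℂ)) _ _
  simp only [h3]
  rw [_root_.sub_apply, fourier_moyalProd hθ, fourier_unitSeq]
  exact h2

end Moyal

/-- Strong convergence to the identity of a bounded sequence can be checked on a dense set. -/
theorem tendsto_apply_of_denseRange {E H : Type*} [NormedAddCommGroup H] [NormedSpace ℂ H]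
    {ι : E → H} (hι : DenseRange ι) (T : ℕ → H →L[ℂ] H) (hT : ∀ n, ‖T n‖ ≤ 1)
    (h : ∀ f, Tendsto (fun n => T n (ι f)) atTop (𝓝 (ι f))) (v : H) :
    Tendsto (fun n => T n v) atTop (𝓝 v) := by
  rw [Metric.tendsto_atTop]
  intro ε hε
  obtain ⟨f, hf⟩ := hι.exists_dist_lt v (ε := ε / 3) (by positivity)
  obtain ⟨N, hN⟩ := Metric.tendsto_atTop.1 (h f) (ε / 3) (by positivity)
  refine ⟨N, fun n hn => ?_⟩
  have h1 : dist (T n v) (T n (ι f)) ≤ dist v (ι f) := by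
    rw [dist_eq_norm, dist_eq_norm, ← map_sub]
    exact (T n).le_of_opNorm_le (hT n) _ |>.trans_eq (one_mul _)
  have h2 := dist_triangle4 (T n v) (T n (ι f)) (ι f) v
  have h3 := hN n hn
  rw [dist_comm (ι f) v] at h2
  linarith

namespace Moyal

theorem tendsto_const_div_succ (C : ℝ) : Tendsto (fun n : ℕ => C / (n + 1 : ℝ)) atTop (𝓝 0) := by
  have := (tendsto_one_div_add_atTop_nhds_zero_nat (𝕜 := ℝ)).const_mul C
  simpa [div_eq_mul_inv] using this

theorem tendsto_leftMul_unitSeq {θ : ℝ} (hθ : 0 < θ) (v : L2) :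
    Tendsto (fun n => leftMul θ (unitSeq n) v) atTop (𝓝 v) := by
  refine tendsto_apply_of_denseRange denseRange_toL2 (fun n => leftMul θ (unitSeq n))
    (fun n => (norm_leftMul_le hθ _).trans_eq (fourierNorm_unitSeq n)) (fun f => ?_) v
  obtain ⟨C, -, h⟩ := exists_unitSeq_rate_L2 hθ f
  rw [tendsto_iff_norm_sub_tendsto_zero]
  refine squeeze_zero (fun _ => norm_nonneg _) (fun n => ?_) (tendsto_const_div_succ C)
  rw [leftMul_toL2 hθ]
  exact h n

theorem tendsto_leftMul_unitSeq_moyalProd {θ : ℝ} (hθ : 0 < θ) (a : 𝓢(Plane, ℂ)) :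
    Tendsto (fun n => leftMul θ (moyalProd θ (unitSeq n) a)) atTop (𝓝 (leftMul θ a)) := by
  obtain ⟨C, -, h⟩ := exists_unitSeq_rate_fourierNorm hθ a
  rw [tendsto_iff_norm_sub_tendsto_zero]
  refine squeeze_zero (fun _ => norm_nonneg _) (fun n => ?_) (tendsto_const_div_succ C)
  rw [← leftMul_sub hθ]
  exact (norm_leftMul_le hθ _).trans (h n)

/-- If L(c) = 0, conjugating c ⋆ conj u_n = 0 gives u_n ⋆ conj c = 0, whose L² limit is conj c. -/
theorem leftMul_injective {θ : ℝ} (hθ : 0 < θ) : Function.Injective (leftMul θ) := by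
  intro a b hab
  rw [← sub_eq_zero, ← leftMul_sub hθ] at hab
  rw [← sub_eq_zero]
  set c := a - b
  have h1 : toL2 (conj c) = 0 := by
    obtain ⟨C, -, h⟩ := exists_unitSeq_rate_L2 hθ (conj c)
    have h2 : ∀ n, moyalProd θ (unitSeq n) (conj c) = 0 := by
      intro n
      have h3 : moyalProd θ c (conj (unitSeq n)) = 0 := by
        apply toL2_injective
        rw [← leftMul_toL2 hθ, hab, map_zero]
        rfl
      have h4 := congrArg conj h3
      rw [conj_moyalProd, conj_conj] at h4
      rw [h4]
      ext x
      simp [conj_apply]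
    simp only [h2, map_zero, zero_sub, norm_neg] at h
    exact norm_le_zero_iff.1 (ge_of_tendsto' (tendsto_const_div_succ C) h)
  have h5 : conj c = 0 := toL2_injective (h1.trans (map_zero toL2).symm)
  rw [← conj_conj c, h5]
  ext x
  simp [conj_apply]

/-- Multiplication by `x̃_0 + s x̃_1`. -/
def mulTilde (θ : ℝ) (s : ℂ) : 𝓢(Plane, ℂ) →ₗ[ℂ] 𝓢(Plane, ℂ) := mulTildeX θ 0 + s • mulTildeX θ 1

theorem norm_mulTilde_apply {θ : ℝ} (hθ : 0 < θ) {s : ℂ} (hs : s = Complex.I ∨ s = -Complex.I)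
    (f : 𝓢(Plane, ℂ)) (x : Plane) : ‖mulTilde θ s f x‖ = 2 / θ * (‖x‖ * ‖f x‖) := by
  have h1 : mulTilde θ s f x = (tildeX θ 0 x + s * tildeX θ 1 x) * f x := by
    rw [mulTilde, LinearMap.add_apply, LinearMap.smul_apply, _root_.add_apply, _root_.smul_apply,
      mulTildeX_apply, mulTildeX_apply, smul_eq_mul]
    ring
  have h2 : ‖tildeX θ 0 x + s * tildeX θ 1 x‖ = 2 / θ * ‖x‖ := by
    rw [tildeX_zero, tildeX_one, EuclideanSpace.norm_eq, Fin.sum_univ_two]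
    have h3 : ∀ u v : ℝ, ∀ t : ℂ, (t = Complex.I ∨ t = -Complex.I) → ‖(u : ℂ) + t * v‖ = √(u ^ 2 + v ^ 2) := by
      rintro u v t (rfl | rfl)
      · rw [mul_comm, Complex.norm_add_mul_I]
      · have : (u : ℂ) + -Complex.I * v = u + ((-v : ℝ) : ℂ) * Complex.I := by push_cast; ring
        rw [this, Complex.norm_add_mul_I, neg_sq]
    rw [h3 _ _ _ hs, ← Real.sqrt_sq (show 0 ≤ 2 / θ by positivity), ← Real.sqrt_mul (sq_nonneg _)]
    congr 1
    simp only [Real.norm_eq_abs, sq_abs]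
    ring
  rw [h1, norm_mul, h2, mul_assoc]

/-- From |u_n(x) - 1| ≤ 2π‖x‖/(n+1) and |x̃_0 ± i x̃_1| = (2/θ)‖x‖. The right side is what the Dirac
operator controls. -/
theorem norm_schwartzMul_unitSeq_sub_le {θ : ℝ} (hθ : 0 < θ) {s : ℂ}
    (hs : s = Complex.I ∨ s = -Complex.I) (n : ℕ) (f : 𝓢(Plane, ℂ)) :
    ‖toL2 (schwartzMul (unitSeq n) f) - toL2 f‖ ≤
      Real.pi * θ / (n + 1) * ‖toL2 (mulTilde θ s f)‖ := by
  rw [← map_sub]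
  refine norm_toL2_le_of_le fun x => ?_
  rw [_root_.sub_apply, schwartzMul_apply, norm_mulTilde_apply hθ hs]
  have h1 := norm_unitSeq_sub_one_le n x
  calc ‖unitSeq n x * f x - f x‖ = ‖unitSeq n x - 1‖ * ‖f x‖ := by rw [← norm_mul, sub_mul, one_mul]
    _ ≤ (2 * Real.pi / (n + 1) * ‖x‖) * ‖f x‖ := by gcongr
    _ = _ := by field_simp

theorem tendsto_mulOp_unitSeq (v : L2) : Tendsto (fun n => mulOp (unitSeq n) v) atTop (𝓝 v) := by
  refine tendsto_apply_of_denseRange denseRange_toL2 (fun n => mulOp (unitSeq n))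
    (fun n => norm_mulOp_le (norm_unitSeq_le n)) (fun f => ?_) v
  rw [tendsto_iff_norm_sub_tendsto_zero]
  refine squeeze_zero (fun _ => norm_nonneg _) (fun n => ?_)
    (tendsto_const_div_succ (Real.pi * 1 * ‖toL2 (mulTilde 1 Complex.I f)‖))
  rw [mulOp_toL2]
  refine (norm_schwartzMul_unitSeq_sub_le one_pos (Or.inl rfl) n f).trans_eq ?_
  ring

/-! ### Compactness of L(a)M(b), and absence of a unit -/

/-- An integral kernel for an operator on the Schwartz space is an integral kernel on `L²`. -/
theorem ae_eq_inner_of_toL2 (T : L2 →L[ℂ] L2) (k : Plane → L2)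
    (h : ∀ f, ∀ᵐ x, T (toL2 f) x = inner ℂ (k x) (toL2 f)) (v : L2) :
    ∀ᵐ x, T v x = inner ℂ (k x) v := by
  obtain ⟨u, hu, hlim⟩ := mem_closure_iff_seq_limit.1 (denseRange_toL2 v)
  choose f hf using hu
  have h1 : Tendsto (fun n => T (u n)) atTop (𝓝 (T v)) := (T.continuous.tendsto v).comp hlim
  obtain ⟨ns, hns, h2⟩ := (tendstoInMeasure_of_tendsto_Lp h1).exists_seq_tendsto_ae
  have h3 : ∀ᵐ x, ∀ n, T (u n) x = inner ℂ (k x) (u n) := by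
    rw [ae_all_iff]
    intro n
    rw [← hf n]
    exact h (f n)
  filter_upwards [h2, h3] with x hx2 hx3
  refine tendsto_nhds_unique hx2 ?_
  simp only [hx3]
  exact (tendsto_const_nhds.inner hlim).comp hns.tendsto_atTop

/-- The frequency `Θ⁻¹ z / π` of the translation by `z`. -/
def unshift {θ : ℝ} (hθ : 0 < θ) : Plane ≃L[ℝ] Plane :=
  (rot.symm.toContinuousLinearEquiv).trans
    (ContinuousLinearEquiv.smulLeft (Units.mk0 (Real.pi * θ)⁻¹ (by positivity)))

/-- The adjoint M(conj b) L(conj a) has a kernel of modulus c |b(x)| |g(y - x)|, with g the Fourier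
transform of conj a after a linear change of variables. It is square-integrable in both variables.
-/
theorem isCompactOperator_leftMul_mulOp {θ : ℝ} (hθ : 0 < θ) (a b : 𝓢(Plane, ℂ)) :
    IsCompactOperator (leftMul θ a ∘L mulOp b) := by
  set a' := conj a
  set b' := conj b
  set T := mulOp b' ∘L leftMul θ a' with hT
  have hadj : ContinuousLinearMap.adjoint T = leftMul θ a ∘L mulOp b := by
    rw [hT, ContinuousLinearMap.adjoint_comp, adjoint_mulOp, adjoint_leftMul hθ, conj_conj, conj_conj]
  rw [← hadj]
  set c : ℂ := ((1 / (Real.pi * θ) ^ 2 : ℝ) : ℂ)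
  set g : 𝓢(Plane, ℂ) := SchwartzMap.compCLMOfContinuousLinearEquiv ℂ (unshift hθ) (𝓕 a') with hg
  have hg_apply : ∀ z, g z = 𝓕 a' ((Real.pi * θ)⁻¹ • rot.symm z) := fun z => rfl
  set K : Plane → Plane → ℂ := fun x y => (starRingEnd ℂ)
    (b' x * (c * (g (y - x) * wave ((Real.pi * θ)⁻¹ • rot.symm (y - x)) x))) with hK
  have hKnorm : ∀ x y, ‖K x y‖ = ‖c * b' x‖ * ‖g (y - x)‖ := by
    intro x y
    simp only [hK, RCLike.norm_conj, norm_mul, norm_wave]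
    ring
  have hgm : ∀ x, MemLp (fun y => g (y - x)) 2 volume := fun x =>
    (g.memLp 2 volume).comp_measurePreserving (measurePreserving_sub_right volume x)
  have hgn : ∀ x, eLpNorm (fun y => g (y - x)) 2 volume = eLpNorm g 2 volume := fun x =>
    eLpNorm_comp_measurePreserving (g.memLp 2 volume).aestronglyMeasurable
      (measurePreserving_sub_right volume x)
  have hKc : ∀ x, Continuous (K x) := by
    intro x
    simp only [hK]
    fun_prop
  have hKm : ∀ x, MemLp (K x) 2 volume := fun x =>
    (hgm x).of_le_mul (hKc x).aestronglyMeasurable (Eventually.of_forall fun y => (hKnorm x y).le)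
  refine isCompactOperator_adjoint_of_kernel T (fun x => (hKm x).toLp (K x)) ?_ ?_
  · refine ae_eq_inner_of_toL2 T _ fun f => ?_
    rw [hT, ContinuousLinearMap.comp_apply, leftMul_toL2 hθ, mulOp_toL2]
    filter_upwards [(schwartzMul b' (moyalProd θ a' f)).coeFn_toLp 2 volume] with x hx
    refine hx.trans ?_
    rw [schwartzMul_apply, moyalProd_eq_kernel hθ, MeasureTheory.L2.inner_def]
    have h1 : ∀ᵐ y : Plane, inner ℂ ((hKm x).toLp (K x) y) (toL2 f y) =
        b' x * (c * (g (y - x) * (wave ((Real.pi * θ)⁻¹ • rot.symm (y - x)) x * f y))) := by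
      filter_upwards [(hKm x).coeFn_toLp, f.coeFn_toLp 2 volume] with y h2 h3
      have h3' : toL2 f y = f y := h3
      rw [h2, h3']
      simp only [RCLike.inner_apply, hK, Complex.conj_conj]
      ring
    rw [integral_congr_ae h1, integral_const_mul, integral_const_mul]
    congr 2
    symm
    rw [← integral_add_right_eq_self _ x]
    congr 1
    ext z
    rw [add_sub_cancel_right, hg_apply, add_comm z x]
  · have h1 : ∀ x, ‖(hKm x).toLp (K x)‖ₑ ≤ ‖c * b' x‖ₑ * eLpNorm g 2 volume := by
      intro x
      rw [Lp.enorm_toLp]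
      refine (eLpNorm_le_mul_eLpNorm_of_ae_le_mul
        (Eventually.of_forall fun y => (hKnorm x y).le) 2).trans_eq ?_
      rw [hgn, ofReal_norm]
    refine ne_top_of_le_ne_top ?_ (lintegral_mono fun x => pow_le_pow_left₀ bot_le (h1 x) 2)
    simp only [mul_pow]
    rw [lintegral_mul_const' _ _ (ENNReal.pow_ne_top (g.eLpNorm_lt_top 2 volume).ne)]
    refine ENNReal.mul_ne_top ?_ (ENNReal.pow_ne_top (g.eLpNorm_lt_top 2 volume).ne)
    have h2 := ((c • b').eLpNorm_lt_top 2 volume).ne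
    rw [eLpNorm_eq_lintegral_rpow_enorm_toReal (by simp) (by simp)] at h2
    intro h3
    apply h2
    have h4 : ∫⁻ x, ‖(c • b') x‖ₑ ^ (2 : ℝ≥0∞).toReal = ⊤ := by
      rw [← h3]
      congr 1
      ext x
      simp
    rw [h4]
    simp

/-- Since L(a) has a bounded kernel, |⟨f, a ⋆ f⟩| ≤ K ‖f‖₁² with K depending on a only. For narrow
bumps ‖f‖₁ = 1 while ‖f‖₂ is arbitrarily large, so L(a) is far from the identity on them. -/
theorem exists_inner_moyalProd_le {θ : ℝ} (hθ : 0 < θ) (a : 𝓢(Plane, ℂ)) : ∃ f : 𝓢(Plane, ℂ),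
    0 < ‖toL2 f‖ ∧ ‖inner ℂ (toL2 f) (toL2 (moyalProd θ a f))‖ ≤ 1 / 2 * ‖toL2 f‖ ^ 2 := by
  obtain ⟨A, hA0, hA⟩ := norm_le_const (𝓕 a)
  set K : ℝ := 1 / (Real.pi * θ) ^ 2 * A with hK
  have hK0 : 0 ≤ K := by positivity
  set t : ℝ := 2 * K + 1 with ht
  obtain ⟨n, hn⟩ := ((tendsto_const_div_succ (t * Real.pi)).eventually (gt_mem_nhds one_pos)).exists
  set f := bumpSchwartz n with hf
  have hsq : ‖toL2 f‖ ^ 2 = ∫ x, ‖f x‖ ^ 2 := by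
    rw [norm_toL2, ← Real.rpow_natCast, ← Real.rpow_mul (integral_nonneg fun x => by positivity)]
    simp
  set B := Metric.closedBall (0 : Plane) (1 / (n + 1 : ℝ)) with hB
  have hBvol : volume.real B = (1 / (n + 1 : ℝ)) ^ 2 * Real.pi := by
    rw [Measure.real, hB, EuclideanSpace.volume_closedBall_fin_two]
    rw [ENNReal.toReal_mul, ENNReal.toReal_pow, ENNReal.toReal_ofReal (by positivity)]
    simp [Real.pi_nonneg]
  have hint : Integrable fun x => ‖f x‖ ^ 2 := by
    simpa using (f.memLp 2 volume).integrable_norm_pow (by norm_num)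
  have hintB : Integrable (B.indicator fun _ => t ^ 2) :=
    (integrable_indicator_iff Metric.isClosed_closedBall.measurableSet).2
      (integrableOn_const measure_closedBall_lt_top.ne)
  have h1 : t ≤ ‖toL2 f‖ ^ 2 := by
    -- Integrating 2t|f| ≤ |f|² + t² on the support gives 2t ≤ ‖f‖₂² + t² vol(B), and n was chosen
    -- so that t² vol(B) ≤ t. Then ‖f‖₂² ≥ t = 2K + 1.
    have h2 : ∫ x, 2 * t * ‖f x‖ ≤ ∫ x, (‖f x‖ ^ 2 + B.indicator (fun _ => t ^ 2) x) := by
      refine integral_mono (f.integrable.norm.const_mul _) (hint.add hintB) fun x => ?_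
      · by_cases hx : x ∈ B
        · simp only [Set.indicator_of_mem hx]
          nlinarith [sq_nonneg (‖f x‖ - t)]
        · have : f x = 0 := bumpSchwartz_eq_zero (by simpa [hB] using hx)
          simp [Set.indicator_of_notMem hx, this]
    rw [integral_const_mul, integral_norm_bumpSchwartz, integral_add hint hintB, ← hsq,
      integral_indicator Metric.isClosed_closedBall.measurableSet, setIntegral_const, hBvol] at h2
    have h5 : (1 / (n + 1 : ℝ)) ^ 2 * Real.pi * t ^ 2 ≤ t := by
      have h6 : 1 / (n + 1 : ℝ) ≤ 1 := by
        rw [div_le_one (by positivity)]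
        linarith [n.cast_nonneg (α := ℝ)]
      have h7 : (1 / (n + 1 : ℝ)) ^ 2 * Real.pi * t ^ 2 =
          (1 / (n + 1 : ℝ)) * (t * Real.pi / (n + 1)) * t := by ring
      rw [h7]
      refine mul_le_of_le_one_left (by positivity) ?_
      exact mul_le_one₀ h6 (by positivity) hn.le
    rw [smul_eq_mul] at h2
    linarith
  have h3 : ∀ x, ‖moyalProd θ a f x‖ ≤ K := by
    intro x
    rw [moyalProd_eq_kernel hθ, norm_mul, Complex.norm_real, Real.norm_of_nonneg (by positivity), hK]
    gcongr
    have h4 : ∫ z, A * ‖f (x + z)‖ = A := by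
      rw [integral_const_mul, integral_add_left_eq_self (fun z => ‖f z‖), integral_norm_bumpSchwartz,
        mul_one]
    rw [← h4]
    refine norm_integral_le_of_norm_le ((f.integrable.comp_add_left x).norm.const_mul _)
      (Eventually.of_forall fun z => ?_)
    rw [norm_mul, norm_mul, norm_wave, one_mul]
    gcongr
    exact hA _
  refine ⟨f, ?_, ?_⟩
  · have : 0 < ‖toL2 f‖ ^ 2 := lt_of_lt_of_le (by positivity) h1
    exact (norm_nonneg _).lt_of_ne' (sq_pos_iff.1 this)
  · have h5 : ‖inner ℂ (toL2 f) (toL2 (moyalProd θ a f))‖ ≤ K := by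
      have h6 : ∫ x, ‖f x‖ * K = K := by
        rw [integral_mul_const, integral_norm_bumpSchwartz, one_mul]
      rw [inner_toL2, ← h6]
      refine norm_integral_le_of_norm_le (f.integrable.norm.mul_const _)
        (Eventually.of_forall fun x => ?_)
      rw [norm_mul, RCLike.norm_conj]
      gcongr
      exact h3 x
    linarith

/-! ### Operators on spinors -/

theorem toSpinor_apply (ψ : Fin 2 × Fin 2 → 𝓢(Plane, ℂ)) (i : Fin 2 × Fin 2) :
    toSpinor ψ i = toL2 (ψ i) := rfl

theorem denseRange_toSpinor : DenseRange toSpinor := by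
  have h1 : DenseRange (Pi.map fun _ : Fin 2 × Fin 2 => (toL2 : 𝓢(Plane, ℂ) → L2)) :=
    DenseRange.piMap fun _ => denseRange_toL2
  exact (PiLp.homeomorph 2 (fun _ : Fin 2 × Fin 2 => L2)).symm.surjective.denseRange.comp h1
    (PiLp.homeomorph 2 (fun _ : Fin 2 × Fin 2 => L2)).symm.continuous

/-- The operator on spinors with a given matrix of operators on `L²(ℝ²)`. -/
def matOp (T : Fin 2 × Fin 2 → Fin 2 × Fin 2 → L2 →L[ℂ] L2) : Spinor →L[ℂ] Spinor :=
  (PiLp.continuousLinearEquiv 2 ℂ (fun _ : Fin 2 × Fin 2 => L2)).symm.toContinuousLinearMap ∘L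
    ContinuousLinearMap.pi fun i => ∑ j, T i j ∘L PiLp.proj 2 (fun _ : Fin 2 × Fin 2 => L2) j

theorem matOp_apply (T : Fin 2 × Fin 2 → Fin 2 × Fin 2 → L2 →L[ℂ] L2) (ψ : Spinor)
    (i : Fin 2 × Fin 2) : matOp T ψ i = ∑ j, T i j (ψ j) := by
  have : matOp T ψ i = (∑ j, T i j ∘L PiLp.proj 2 (fun _ : Fin 2 × Fin 2 => L2) j) ψ := rfl
  rw [this, _root_.sum_apply]
  rfl

theorem norm_spinor_le_sum (ψ : Spinor) : ‖ψ‖ ≤ ∑ i, ‖ψ i‖ := by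
  refine le_of_sq_le_sq ?_ (Finset.sum_nonneg fun _ _ => norm_nonneg _)
  rw [PiLp.norm_sq_eq_of_L2, sq, Finset.sum_mul]
  refine Finset.sum_le_sum fun i hi => ?_
  rw [sq]
  gcongr
  exact Finset.single_le_sum (f := fun i => ‖ψ i‖) (fun _ _ => norm_nonneg _) hi

theorem norm_matOp_le {T : Fin 2 × Fin 2 → Fin 2 × Fin 2 → L2 →L[ℂ] L2}
    {C : Fin 2 × Fin 2 → Fin 2 × Fin 2 → ℝ} (h : ∀ i j, ‖T i j‖ ≤ C i j) :
    ‖matOp T‖ ≤ ∑ i, ∑ j, C i j := by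
  have hC : ∀ i j, 0 ≤ C i j := fun i j => (norm_nonneg _).trans (h i j)
  refine ContinuousLinearMap.opNorm_le_bound _
    (Finset.sum_nonneg fun i _ => Finset.sum_nonneg fun j _ => hC i j) fun ψ => ?_
  refine (norm_spinor_le_sum _).trans ?_
  rw [Finset.sum_mul]
  refine Finset.sum_le_sum fun i _ => ?_
  rw [matOp_apply, Finset.sum_mul]
  refine norm_sum_le_of_le _ fun j _ => ?_
  exact (T i j).le_of_opNorm_le_of_le (h i j) (PiLp.norm_apply_le ψ j)

/-- The operator on spinors that acts by `T` on every component. -/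
def diagOp (T : L2 →L[ℂ] L2) : Spinor →L[ℂ] Spinor :=
  (PiLp.continuousLinearEquiv 2 ℂ (fun _ : Fin 2 × Fin 2 => L2)).symm.toContinuousLinearMap ∘L
    ContinuousLinearMap.pi fun i => T ∘L PiLp.proj 2 (fun _ : Fin 2 × Fin 2 => L2) i

theorem diagOp_apply (T : L2 →L[ℂ] L2) (ψ : Spinor) (i : Fin 2 × Fin 2) :
    diagOp T ψ i = T (ψ i) := rfl

theorem rep_eq_diagOp (θ : ℝ) (a : 𝓢(Plane, ℂ)) : rep θ a = diagOp (leftMul θ a) := rfl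

theorem norm_diagOp_apply_le {T : L2 →L[ℂ] L2} {ψ : Spinor} {C : ℝ} (hC : 0 ≤ C)
    (h : ∀ i, ‖T (ψ i)‖ ≤ C * ‖ψ i‖) : ‖diagOp T ψ‖ ≤ C * ‖ψ‖ := by
  refine le_of_sq_le_sq ?_ (by positivity)
  rw [mul_pow, PiLp.norm_sq_eq_of_L2, PiLp.norm_sq_eq_of_L2, Finset.mul_sum]
  refine Finset.sum_le_sum fun i _ => ?_
  rw [← mul_pow]
  gcongr
  exact h i

theorem norm_diagOp_le (T : L2 →L[ℂ] L2) : ‖diagOp T‖ ≤ ‖T‖ :=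
  ContinuousLinearMap.opNorm_le_bound _ (norm_nonneg _) fun _ =>
    norm_diagOp_apply_le (norm_nonneg _) fun _ => T.le_opNorm _

theorem adjoint_diagOp (T : L2 →L[ℂ] L2) :
    ContinuousLinearMap.adjoint (diagOp T) = diagOp (ContinuousLinearMap.adjoint T) := by
  symm
  rw [ContinuousLinearMap.eq_adjoint_iff]
  intro ψ φ
  simp only [PiLp.inner_apply, diagOp_apply, ContinuousLinearMap.adjoint_inner_left]

theorem diagOp_toSpinor {T : L2 →L[ℂ] L2} {A : 𝓢(Plane, ℂ) → 𝓢(Plane, ℂ)}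
    (h : ∀ f, T (toL2 f) = toL2 (A f)) (ψ : Fin 2 × Fin 2 → 𝓢(Plane, ℂ)) :
    diagOp T (toSpinor ψ) = toSpinor fun i => A (ψ i) := by
  refine PiLp.ext fun i => ?_
  exact h (ψ i)

theorem tendsto_diagOp {T : ℕ → L2 →L[ℂ] L2} (h : ∀ v, Tendsto (fun n => T n v) atTop (𝓝 v))
    (ψ : Spinor) : Tendsto (fun n => diagOp (T n) ψ) atTop (𝓝 ψ) := by
  rw [(PiLp.homeomorph 2 (fun _ : Fin 2 × Fin 2 => L2)).isInducing.tendsto_nhds_iff, tendsto_pi_nhds]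
  exact fun i => h (ψ i)

theorem isCompactOperator_diagOp {T : L2 →L[ℂ] L2} (hT : IsCompactOperator T) :
    IsCompactOperator (diagOp T) := by
  have h1 : diagOp T = ∑ i, ((PiLp.continuousLinearEquiv 2 ℂ
      (fun _ : Fin 2 × Fin 2 => L2)).symm.toContinuousLinearMap ∘L
      ContinuousLinearMap.single ℂ (fun _ : Fin 2 × Fin 2 => L2) i) ∘L
      (T ∘L PiLp.proj 2 (fun _ : Fin 2 × Fin 2 => L2) i) := by
    ext1 ψ
    apply (PiLp.continuousLinearEquiv 2 ℂ (fun _ : Fin 2 × Fin 2 => L2)).injective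
    rw [_root_.sum_apply, map_sum]
    simp only [ContinuousLinearMap.comp_apply, ContinuousLinearEquiv.coe_coe,
      ContinuousLinearEquiv.apply_symm_apply, ContinuousLinearMap.single_apply]
    rw [Finset.univ_sum_single fun i => T (PiLp.proj 2 (fun _ : Fin 2 × Fin 2 => L2) i ψ)]
    rfl
  rw [h1]
  refine Finset.sum_induction _ (fun S : Spinor →L[ℂ] Spinor => IsCompactOperator S)
    (fun _ _ h2 h3 => h2.add h3) isCompactOperator_zero fun i _ => ?_
  have h4 : IsCompactOperator (T ∘L PiLp.proj 2 (fun _ : Fin 2 × Fin 2 => L2) i) := hT.comp_clm _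
  exact h4.clm_comp ((PiLp.continuousLinearEquiv 2 ℂ
    (fun _ : Fin 2 × Fin 2 => L2)).symm.toContinuousLinearMap ∘L
    ContinuousLinearMap.single ℂ (fun _ : Fin 2 × Fin 2 => L2) i)

/-! ### The Dirac operator on Schwartz spinors -/

theorem pauli3_eq : pauli3 = !![1, 0; 0, -1] := by
  ext i j
  fin_cases i <;> fin_cases j <;> simp [pauli3, pauli]

theorem pauli_isHermitian (μ : Fin 2) : (pauli μ).IsHermitian := by
  ext i j
  fin_cases μ <;> fin_cases i <;> fin_cases j <;> simp [pauli]

theorem pauli3_isHermitian : pauli3.IsHermitian := by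
  rw [pauli3_eq]
  ext i j
  fin_cases i <;> fin_cases j <;> simp

theorem gammaD_isHermitian (k : ℕ) (μ : Fin 2) : (gammaD k μ).IsHermitian := by
  rw [gammaD]
  split_ifs
  · rw [Matrix.IsHermitian, Matrix.conjTranspose_kronecker, (pauli_isHermitian μ).eq,
      Matrix.conjTranspose_one]
  · rw [Matrix.IsHermitian, Matrix.conjTranspose_kronecker, (pauli_isHermitian μ).eq,
      pauli3_isHermitian.eq]

theorem gammaX_isHermitian (k : ℕ) (μ : Fin 2) : (gammaX k μ).IsHermitian := by
  rw [gammaX]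
  split_ifs
  · rw [Matrix.IsHermitian, Matrix.conjTranspose_kronecker, (pauli_isHermitian μ).eq,
      pauli3_isHermitian.eq]
  · rw [Matrix.IsHermitian, Matrix.conjTranspose_kronecker, (pauli_isHermitian μ).eq,
      Matrix.conjTranspose_one]

theorem inner_partialDeriv (μ : Fin 2) (f g : 𝓢(Plane, ℂ)) :
    inner ℂ (toL2 (partialDeriv μ f)) (toL2 g) = -inner ℂ (toL2 f) (toL2 (partialDeriv μ g)) := by
  rw [inner_toL2, inner_toL2]
  have h := integral_mul_lineDerivOp_right_eq_neg_left (conj f) g (EuclideanSpace.single μ (1 : ℝ))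
    (μ := (volume : Measure Plane))
  have h1 : ∀ x, (starRingEnd ℂ) (partialDeriv μ f x) = partialDeriv μ (conj f) x := fun x => by
    rw [partialDeriv_conj, conj_apply]
  simp only [h1]
  exact (neg_eq_iff_eq_neg.2 h).symm

theorem inner_mulTildeX (θ : ℝ) (μ : Fin 2) (f g : 𝓢(Plane, ℂ)) :
    inner ℂ (toL2 (mulTildeX θ μ f)) (toL2 g) = inner ℂ (toL2 f) (toL2 (mulTildeX θ μ g)) := by
  rw [inner_toL2, inner_toL2]
  congr 1
  ext x
  rw [mulTildeX_apply, mulTildeX_apply, map_mul, tildeX, Complex.conj_ofReal]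
  ring

theorem diracSchwartz_apply (θ Ω : ℝ) (k : ℕ) (ψ : Fin 2 × Fin 2 → 𝓢(Plane, ℂ)) (i : Fin 2 × Fin 2) :
    diracSchwartz θ Ω k ψ i = ∑ μ, ∑ j, (gammaD k μ i j • (-Complex.I) • partialDeriv μ (ψ j)
      - (Ω : ℂ) • gammaX k μ i j • mulTildeX θ μ (ψ j)) := by
  have h1 : diracSchwartz θ Ω k ψ i = (∑ μ, ∑ j, (gammaD k μ i j • (-Complex.I) • partialDeriv μ
    - (Ω : ℂ) • gammaX k μ i j • mulTildeX θ μ) ∘ₗ LinearMap.proj j) ψ := rfl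
  rw [h1]
  simp only [LinearMap.sum_apply]
  rfl

/-- Both -i∂_μ and x̃_μ are symmetric, and their coefficient matrices are Hermitian. -/
theorem diracSchwartz_symmetric (θ Ω : ℝ) (k : ℕ) (φ ψ : Fin 2 × Fin 2 → 𝓢(Plane, ℂ)) :
    inner ℂ (toSpinor (diracSchwartz θ Ω k φ)) (toSpinor ψ) =
      inner ℂ (toSpinor φ) (toSpinor (diracSchwartz θ Ω k ψ)) := by
  simp only [PiLp.inner_apply, toSpinor_apply, diracSchwartz_apply, map_sum, sum_inner, inner_sum,
    map_sub, inner_sub_left, inner_sub_right, map_smul, inner_smul_left, inner_smul_right,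
    inner_partialDeriv, inner_mulTildeX]
  rw [Finset.sum_comm]
  conv_rhs => rw [Finset.sum_comm]
  refine Finset.sum_congr rfl fun μ _ => ?_
  rw [Finset.sum_comm]
  refine Finset.sum_congr rfl fun i _ => Finset.sum_congr rfl fun j _ => ?_
  have h1 : (starRingEnd ℂ) (gammaD k μ j i) = gammaD k μ i j := (gammaD_isHermitian k μ).apply i j
  have h2 : (starRingEnd ℂ) (gammaX k μ j i) = gammaX k μ i j := (gammaX_isHermitian k μ).apply i j
  rw [h1, h2, map_neg, Complex.conj_I, Complex.conj_ofReal]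
  ring

/-- The operator on spinors obtained from the expression of `D_k` when `∂_μ` and `x̃_μ` are replaced by
bounded operators. -/
def diracSymbol (Ω : ℝ) (k : ℕ) (P Q : Fin 2 → L2 →L[ℂ] L2) : Spinor →L[ℂ] Spinor :=
  matOp fun i j => ∑ μ, (gammaD k μ i j • (-Complex.I) • P μ - (Ω : ℂ) • gammaX k μ i j • Q μ)

/-- A bound for the coefficients of `D_k`. -/
def gammaBound (Ω : ℝ) (k : ℕ) : ℝ := ∑ i, ∑ j, ∑ μ, (‖gammaD k μ i j‖ + |Ω| * ‖gammaX k μ i j‖)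

theorem gammaBound_nonneg (Ω : ℝ) (k : ℕ) : 0 ≤ gammaBound Ω k := by
  unfold gammaBound
  positivity

theorem norm_diracSymbol_le (Ω : ℝ) (k : ℕ) {P Q : Fin 2 → L2 →L[ℂ] L2} {s : ℝ}
    (hP : ∀ μ, ‖P μ‖ ≤ s) (hQ : ∀ μ, ‖Q μ‖ ≤ s) : ‖diracSymbol Ω k P Q‖ ≤ gammaBound Ω k * s := by
  have h : ∀ i j, ‖∑ μ, (gammaD k μ i j • (-Complex.I) • P μ - (Ω : ℂ) • gammaX k μ i j • Q μ)‖ ≤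
      ∑ μ, (‖gammaD k μ i j‖ + |Ω| * ‖gammaX k μ i j‖) * s := by
    intro i j
    refine norm_sum_le_of_le _ fun μ _ => (norm_sub_le _ _).trans ?_
    rw [norm_smul, norm_smul, norm_smul, norm_smul, norm_neg, Complex.norm_I, one_mul,
      Complex.norm_real, Real.norm_eq_abs, add_mul, mul_assoc]
    gcongr
    · exact hP μ
    · exact hQ μ
  refine (norm_matOp_le h).trans_eq ?_
  rw [gammaBound]
  simp only [Finset.sum_mul]

theorem diracSymbol_toSpinor (Ω : ℝ) (k : ℕ) {P Q : Fin 2 → L2 →L[ℂ] L2}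
    {p q : Fin 2 → 𝓢(Plane, ℂ) → 𝓢(Plane, ℂ)} (hP : ∀ μ f, P μ (toL2 f) = toL2 (p μ f))
    (hQ : ∀ μ f, Q μ (toL2 f) = toL2 (q μ f)) (ψ : Fin 2 × Fin 2 → 𝓢(Plane, ℂ)) :
    diracSymbol Ω k P Q (toSpinor ψ) = toSpinor fun i => ∑ μ, ∑ j,
      (gammaD k μ i j • (-Complex.I) • p μ (ψ j) - (Ω : ℂ) • gammaX k μ i j • q μ (ψ j)) := by
  refine PiLp.ext fun i => ?_
  rw [diracSymbol, matOp_apply, toSpinor_apply]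
  simp only [_root_.sum_apply, _root_.sub_apply, _root_.smul_apply, toSpinor_apply, hP, hQ, map_sum,
    map_sub, map_smul]
  exact Finset.sum_comm

theorem diracSymbol_eq_comp (θ Ω : ℝ) (k : ℕ) {P Q : Fin 2 → L2 →L[ℂ] L2}
    (A : 𝓢(Plane, ℂ) → 𝓢(Plane, ℂ)) (hP : ∀ μ f, P μ (toL2 f) = toL2 (partialDeriv μ (A f)))
    (hQ : ∀ μ f, Q μ (toL2 f) = toL2 (mulTildeX θ μ (A f))) (ψ : Fin 2 × Fin 2 → 𝓢(Plane, ℂ)) :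
    diracSymbol Ω k P Q (toSpinor ψ) = toSpinor (diracSchwartz θ Ω k fun i => A (ψ i)) := by
  rw [diracSymbol_toSpinor Ω k hP hQ]
  exact congrArg toSpinor (funext fun i => (diracSchwartz_apply θ Ω k _ i).symm)

theorem diracSymbol_eq_commutator (θ Ω : ℝ) (k : ℕ) {P Q : Fin 2 → L2 →L[ℂ] L2}
    (A : 𝓢(Plane, ℂ) →ₗ[ℂ] 𝓢(Plane, ℂ))
    (hP : ∀ μ f, P μ (toL2 f) = toL2 (partialDeriv μ (A f) - A (partialDeriv μ f)))
    (hQ : ∀ μ f, Q μ (toL2 f) = toL2 (mulTildeX θ μ (A f) - A (mulTildeX θ μ f)))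
    (ψ : Fin 2 × Fin 2 → 𝓢(Plane, ℂ)) :
    diracSymbol Ω k P Q (toSpinor ψ) = toSpinor (diracSchwartz θ Ω k fun i => A (ψ i)) -
      toSpinor fun i => A (diracSchwartz θ Ω k ψ i) := by
  rw [diracSymbol_toSpinor Ω k hP hQ, ← map_sub]
  congr 1
  ext1 i
  rw [Pi.sub_apply, diracSchwartz_apply, diracSchwartz_apply, map_sum, ← Finset.sum_sub_distrib]
  refine Finset.sum_congr rfl fun μ _ => ?_
  rw [map_sum, ← Finset.sum_sub_distrib]
  refine Finset.sum_congr rfl fun j _ => ?_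
  rw [map_sub, map_smul, map_smul, map_smul, map_smul]
  simp only [smul_sub]
  abel

/-! ### Commutators and self-adjointness -/

/-- The bounded extension of `[D_k, π(a)]`. -/
def repCommutator (θ Ω : ℝ) (k : ℕ) (a : 𝓢(Plane, ℂ)) : Spinor →L[ℂ] Spinor :=
  diracSymbol Ω k (fun μ => leftMul θ (partialDeriv μ a))
    (fun μ => Complex.I • leftMul θ (partialDeriv μ a))

theorem repCommutator_toSpinor {θ : ℝ} (hθ : 0 < θ) (Ω : ℝ) (k : ℕ) (a : 𝓢(Plane, ℂ))
    (ψ : Fin 2 × Fin 2 → 𝓢(Plane, ℂ)) :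
    repCommutator θ Ω k a (toSpinor ψ) = toSpinor (diracSchwartz θ Ω k fun i => moyalProd θ a (ψ i)) -
      toSpinor fun i => moyalProd θ a (diracSchwartz θ Ω k ψ i) := by
  refine diracSymbol_eq_commutator θ Ω k (moyalLeft θ a) (fun μ f => ?_) (fun μ f => ?_) ψ
  · rw [leftMul_toL2 hθ]
    congr 1
    exact (sub_eq_of_eq_add (partialDeriv_moyalProd hθ μ a f)).symm
  · rw [_root_.smul_apply, leftMul_toL2 hθ, ← map_smul]
    congr 1
    refine (sub_eq_of_eq_add ?_).symm
    rw [add_comm]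
    exact mulTildeX_moyalProd hθ μ a f

theorem norm_repCommutator_le {θ : ℝ} (Ω : ℝ) (k : ℕ) {a : 𝓢(Plane, ℂ)} {s : ℝ}
    (h : ∀ μ, ‖leftMul θ (partialDeriv μ a)‖ ≤ s) : ‖repCommutator θ Ω k a‖ ≤ gammaBound Ω k * s :=
  norm_diracSymbol_le Ω k h fun μ => by
    rw [norm_smul, Complex.norm_I, one_mul]
    exact h μ

theorem norm_leftMul_partialDeriv_unitSeq_le {θ : ℝ} (hθ : 0 < θ) (n : ℕ) (μ : Fin 2) :
    ‖leftMul θ (partialDeriv μ (unitSeq n))‖ ≤ 2 * Real.pi / (n + 1) :=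
  (norm_leftMul_le hθ _).trans (fourierNorm_partialDeriv_unitSeq_le μ n)

theorem partialDeriv_schwartzMul (μ : Fin 2) (b f : 𝓢(Plane, ℂ)) :
    partialDeriv μ (schwartzMul b f) =
      schwartzMul (partialDeriv μ b) f + schwartzMul b (partialDeriv μ f) := by
  ext x
  refine partialDeriv_eq_of_hasDerivAt ?_
  have h := (hasDerivAt_line μ b x 0).mul (hasDerivAt_line μ f x 0)
  simp only [zero_smul, add_zero] at h
  rw [_root_.add_apply, schwartzMul_apply, schwartzMul_apply]
  refine h.congr_of_eventuallyEq (Eventually.of_forall fun t => ?_)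
  exact schwartzMul_apply b f _

theorem mulTildeX_schwartzMul_left (θ : ℝ) (μ : Fin 2) (b f : 𝓢(Plane, ℂ)) :
    mulTildeX θ μ (schwartzMul b f) = schwartzMul (mulTildeX θ μ b) f := by
  ext x
  simp only [mulTildeX_apply, schwartzMul_apply, mul_assoc]

theorem mulTildeX_schwartzMul_right (θ : ℝ) (μ : Fin 2) (b f : 𝓢(Plane, ℂ)) :
    mulTildeX θ μ (schwartzMul b f) = schwartzMul b (mulTildeX θ μ f) := by
  ext x
  simp only [mulTildeX_apply, schwartzMul_apply]
  ring

/-- The regularizer is L(u_n) M(u_n). D composed with it is bounded because derivatives become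
multiplications by x̃, which the Schwartz factors absorb. The commutator of D with its adjoint only
contains derivatives of conj u_n, of norm O(1/n). -/
theorem isSelfAdjoint_dirac {θ : ℝ} (hθ : 0 < θ) (Ω : ℝ) (k : ℕ) : IsSelfAdjoint (dirac θ Ω k) := by
  set e := unitSeq
  set e' : ℕ → 𝓢(Plane, ℂ) := fun n => conj (unitSeq n)
  refine isSelfAdjoint_closure_coreOperator (hι := toSpinor_injective) denseRange_toSpinor
    (diracSchwartz_symmetric θ Ω k)
    (fun n => diagOp (leftMul θ (e n) ∘L mulOp (e n)))
    (fun n => diracSymbol Ω k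
      (fun μ => (-Complex.I) • (leftMul θ (mulTildeX θ μ (e n)) ∘L mulOp (e n) -
        leftMul θ (e n) ∘L mulOp (mulTildeX θ μ (e n))))
      (fun μ => leftMul θ (e n) ∘L mulOp (mulTildeX θ μ (e n)) +
        Complex.I • (leftMul θ (partialDeriv μ (e n)) ∘L mulOp (e n))))
    (fun n => diracSymbol Ω k
      (fun μ => mulOp (partialDeriv μ (e' n)) ∘L leftMul θ (e' n) +
        mulOp (e' n) ∘L leftMul θ (partialDeriv μ (e' n)))
      (fun μ => Complex.I • (mulOp (e' n) ∘L leftMul θ (partialDeriv μ (e' n)))))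
    (fun n ψ i => moyalProd θ (e n) (schwartzMul (e n) (ψ i)))
    (fun n ψ i => schwartzMul (e' n) (moyalProd θ (e' n) (ψ i)))
    (fun n ψ => ?_) (fun n ψ => ?_) (fun n ψ => ?_) (fun n ψ => ?_) (fun v => ?_) ?_
  · refine diagOp_toSpinor (A := fun f => moyalProd θ (e n) (schwartzMul (e n) f)) (fun f => ?_) ψ
    rw [ContinuousLinearMap.comp_apply, mulOp_toL2, leftMul_toL2 hθ]
  · refine diracSymbol_eq_comp θ Ω k (fun f => moyalProd θ (e n) (schwartzMul (e n) f))
      (fun μ f => ?_) (fun μ f => ?_) ψ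
    · rw [partialDeriv_moyalProd_eq hθ, mulTildeX_schwartzMul_left, _root_.smul_apply,
        _root_.sub_apply, ContinuousLinearMap.comp_apply, ContinuousLinearMap.comp_apply, mulOp_toL2,
        mulOp_toL2, leftMul_toL2 hθ, leftMul_toL2 hθ, map_smul, map_sub]
    · rw [mulTildeX_moyalProd hθ, mulTildeX_schwartzMul_left, _root_.add_apply, _root_.smul_apply,
        ContinuousLinearMap.comp_apply, ContinuousLinearMap.comp_apply, mulOp_toL2,
        mulOp_toL2, leftMul_toL2 hθ, leftMul_toL2 hθ, map_add, map_smul]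
  · rw [adjoint_diagOp, ContinuousLinearMap.adjoint_comp, adjoint_mulOp, adjoint_leftMul hθ]
    refine diagOp_toSpinor (A := fun f => schwartzMul (e' n) (moyalProd θ (e' n) f)) (fun f => ?_) ψ
    rw [ContinuousLinearMap.comp_apply, leftMul_toL2 hθ, mulOp_toL2]
  · refine diracSymbol_eq_commutator θ Ω k (schwartzMul (e' n) ∘ₗ moyalLeft θ (e' n))
      (fun μ f => ?_) (fun μ f => ?_) ψ
    · change _ = toL2 (partialDeriv μ (schwartzMul (e' n) (moyalProd θ (e' n) f)) -
        schwartzMul (e' n) (moyalProd θ (e' n) (partialDeriv μ f)))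
      rw [partialDeriv_schwartzMul, partialDeriv_moyalProd hθ, _root_.add_apply,
        ContinuousLinearMap.comp_apply, ContinuousLinearMap.comp_apply, leftMul_toL2 hθ,
        leftMul_toL2 hθ, mulOp_toL2, mulOp_toL2, ← map_add, map_add (schwartzMul (e' n))]
      congr 1
      abel
    · change _ = toL2 (mulTildeX θ μ (schwartzMul (e' n) (moyalProd θ (e' n) f)) -
        schwartzMul (e' n) (moyalProd θ (e' n) (mulTildeX θ μ f)))
      rw [mulTildeX_schwartzMul_right, mulTildeX_moyalProd hθ, _root_.smul_apply,
        ContinuousLinearMap.comp_apply, leftMul_toL2 hθ, mulOp_toL2, map_add, map_smul,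
        add_sub_cancel_left, map_smul]
  · refine tendsto_diagOp (fun v => ?_) v
    have h1 := (tendsto_leftMul_unitSeq hθ v)
    have h2 : Tendsto (fun n => leftMul θ (e n) (mulOp (e n) v - v)) atTop (𝓝 0) := by
      rw [tendsto_zero_iff_norm_tendsto_zero]
      refine squeeze_zero (fun _ => norm_nonneg _) (fun n => ?_)
        (tendsto_iff_norm_sub_tendsto_zero.1 (tendsto_mulOp_unitSeq v))
      refine ((leftMul θ (e n)).le_of_opNorm_le (c := 1) ?_ _).trans_eq (one_mul _)
      exact (norm_leftMul_le hθ _).trans_eq (fourierNorm_unitSeq n)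
    have h3 := h2.add h1
    rw [zero_add] at h3
    refine h3.congr fun n => ?_
    rw [← map_add, sub_add_cancel, ContinuousLinearMap.comp_apply]
  · refine squeeze_zero (fun _ => norm_nonneg _) (fun n => ?_)
      (tendsto_const_div_succ (gammaBound Ω k * (4 * Real.pi)))
    have h1 : ∀ μ, ‖leftMul θ (partialDeriv μ (e' n))‖ ≤ 2 * Real.pi / (n + 1) := fun μ => by
      rw [partialDeriv_conj, norm_leftMul_conj hθ]
      exact norm_leftMul_partialDeriv_unitSeq_le hθ n μ
    have h2 : ‖leftMul θ (e' n)‖ ≤ 1 := by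
      rw [norm_leftMul_conj hθ]
      exact (norm_leftMul_le hθ _).trans_eq (fourierNorm_unitSeq n)
    have h3 : ‖mulOp (e' n)‖ ≤ 1 := norm_mulOp_le fun x => by
      rw [conj_apply, RCLike.norm_conj]
      exact norm_unitSeq_le n x
    have h4 : ∀ μ, ‖mulOp (partialDeriv μ (e' n))‖ ≤ 2 * Real.pi / (n + 1) := fun μ =>
      norm_mulOp_le fun x => by
        rw [partialDeriv_conj, conj_apply, RCLike.norm_conj]
        exact (norm_le_fourierNorm _ x).trans (fourierNorm_partialDeriv_unitSeq_le μ n)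
    have h5 : ∀ μ, ‖mulOp (e' n) ∘L leftMul θ (partialDeriv μ (e' n))‖ ≤ 2 * Real.pi / (n + 1) :=
      fun μ => (ContinuousLinearMap.opNorm_comp_le _ _).trans
        ((mul_le_mul h3 (h1 μ) (norm_nonneg _) zero_le_one).trans_eq (one_mul _))
    have h6 : ∀ μ, ‖mulOp (partialDeriv μ (e' n)) ∘L leftMul θ (e' n)‖ ≤ 2 * Real.pi / (n + 1) :=
      fun μ => (ContinuousLinearMap.opNorm_comp_le _ _).trans
        ((mul_le_mul (h4 μ) h2 (norm_nonneg _) (by positivity)).trans_eq (mul_one _))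
    have h7 : (2 * Real.pi / (n + 1) : ℝ) + 2 * Real.pi / (n + 1) = 4 * Real.pi / (n + 1) := by ring
    rw [mul_div_assoc]
    refine norm_diracSymbol_le Ω k (fun μ => ?_) (fun μ => ?_)
    · exact (norm_add_le_of_le (h6 μ) (h5 μ)).trans_eq h7
    · rw [norm_smul, Complex.norm_I, one_mul, ← h7]
      exact (h5 μ).trans (le_add_of_nonneg_left (by positivity))

/-! ### Components of the Dirac operator and relative bounds -/

/-- The operator `-i (∂_0 + s ∂_1)`. -/
def momentum (s : ℂ) : 𝓢(Plane, ℂ) →ₗ[ℂ] 𝓢(Plane, ℂ) :=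
  (-Complex.I) • (partialDeriv 0 + s • partialDeriv 1)

theorem momentum_apply (s : ℂ) (f : 𝓢(Plane, ℂ)) :
    momentum s f = (-Complex.I) • (partialDeriv 0 f + s • partialDeriv 1 f) := rfl

theorem mulTilde_apply (θ : ℝ) (s : ℂ) (f : 𝓢(Plane, ℂ)) :
    mulTilde θ s f = mulTildeX θ 0 f + s • mulTildeX θ 1 f := rfl

theorem tildeX_smul (θ : ℝ) (μ : Fin 2) (t : ℝ) (x : Plane) :
    tildeX θ μ (t • x) = (t : ℂ) * tildeX θ μ x := by
  simp [tildeX]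
  ring

theorem partialDeriv_mulTildeX (θ : ℝ) (μ ν : Fin 2) (f : 𝓢(Plane, ℂ)) :
    partialDeriv μ (mulTildeX θ ν f) = mulTildeX θ ν (partialDeriv μ f) +
      tildeX θ ν (EuclideanSpace.single μ (1 : ℝ)) • f := by
  ext x
  refine partialDeriv_eq_of_hasDerivAt ?_
  have h1 : ∀ t : ℝ, tildeX θ ν (x + t • EuclideanSpace.single μ (1 : ℝ)) =
      tildeX θ ν x + (t : ℂ) * tildeX θ ν (EuclideanSpace.single μ (1 : ℝ)) := by
    intro t
    rw [tildeX_add, tildeX_smul]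
  have h2 : HasDerivAt (fun t : ℝ => tildeX θ ν (x + t • EuclideanSpace.single μ (1 : ℝ)))
      (1 * tildeX θ ν (EuclideanSpace.single μ (1 : ℝ))) 0 := by
    simp only [h1]
    exact ((Complex.ofRealCLM.hasDerivAt (x := 0)).mul_const _).const_add _
  have h := h2.mul (hasDerivAt_line μ f x 0)
  simp only [zero_smul, add_zero] at h
  rw [_root_.add_apply, mulTildeX_apply, _root_.smul_apply, smul_eq_mul]
  rw [one_mul, add_comm] at h
  refine h.congr_of_eventuallyEq (Eventually.of_forall fun t => ?_)
  exact mulTildeX_apply θ ν f _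

/-- The canonical commutation relation: the commutator is a scalar, hence harmless in the relative
bound below. -/
theorem momentum_mulTilde (θ : ℝ) (s t : ℂ) (f : 𝓢(Plane, ℂ)) :
    momentum s (mulTilde θ t f) =
      mulTilde θ t (momentum s f) + (-Complex.I * (2 * (θ : ℂ)⁻¹) * (t - s)) • f := by
  have h00 : tildeX θ 0 (EuclideanSpace.single 0 (1 : ℝ)) = 0 := by simp [tildeX_zero]
  have h01 : tildeX θ 0 (EuclideanSpace.single 1 (1 : ℝ)) = -(2 * (θ : ℂ)⁻¹) := by simp [tildeX_zero]
  have h10 : tildeX θ 1 (EuclideanSpace.single 0 (1 : ℝ)) = 2 * (θ : ℂ)⁻¹ := by simp [tildeX_one]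
  have h11 : tildeX θ 1 (EuclideanSpace.single 1 (1 : ℝ)) = 0 := by simp [tildeX_one]
  simp only [momentum_apply, mulTilde_apply, map_add, map_smul, partialDeriv_mulTildeX, h00, h01, h10,
    h11]
  module

theorem inner_momentum (s : ℂ) (f g : 𝓢(Plane, ℂ)) :
    inner ℂ (toL2 (momentum s f)) (toL2 g) =
      inner ℂ (toL2 f) (toL2 (momentum ((starRingEnd ℂ) s) g)) := by
  simp only [momentum_apply, map_smul, map_add, inner_smul_left, inner_smul_right, inner_add_left,
    inner_add_right, inner_partialDeriv, map_neg, Complex.conj_I]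
  ring

theorem inner_mulTilde (θ : ℝ) (s : ℂ) (f g : 𝓢(Plane, ℂ)) :
    inner ℂ (toL2 (mulTilde θ s f)) (toL2 g) =
      inner ℂ (toL2 f) (toL2 (mulTilde θ ((starRingEnd ℂ) s) g)) := by
  simp only [mulTilde_apply, map_smul, map_add, inner_smul_left, inner_smul_right, inner_add_left,
    inner_add_right, inner_mulTildeX]

/-- With P and X for the momentum and x̃ operators, the cross terms of ‖Pu - ΩXv‖² and ‖P*v + ΩX*u‖²
cancel up to the scalar [P, X*], of modulus at most 4/θ. The term 2Ω · (4/θ) ‖u‖ ‖v‖ gives the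
constant 8Ω/θ. -/
theorem norm_mulTilde_pair_le {θ Ω : ℝ} (hθ : 0 < θ) (hΩ : 0 < Ω) {s t : ℂ}
    (hs : s = Complex.I ∨ s = -Complex.I) (ht : t = Complex.I ∨ t = -Complex.I) (u v : 𝓢(Plane, ℂ)) :
    Ω ^ 2 * (‖toL2 (mulTilde θ t v)‖ ^ 2 + ‖toL2 (mulTilde θ ((starRingEnd ℂ) t) u)‖ ^ 2) ≤
      ‖toL2 (momentum s u - (Ω : ℂ) • mulTilde θ t v)‖ ^ 2 +
      ‖toL2 (momentum ((starRingEnd ℂ) s) v + (Ω : ℂ) • mulTilde θ ((starRingEnd ℂ) t) u)‖ ^ 2 +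
      8 * Ω / θ * (‖toL2 u‖ ^ 2 + ‖toL2 v‖ ^ 2) := by
  set t' := (starRingEnd ℂ) t
  set s' := (starRingEnd ℂ) s
  set c : ℂ := -Complex.I * (2 * (θ : ℂ)⁻¹) * (t' - s) with hc
  have hcn : ‖c‖ ≤ 4 / θ := by
    have h1 : ‖t' - s‖ ≤ 2 := by
      refine (norm_sub_le _ _).trans ?_
      have h2 : ‖s‖ = 1 := by rcases hs with rfl | rfl <;> simp
      have h3 : ‖t'‖ = 1 := by rcases ht with rfl | rfl <;> simp [t']
      rw [h2, h3]
      norm_num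
    rw [hc, norm_mul, norm_mul, norm_neg, Complex.norm_I, norm_mul, norm_inv, Complex.norm_real,
      Real.norm_of_nonneg hθ.le, Complex.norm_ofNat, one_mul]
    calc 2 * θ⁻¹ * ‖t' - s‖ ≤ 2 * θ⁻¹ * 2 := by gcongr
      _ = 4 / θ := by ring
  have h1 : inner ℂ (toL2 (momentum s' v)) (toL2 (mulTilde θ t' u)) =
      inner ℂ (toL2 (mulTilde θ t v)) (toL2 (momentum s u)) + c * inner ℂ (toL2 v) (toL2 u) := by
    rw [inner_momentum, inner_mulTilde, Complex.conj_conj, momentum_mulTilde, map_add, map_smul,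
      inner_add_right, inner_smul_right]
  have h2 : |Complex.re (c * inner ℂ (toL2 v) (toL2 u))| ≤ 4 / θ * (‖toL2 v‖ * ‖toL2 u‖) := by
    refine (Complex.abs_re_le_norm _).trans ?_
    rw [norm_mul]
    exact mul_le_mul hcn (norm_inner_le_norm _ _) (norm_nonneg _) (by positivity)
  have h3 : ∀ a b : L2, ‖a - b‖ ^ 2 = ‖a‖ ^ 2 - 2 * Complex.re (inner ℂ b a) + ‖b‖ ^ 2 := fun a b => by
    rw [norm_sub_sq (𝕜 := ℂ), ← inner_re_symm]
    rfl
  have h4 : ∀ a b : L2, ‖a + b‖ ^ 2 = ‖a‖ ^ 2 + 2 * Complex.re (inner ℂ a b) + ‖b‖ ^ 2 := fun a b =>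
    norm_add_sq (𝕜 := ℂ) a b
  rw [map_sub, map_add, map_smul, map_smul, h3, h4, inner_smul_left, inner_smul_right, h1,
    Complex.conj_ofReal, Complex.re_ofReal_mul, Complex.re_ofReal_mul, norm_smul, norm_smul,
    Complex.norm_real, Real.norm_of_nonneg hΩ.le, Complex.add_re]
  have h5 := (abs_le.1 h2).1
  have h6 : 4 / θ * (‖toL2 v‖ * ‖toL2 u‖) * (2 * Ω) ≤
      8 * Ω / θ * (‖toL2 u‖ ^ 2 + ‖toL2 v‖ ^ 2) := by
    have h7 : 4 / θ * (‖toL2 v‖ * ‖toL2 u‖) * (2 * Ω) = 8 * Ω / θ * (‖toL2 v‖ * ‖toL2 u‖) := by ring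
    rw [h7]
    gcongr
    nlinarith [sq_nonneg (‖toL2 u‖ - ‖toL2 v‖), sq_nonneg ‖toL2 u‖, sq_nonneg ‖toL2 v‖]
  have h8 := mul_le_mul_of_nonneg_right h5 (show 0 ≤ 2 * Ω by positivity)
  nlinarith [sq_nonneg ‖toL2 (momentum s u)‖, sq_nonneg ‖toL2 (momentum s' v)‖]

theorem diracSchwartz_one (θ Ω : ℝ) (ψ : Fin 2 × Fin 2 → 𝓢(Plane, ℂ)) :
    diracSchwartz θ Ω 1 ψ (0, 0) =
      momentum Complex.I (ψ (0, 1)) - (Ω : ℂ) • mulTilde θ Complex.I (ψ (1, 0)) ∧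
    diracSchwartz θ Ω 1 ψ (0, 1) =
      momentum (-Complex.I) (ψ (0, 0)) + (Ω : ℂ) • mulTilde θ Complex.I (ψ (1, 1)) ∧
    diracSchwartz θ Ω 1 ψ (1, 0) =
      momentum Complex.I (ψ (1, 1)) - (Ω : ℂ) • mulTilde θ (-Complex.I) (ψ (0, 0)) ∧
    diracSchwartz θ Ω 1 ψ (1, 1) =
      momentum (-Complex.I) (ψ (1, 0)) + (Ω : ℂ) • mulTilde θ (-Complex.I) (ψ (0, 1)) := by
  refine ⟨?_, ?_, ?_, ?_⟩ <;>
  · simp only [diracSchwartz_apply, gammaD, gammaX, momentum_apply, mulTilde_apply, pauli3_eq,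
      Fin.sum_univ_two, Fintype.sum_prod_type, if_true, pauli]
    simp
    module

theorem diracSchwartz_two (θ Ω : ℝ) (ψ : Fin 2 × Fin 2 → 𝓢(Plane, ℂ)) :
    diracSchwartz θ Ω 2 ψ (0, 0) =
      momentum Complex.I (ψ (0, 1)) - (Ω : ℂ) • mulTilde θ Complex.I (ψ (1, 0)) ∧
    diracSchwartz θ Ω 2 ψ (0, 1) =
      momentum (-Complex.I) (ψ (0, 0)) - (Ω : ℂ) • mulTilde θ Complex.I (ψ (1, 1)) ∧
    diracSchwartz θ Ω 2 ψ (1, 0) =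
      -(momentum Complex.I (ψ (1, 1)) + (Ω : ℂ) • mulTilde θ (-Complex.I) (ψ (0, 0))) ∧
    diracSchwartz θ Ω 2 ψ (1, 1) =
      -(momentum (-Complex.I) (ψ (1, 0)) + (Ω : ℂ) • mulTilde θ (-Complex.I) (ψ (0, 1))) := by
  refine ⟨?_, ?_, ?_, ?_⟩ <;>
  · simp only [diracSchwartz_apply, gammaD, gammaX, momentum_apply, mulTilde_apply, pauli3_eq,
      Fin.sum_univ_two, Fintype.sum_prod_type, pauli]
    simp
    module

theorem norm_sq_toSpinor (ψ : Fin 2 × Fin 2 → 𝓢(Plane, ℂ)) : ‖toSpinor ψ‖ ^ 2 =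
    ‖toL2 (ψ (0, 0))‖ ^ 2 + ‖toL2 (ψ (0, 1))‖ ^ 2 + ‖toL2 (ψ (1, 0))‖ ^ 2 + ‖toL2 (ψ (1, 1))‖ ^ 2 := by
  rw [PiLp.norm_sq_eq_of_L2, Fintype.sum_prod_type]
  simp only [Fin.sum_univ_two, toSpinor_apply]
  ring

theorem norm_mulTilde_neg {θ : ℝ} (hθ : 0 < θ) (f : 𝓢(Plane, ℂ)) :
    ‖toL2 (mulTilde θ (-Complex.I) f)‖ = ‖toL2 (mulTilde θ Complex.I f)‖ := by
  have key : ∀ s t : ℂ, (s = Complex.I ∨ s = -Complex.I) → (t = Complex.I ∨ t = -Complex.I) →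
      ‖toL2 (mulTilde θ s f)‖ ≤ ‖toL2 (mulTilde θ t f)‖ := fun s t hs ht => by
    refine (norm_toL2_le_of_le (C := 1) fun x => ?_).trans_eq (one_mul _)
    rw [one_mul, norm_mulTilde_apply hθ hs, norm_mulTilde_apply hθ ht]
  exact le_antisymm (key _ _ (Or.inr rfl) (Or.inl rfl)) (key _ _ (Or.inl rfl) (Or.inr rfl))

/-- The components of Dψ group into two pairs of the form of `norm_mulTilde_pair_le`, one from the
rows (0,0) and (1,1), the other from (0,1) and (1,0). For k = 2 the signs of the last two rows do
not affect norms. -/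
theorem sum_norm_mulTilde_le {θ Ω : ℝ} (hθ : 0 < θ) (hΩ : 0 < Ω) {k : ℕ} (hk : k = 1 ∨ k = 2)
    (ψ : Fin 2 × Fin 2 → 𝓢(Plane, ℂ)) : Ω ^ 2 * ∑ i, ‖toL2 (mulTilde θ Complex.I (ψ i))‖ ^ 2 ≤
      ‖toSpinor (diracSchwartz θ Ω k ψ)‖ ^ 2 + 8 * Ω / θ * ‖toSpinor ψ‖ ^ 2 := by
  have hI : (starRingEnd ℂ) (-Complex.I) = Complex.I := by simp
  have h1 := norm_mulTilde_pair_le hθ hΩ (s := Complex.I) (t := Complex.I) (Or.inl rfl) (Or.inl rfl)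
    (ψ (0, 1)) (ψ (1, 0))
  rw [norm_sq_toSpinor, norm_sq_toSpinor, Fintype.sum_prod_type]
  simp only [Fin.sum_univ_two]
  rcases hk with rfl | rfl
  · have h2 := norm_mulTilde_pair_le hθ hΩ (s := Complex.I) (t := -Complex.I) (Or.inl rfl) (Or.inr rfl)
      (ψ (1, 1)) (ψ (0, 0))
    obtain ⟨e1, e2, e3, e4⟩ := diracSchwartz_one θ Ω ψ
    rw [e1, e2, e3, e4]
    rw [hI, Complex.conj_I, norm_mulTilde_neg hθ] at h2
    rw [Complex.conj_I, norm_mulTilde_neg hθ] at h1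
    linarith
  · have h2 := norm_mulTilde_pair_le hθ hΩ (s := -Complex.I) (t := Complex.I) (Or.inr rfl) (Or.inl rfl)
      (ψ (0, 0)) (ψ (1, 1))
    obtain ⟨e1, e2, e3, e4⟩ := diracSchwartz_two θ Ω ψ
    rw [e1, e2, e3, e4, map_neg, map_neg, norm_neg, norm_neg]
    rw [hI, Complex.conj_I, norm_mulTilde_neg hθ] at h2
    rw [Complex.conj_I, norm_mulTilde_neg hθ] at h1
    linarith

/-- Truncation to bounded regions is controlled by the graph norm of the Dirac operator. -/
theorem norm_diagOp_mulOp_sub_le {θ Ω : ℝ} (hθ : 0 < θ) (hΩ : 0 < Ω) {k : ℕ} (hk : k = 1 ∨ k = 2) :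
    ∃ C, 0 ≤ C ∧ ∀ n ψ, ‖(diagOp (mulOp (unitSeq n)) - 1) (toSpinor ψ)‖ ≤
      C / (n + 1) * (‖toSpinor ψ‖ + ‖toSpinor (diracSchwartz θ Ω k ψ)‖) := by
  set M := 1 + √(8 * Ω / θ) with hM
  refine ⟨Real.pi * θ / Ω * M, by positivity, fun n ψ => ?_⟩
  have h1 : (diagOp (mulOp (unitSeq n)) - 1) (toSpinor ψ) =
      toSpinor fun i => schwartzMul (unitSeq n) (ψ i) - ψ i := by
    rw [_root_.sub_apply, one_apply_eq_self, diagOp_toSpinor (mulOp_toL2 (unitSeq n)), ← map_sub]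
    rfl
  rw [h1]
  refine le_of_sq_le_sq ?_ (by positivity)
  have h2 : ‖toSpinor fun i => schwartzMul (unitSeq n) (ψ i) - ψ i‖ ^ 2 ≤
      (Real.pi * θ / (n + 1)) ^ 2 * ∑ i, ‖toL2 (mulTilde θ Complex.I (ψ i))‖ ^ 2 := by
    rw [PiLp.norm_sq_eq_of_L2, Finset.mul_sum]
    refine Finset.sum_le_sum fun i _ => ?_
    rw [← mul_pow, toSpinor_apply, map_sub]
    gcongr
    exact norm_schwartzMul_unitSeq_sub_le hθ (Or.inl rfl) n (ψ i)
  have h3 := sum_norm_mulTilde_le hθ hΩ hk ψ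
  set S := ∑ i, ‖toL2 (mulTilde θ Complex.I (ψ i))‖ ^ 2
  set x := ‖toSpinor ψ‖
  set y := ‖toSpinor (diracSchwartz θ Ω k ψ)‖
  -- M exceeds both 1 and √(8Ω/θ), so the quadratic bound becomes one by the graph norm x + y.
  have h4 : y ^ 2 + 8 * Ω / θ * x ^ 2 ≤ (M * (x + y)) ^ 2 := by
    have h5 : 8 * Ω / θ = √(8 * Ω / θ) ^ 2 := (Real.sq_sqrt (by positivity)).symm
    rw [h5, ← mul_pow]
    have h6 : √(8 * Ω / θ) * x ≤ M * x := by rw [hM]; gcongr; linarith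
    have h7 : y ≤ M * y := le_mul_of_one_le_left (norm_nonneg _) (by rw [hM]; linarith [Real.sqrt_nonneg (8 * Ω / θ)])
    have hx : 0 ≤ √(8 * Ω / θ) * x := by positivity
    have hy : 0 ≤ y := norm_nonneg _
    rw [mul_add]
    nlinarith [mul_nonneg (hx.trans h6) (hy.trans h7)]
  calc _ ≤ (Real.pi * θ / (n + 1)) ^ 2 * S := h2
    _ = (Real.pi * θ / Ω / (n + 1)) ^ 2 * (Ω ^ 2 * S) := by field_simp
    _ ≤ (Real.pi * θ / Ω / (n + 1)) ^ 2 * (M * (x + y)) ^ 2 := by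
      gcongr
      exact h3.trans h4
    _ = _ := by ring

/-! ### The harmonic triples -/

theorem dirac_isClosable (θ Ω : ℝ) (k : ℕ) :
    (coreOperator toSpinor toSpinor_injective (diracSchwartz θ Ω k)).IsClosable :=
  coreOperator_isClosable denseRange_toSpinor (diracSchwartz_symmetric θ Ω k)

theorem rep_toSpinor {θ : ℝ} (hθ : 0 < θ) (a : 𝓢(Plane, ℂ)) (ψ : Fin 2 × Fin 2 → 𝓢(Plane, ℂ)) :
    rep θ a (toSpinor ψ) = toSpinor fun i => moyalProd θ a (ψ i) :=
  diagOp_toSpinor (leftMul_toL2 hθ a) ψ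

theorem isCommutator_repCommutator {θ : ℝ} (hθ : 0 < θ) (Ω : ℝ) (k : ℕ) (a : 𝓢(Plane, ℂ)) :
    (harmonicTriple θ Ω k).IsCommutator a (repCommutator θ Ω k a) := fun ψ =>
  coreOperator_closure_commutator (dirac_isClosable θ Ω k) (rep θ a) (repCommutator θ Ω k a)
    (fun φ i => moyalProd θ a (φ i)) (rep_toSpinor hθ a) (repCommutator_toSpinor hθ Ω k a) ψ

/-- In Fourier space all ξ_μ â(ξ) vanish, so â is zero off the origin, and everywhere by continuity.
-/
theorem partialDeriv_injective {a : 𝓢(Plane, ℂ)} (h : ∀ μ, partialDeriv μ a = 0) : a = 0 := by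
  have h1 : ∀ ξ ∈ ({0}ᶜ : Set Plane), 𝓕 a ξ = (0 : 𝓢(Plane, ℂ)) ξ := by
    intro ξ hξ
    obtain ⟨μ, hμ⟩ : ∃ μ, ξ μ ≠ 0 := by
      by_contra! hcon
      exact hξ (PiLp.ext hcon)
    have h2 := fourier_partialDeriv μ a ξ
    rw [h μ, FourierTransform.fourier_zero] at h2
    have h3 : 2 * Real.pi * Complex.I * (ξ μ : ℂ) ≠ 0 := by
      have h4 : (ξ μ : ℂ) ≠ 0 := by exact_mod_cast hμ
      have h5 : (Real.pi : ℂ) ≠ 0 := by exact_mod_cast Real.pi_ne_zero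
      simp [h4, h5]
    exact (mul_eq_zero.1 h2.symm).resolve_left h3
  have h2 : 𝓕 a = 0 := DFunLike.coe_injective
    (Continuous.ext_on (dense_compl_singleton (0 : Plane)) (𝓕 a).continuous
      (0 : 𝓢(Plane, ℂ)).continuous h1)
  rw [← FourierTransform.fourierInv_fourier_eq a (F := 𝓢(Plane, ℂ)), h2, FourierTransform.fourierInv_zero]

theorem momentum_moyalProd {θ : ℝ} (hθ : 0 < θ) (s : ℂ) (a f : 𝓢(Plane, ℂ)) :
    momentum s (moyalProd θ a f) - moyalProd θ a (momentum s f) = moyalProd θ (momentum s a) f := by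
  simp only [momentum_apply, partialDeriv_moyalProd hθ, moyalProd_smul_right, moyalProd_smul_left,
    moyalProd_add_right, moyalProd_add_left]
  module

theorem diracSchwartz_single (θ Ω : ℝ) {k : ℕ} (hk : k = 1 ∨ k = 2) (f : 𝓢(Plane, ℂ)) :
    diracSchwartz θ Ω k (fun i => if i = (0, 1) then f else 0) (0, 0) = momentum Complex.I f ∧
    diracSchwartz θ Ω k (fun i => if i = (0, 0) then f else 0) (0, 1) = momentum (-Complex.I) f := by
  rcases hk with rfl | rfl
  · rw [(diracSchwartz_one θ Ω _).1, (diracSchwartz_one θ Ω _).2.1]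
    simp
  · rw [(diracSchwartz_two θ Ω _).1, (diracSchwartz_two θ Ω _).2.1]
    simp

/-- Two matrix entries of [D, π(a)] are L((-i)(∂_0 ± i∂_1)a). If both vanish, faithfulness of L
gives ∂_0 a = ∂_1 a = 0. -/
theorem eq_zero_of_isCommutator_zero {θ Ω : ℝ} (hθ : 0 < θ) {k : ℕ} (hk : k = 1 ∨ k = 2)
    {a : 𝓢(Plane, ℂ)} (ha : (harmonicTriple θ Ω k).IsCommutator a 0) : a = 0 := by
  have h1 : ∀ ψ, (diracSchwartz θ Ω k fun i => moyalProd θ a (ψ i)) =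
      fun i => moyalProd θ a (diracSchwartz θ Ω k ψ i) := by
    intro ψ
    obtain ⟨hu, h2⟩ := coreOperator_closure_apply (dirac_isClosable θ Ω k) ψ
    obtain ⟨hv, h3⟩ := ha ⟨toSpinor ψ, hu⟩
    obtain ⟨hw, h4⟩ := isCommutator_repCommutator hθ Ω k a ⟨toSpinor ψ, hu⟩
    rw [← h3, repCommutator_toSpinor hθ, _root_.zero_apply, sub_eq_zero] at h4
    exact toSpinor_injective h4
  have hz : moyalProd θ a 0 = 0 := (moyalLeft θ a).map_zero
  have hmap : ∀ (j : Fin 2 × Fin 2) f, (fun i => moyalProd θ a (if i = j then f else 0)) =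
      fun i => if i = j then moyalProd θ a f else 0 := fun j f => by
    ext1 i
    split_ifs
    · rfl
    · exact hz
  have h2 : ∀ s, (∀ f, momentum s (moyalProd θ a f) = moyalProd θ a (momentum s f)) →
      momentum s a = 0 := by
    intro s hs
    apply leftMul_injective hθ
    refine clm_ext_toL2 fun f => ?_
    have h3 := momentum_moyalProd hθ s a f
    rw [hs, sub_self] at h3
    have h4 := moyalProd_smul_left θ 0 0 f
    rw [zero_smul, zero_smul] at h4
    rw [leftMul_toL2 hθ, leftMul_toL2 hθ, ← h3, h4]
  have h3 : momentum Complex.I a = 0 := h2 _ fun f => by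
    have h4 := congrFun (h1 fun i => if i = (0, 1) then f else 0) (0, 0)
    rw [hmap, (diracSchwartz_single θ Ω hk _).1, (diracSchwartz_single θ Ω hk _).1] at h4
    exact h4
  have h4 : momentum (-Complex.I) a = 0 := h2 _ fun f => by
    have h4 := congrFun (h1 fun i => if i = (0, 0) then f else 0) (0, 1)
    rw [hmap, (diracSchwartz_single θ Ω hk _).2, (diracSchwartz_single θ Ω hk _).2] at h4
    exact h4
  rw [momentum_apply] at h3 h4
  have hI : -Complex.I ≠ 0 := by simp
  have h5 := (smul_eq_zero.1 h3).resolve_left hI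
  have h6 := (smul_eq_zero.1 h4).resolve_left hI
  have h7 : (2 : ℂ) • partialDeriv 0 a = 0 := by
    rw [← add_zero (0 : 𝓢(Plane, ℂ))]
    nth_rw 1 [← h5]
    rw [← h6]
    module
  have h8 : partialDeriv 0 a = 0 := (smul_eq_zero.1 h7).resolve_left two_ne_zero
  rw [h8, zero_add] at h5
  refine partialDeriv_injective fun μ => ?_
  fin_cases μ
  · exact h8
  · exact (smul_eq_zero.1 h5).resolve_left Complex.I_ne_zero

/-- As D R = 1 + zR, the operator R is bounded into the graph norm, so (M_n - 1)R = O(1/n) in norm.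
Thus π(a)R is the norm limit of the compact operators π(a) M_n R. -/
theorem isCompactOperator_rep_resolvent {θ Ω : ℝ} (hθ : 0 < θ) (hΩ : 0 < Ω) {k : ℕ}
    (hk : k = 1 ∨ k = 2) (a : 𝓢(Plane, ℂ)) (z : ℂ) (R : Spinor →L[ℂ] Spinor)
    (hR : (harmonicTriple θ Ω k).IsResolvent z R) : IsCompactOperator (rep θ a ∘L R) := by
  obtain ⟨C, hC0, hC⟩ := norm_diagOp_mulOp_sub_le hθ hΩ hk
  set M : ℕ → Spinor →L[ℂ] Spinor := fun n => diagOp (mulOp (unitSeq n)) with hM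
  have h1 : ∀ n, ‖(M n - 1) ∘L R‖ ≤ C * (‖R‖ + (1 + ‖z‖ * ‖R‖)) / (n + 1) := by
    intro n
    refine ContinuousLinearMap.opNorm_le_bound _ (by positivity) fun φ => ?_
    obtain ⟨h, h2⟩ := hR.1 φ
    have h3 := coreOperator_closure_norm_le (dirac_isClosable θ Ω k) (M n - 1) (C / (n + 1)) (hC n)
      ⟨R φ, h⟩
    have h4 : ‖dirac θ Ω k ⟨R φ, h⟩‖ ≤ (1 + ‖z‖ * ‖R‖) * ‖φ‖ := by
      have h5 : dirac θ Ω k ⟨R φ, h⟩ = φ + z • R φ := sub_eq_iff_eq_add.1 h2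
      rw [h5, add_mul, one_mul, mul_assoc]
      refine norm_add_le_of_le le_rfl ?_
      rw [norm_smul]
      gcongr
      exact R.le_opNorm φ
    calc ‖((M n - 1) ∘L R) φ‖ ≤ C / (n + 1) * (‖R φ‖ + ‖dirac θ Ω k ⟨R φ, h⟩‖) := h3
      _ ≤ C / (n + 1) * (‖R‖ * ‖φ‖ + (1 + ‖z‖ * ‖R‖) * ‖φ‖) := by
        gcongr
        exact R.le_opNorm φ
      _ = _ := by ring
  refine isCompactOperator_of_tendsto (l := atTop) (F := fun n => (rep θ a ∘L M n) ∘L R) ?_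
    (Eventually.of_forall fun n => ?_)
  · rw [tendsto_iff_norm_sub_tendsto_zero]
    refine squeeze_zero (fun _ => norm_nonneg _) (fun n => ?_)
      (tendsto_const_div_succ (‖rep θ a‖ * (C * (‖R‖ + (1 + ‖z‖ * ‖R‖)))))
    have h2 : (rep θ a ∘L M n) ∘L R - rep θ a ∘L R = rep θ a ∘L ((M n - 1) ∘L R) := by
      ext1 φ
      simp
    rw [h2, mul_div_assoc]
    refine (ContinuousLinearMap.opNorm_comp_le _ _).trans ?_
    gcongr
    exact h1 n
  · have h2 : IsCompactOperator (rep θ a ∘L M n) :=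
      isCompactOperator_diagOp (isCompactOperator_leftMul_mulOp hθ a (unitSeq n))
    exact h2.comp_clm R

theorem isSpectralTriple_harmonicTriple {θ Ω : ℝ} (hθ : 0 < θ) (hΩ : 0 < Ω) {k : ℕ}
    (hk : k = 1 ∨ k = 2) : (harmonicTriple θ Ω k).IsSpectralTriple where
  separable := by
    have : Fact ((2 : ℝ≥0∞) ≠ ⊤) := ⟨by norm_num⟩
    have h : TopologicalSpace.SeparableSpace L2 := inferInstance
    exact (PiLp.homeomorph 2 (fun _ : Fin 2 × Fin 2 => L2)).symm.surjective.denseRange.separableSpace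
      (PiLp.homeomorph 2 (fun _ : Fin 2 × Fin 2 => L2)).symm.continuous
  prod_add := moyalProd_add_right θ
  add_prod := moyalProd_add_left θ
  smul_prod := moyalProd_smul_left θ
  prod_smul := moyalProd_smul_right θ
  prod_assoc := moyalProd_assoc hθ
  inv_add := conj_add
  inv_smul := conj_smul
  inv_inv := conj_conj
  inv_prod := conj_moyalProd θ
  rep_add a b := by
    ext1 ψ
    refine PiLp.ext fun i => ?_
    change leftMul θ (a + b) (ψ i) = leftMul θ a (ψ i) + leftMul θ b (ψ i)
    rw [leftMul_add hθ, _root_.add_apply]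
  rep_smul t a := by
    ext1 ψ
    refine PiLp.ext fun i => ?_
    change leftMul θ (t • a) (ψ i) = t • leftMul θ a (ψ i)
    rw [leftMul_smul hθ, _root_.smul_apply]
  rep_prod a b := by
    ext1 ψ
    refine PiLp.ext fun i => ?_
    change leftMul θ (moyalProd θ a b) (ψ i) = leftMul θ a (leftMul θ b (ψ i))
    rw [leftMul_moyalProd hθ, ContinuousLinearMap.comp_apply]
  rep_inv a := by
    change rep θ (conj a) = ContinuousLinearMap.adjoint (rep θ a)
    rw [rep_eq_diagOp, rep_eq_diagOp, adjoint_diagOp, adjoint_leftMul hθ]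
  rep_faithful a b hab := by
    apply leftMul_injective hθ
    ext1 v
    have h := congrArg (fun T : Spinor →L[ℂ] Spinor => T (WithLp.toLp 2 fun _ => v) (0, 0)) hab
    exact h
  dense_domain := by
    refine denseRange_toSpinor.mono ?_
    rintro _ ⟨ψ, rfl⟩
    exact (coreOperator_closure_apply (dirac_isClosable θ Ω k) ψ).1
  self_adjoint := isSelfAdjoint_dirac hθ Ω k
  rep_domain a ψ hψ := (isCommutator_repCommutator hθ Ω k a ⟨ψ, hψ⟩).1
  bounded_commutator a := ⟨_, isCommutator_repCommutator hθ Ω k a⟩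
  compact_resolvent := isCompactOperator_rep_resolvent hθ hΩ hk

theorem isApproxUnit_unitSeq {θ : ℝ} (hθ : 0 < θ) (Ω : ℝ) (k : ℕ) :
    (harmonicTriple θ Ω k).IsApproxUnit unitSeq where
  norm_le n := (norm_diagOp_le _).trans ((norm_leftMul_le hθ _).trans_eq (fourierNorm_unitSeq n))
  tendsto_apply ψ := tendsto_diagOp (tendsto_leftMul_unitSeq hθ) ψ
  tendsto_prod a := by
    rw [tendsto_iff_norm_sub_tendsto_zero]
    refine squeeze_zero (fun _ => norm_nonneg _) (fun n => ?_)
      (tendsto_iff_norm_sub_tendsto_zero.1 (tendsto_leftMul_unitSeq_moyalProd hθ a))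
    exact norm_diagOp_le (leftMul θ (moyalProd θ (unitSeq n) a) - leftMul θ a)

theorem isSpectralMetricSpace_harmonicTriple {θ Ω : ℝ} (hθ : 0 < θ) (hΩ : 0 < Ω) {k : ℕ}
    (hk : k = 1 ∨ k = 2) : (harmonicTriple θ Ω k).IsSpectralMetricSpace where
  toIsSpectralTriple := isSpectralTriple_harmonicTriple hθ hΩ hk
  nondegenerate ψ := mem_closure_of_tendsto ((isApproxUnit_unitSeq hθ Ω k).tendsto_apply ψ)
    (Eventually.of_forall fun n => Submodule.subset_span ⟨unitSeq n, ψ, rfl⟩)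
  metric_commutant := by
    refine Set.Subset.antisymm (fun a ha => eq_zero_of_isCommutator_zero hθ hk ha) ?_
    rintro _ rfl
    have h := isCommutator_repCommutator hθ Ω k 0
    have h0 : repCommutator θ Ω k 0 = 0 := by
      rw [← norm_le_zero_iff]
      refine (norm_repCommutator_le (s := 0) Ω k fun μ => ?_).trans_eq (mul_zero _)
      have h1 := leftMul_sub hθ (0 : 𝓢(Plane, ℂ)) 0
      rw [sub_self, sub_self] at h1
      rw [map_zero, h1, norm_zero]
    rwa [h0] at h

/-- On the spinor with four equal components f of `exists_inner_moyalProd_le`, the form of 1 - π(a)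
is at least half the squared norm. -/
theorem half_le_norm_rep_sub_one {θ : ℝ} (hθ : 0 < θ) (a : 𝓢(Plane, ℂ)) : 1 / 2 ≤ ‖rep θ a - 1‖ := by
  obtain ⟨f, hf, h⟩ := exists_inner_moyalProd_le hθ a
  set ψ := toSpinor fun _ => f with hψ
  have h1 : ‖ψ‖ ^ 2 = 4 * ‖toL2 f‖ ^ 2 := by
    rw [hψ, norm_sq_toSpinor]
    ring
  have h2 : ‖inner ℂ ψ (rep θ a ψ)‖ ≤ 1 / 2 * ‖ψ‖ ^ 2 := by
    have h3 : inner ℂ ψ (rep θ a ψ) = 4 * inner ℂ (toL2 f) (toL2 (moyalProd θ a f)) := by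
      rw [hψ, rep_toSpinor hθ, PiLp.inner_apply]
      simp only [toSpinor_apply, Finset.sum_const, Finset.card_univ, Fintype.card_prod, Fintype.card_fin]
      rw [nsmul_eq_mul]
      norm_num
    rw [h3, h1, norm_mul, Complex.norm_ofNat]
    linarith
  have h3 : ‖inner ℂ ψ ((rep θ a - 1) ψ)‖ ≤ ‖rep θ a - 1‖ * ‖ψ‖ ^ 2 := by
    refine (norm_inner_le_norm _ _).trans ?_
    rw [sq, ← mul_assoc, mul_comm (‖rep θ a - 1‖ * ‖ψ‖)]
    gcongr
    exact (rep θ a - 1).le_opNorm ψ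
  have h4 : ‖ψ‖ ^ 2 - ‖inner ℂ ψ (rep θ a ψ)‖ ≤ ‖inner ℂ ψ ((rep θ a - 1) ψ)‖ := by
    rw [_root_.sub_apply, one_apply_eq_self, inner_sub_right, norm_sub_rev]
    refine le_trans (le_of_eq ?_) (norm_sub_norm_le _ _)
    rw [inner_self_eq_norm_sq_to_K]
    simp
  have h5 : 0 < ‖ψ‖ ^ 2 := by rw [h1]; positivity
  refine le_of_mul_le_mul_right ?_ h5
  linarith

theorem exists_edist_eq_top {θ Ω : ℝ} (hθ : 0 < θ) (hΩ : 0 < Ω) {k : ℕ} (hk : k = 1 ∨ k = 2) :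
    ∃ ρ σ : (harmonicTriple θ Ω k).State, edist ρ σ = ⊤ := by
  have hB := gammaBound_nonneg Ω k
  -- The commutator with u_n has norm at most gammaBound · 2π/(n+1), so (n+1)/c times u_n has
  -- seminorm at most 1; the summand 1 keeps c positive without a lower bound for the coefficients.
  set c := 2 * Real.pi * (gammaBound Ω k + 1) with hc
  have hc0 : 0 < c := by positivity
  refine TripleData.exists_edist_eq_top (isSpectralTriple_harmonicTriple hθ hΩ hk)
    (isApproxUnit_unitSeq hθ Ω k) (r := fun n => (n + 1) / c) ?_ (fun n => ?_)
    (half_le_norm_rep_sub_one hθ)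
  · exact (tendsto_atTop_add_const_right _ 1 tendsto_natCast_atTop_atTop).atTop_div_const hc0
  · refine (iInf₂_le _ (isCommutator_repCommutator hθ Ω k _)).trans ?_
    rw [← ofReal_norm, ENNReal.ofReal_le_one]
    refine (norm_repCommutator_le (s := (gammaBound Ω k + 1)⁻¹) Ω k fun μ => ?_).trans ?_
    · rw [map_smul, leftMul_smul hθ, norm_smul, Complex.norm_real, Real.norm_of_nonneg (by positivity)]
      calc (n + 1 : ℝ) / c * ‖leftMul θ (partialDeriv μ (unitSeq n))‖
          ≤ (n + 1) / c * (2 * Real.pi / (n + 1)) := by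
            gcongr
            exact norm_leftMul_partialDeriv_unitSeq_le hθ n μ
        _ = _ := by rw [hc]; field_simp
    · rw [← div_eq_mul_inv, div_le_one (by positivity)]
      linarith

end Moyal

end

theorem mainTheorem4 (θ Ω : ℝ) (hθ : 0 < θ) (hΩ : 0 < Ω) (hΩ1 : Ω ≤ 1)
    (k : ℕ) (hk : k = 1 ∨ k = 2) :
    (Moyal.harmonicTriple θ Ω k).IsSpectralMetricSpace ∧
    Infinite (ConnectedComponents (Moyal.harmonicTriple θ Ω k).State) ∧
    ∀ ρ : (Moyal.harmonicTriple θ Ω k).State, IsPathConnected (connectedComponent ρ) := by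
  have hX := Moyal.isSpectralTriple_harmonicTriple hθ hΩ hk
  have hu := Moyal.isApproxUnit_unitSeq hθ Ω k
  obtain ⟨ρ, σ, h⟩ := Moyal.exists_edist_eq_top hθ hΩ hk
  refine ⟨Moyal.isSpectralMetricSpace_harmonicTriple hθ hΩ hk,
    TripleData.infinite_connectedComponents hX hu h, fun τ => ?_⟩
  obtain ⟨h1, h2⟩ := TripleData.connectedComponent_eq_ball hX hu τ
  rwa [h1]
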